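/- Let $A,A^*$ be the annihilation and creation operators on $\mathcal H=\ell^2(\mathbb N)$ (one bosonic mode, $[A,A^*]=1$), let $\mathcal S\subset\mathcal H$ be the space of vectors that lie in the maximal domain of every noncommutative polynomial $f(A,A^*)$, and regard polynomials $f(A,A^*)$ as operators with domain $\mathcal S$. Let $\mathcal B$ be the set of pairs $g=(\tau,\theta)\in\mathbb C^2$ with $|\tau|^2-|\theta|^2=1$, a topological group under composition of the Bogoliubov transformations $$a_g=\tau A+\theta A^*,\qquad a_g^*=\bar\tau A^*+\bar\theta A .$$ Let $U$ be a self-adjoint operator on $\mathcal H$ such that $\mathrm{Tr}\big(f(A,A^*)^*f(A,A^*)e^{-U}\big)$ is defined and finite for all polynomials $f$: $U$ has an orthonormal basis of eigenvectors $\psi_n\in\mathcal S$, with eigenvalues $E_n$, and $\sum_n e^{-E_n}\|f(A,A^*)\psi_n\|^2<\infty$. Put $\rho=Z^{-1}e^{-U}$ with $Z=\mathrm{Tr}\,e^{-U}$. Let $\mathbb L_2(\rho)$ be the completion of the bounded operators in the norm $\|f\|^2=\mathrm{Tr}\,|\rho^{1/4}f\rho^{1/4}|^2$; through $f\mapsto\rho^{1/4}f\rho^{1/4}$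 it is the space of Hilbert–Schmidt operators, and it also contains all polynomials $f(A,A^*)$. More generally an operator $T$ belongs to $\mathbb L_2(\rho)$ if $\rho^{1/4}T\rho^{1/4}$ is an everywhere defined Hilbert–Schmidt operator. **Theorem.** 1. For every $g\in\mathcal B$ there is a unitary $W$ with $WAW^*=a_g$ and $WA^*W^*=a_g^*$ on $\mathcal S=W\mathcal S$. For any operator $T=T(A,A^*)$, the operator $T(a_g,a_g^*):=WTW^*$ does not depend on the choice of $W$; for polynomials it is obtained by literal substitution, and if $U$ is the closure of a polynomial in $A,A^*$ then $U(a_g,a_g^*)$ is the closure of the substituted polynomial. The operators $e^{-pU(a_g,a_g^*)}$, $p\ge0$, are well defined and $\mathrm{Tr}\,e^{-U(a_g,a_g^*)}=Z\in(0,\infty)$. Put $\rho_g=Z^{-1}e^{-U(a_g,a_g^*)}$. 2. The formula $$V_g(T)=\rho^{-1/4}\rho_g^{1/4}\,T(a_g,a_g^*)\,\rho_g^{1/4}\rho^{-1/4},\qquad\text{i.e.}\quad \rho^{1/4}V_g(T)\rho^{1/4}=\rho_g^{1/4}\,T(a_g,a_g^*)\,\rho_g^{1/4},$$ for all operators $T\in\mathbb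 L_2(\rho)$ (in particular all bounded operators and all polynomials), defines a strongly continuous unitary representation of the group $\mathcal B$ on $\mathbb L_2(\rho)$. In particular, if $s\mapsto g(s)=(\tau(s),\theta(s))$ is a differentiable one-parameter subgroup of $\mathcal B$, then $V_s:=V_{g(s)}$ is a strongly continuous one-parameter unitary group. 3. Let $s\mapsto g(s)=(\tau(s),\theta(s))\in\mathcal B$ be any differentiable family with $(\tau(0),\theta(0))=(1,0)$, and write $a_s=a_{g(s)}$, $\rho_s=\rho_{g(s)}$, $V_s=V_{g(s)}$, $Z_s=\mathrm{Tr}\,e^{-U(a_s,a_s^*)}$. For every polynomial $f$, the operators $f(a_s,a_s^*)$ are strongly differentiable on $\mathcal S$ at $s=0$, and so are the $U(a_s,a_s^*)$ if $U$ is the closure of a polynomial. Whenever the operators $U(a_s,a_s^*)$ are defined on $\mathcal S$ and strongly differentiable there at $s=0$, the strong integral $$L=\int_0^1\rho^{\lambda/4}\,\big(\partial_sU(a_s,a_s^*)|_{s=0}\big)\,\rho^{(1-\lambda)/4}\,d\lambda$$ exists, and for every polynomial $f=f(A,A^*)$ the map $s\mapsto V_s(f)$ is differentiable at $s=0$ in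 the norm of $\mathbb L_2(\rho)$, with $$\partial_sV_s(f)|_{s=0}=\partial_sf(a_s,a_s^*)|_{s=0}-\tfrac14\big(\rho^{-1/4}L\,f+f\,L\,\rho^{-1/4}\big)-\tfrac12\,\frac{Z'}{Z}\,f,\qquad Z'=\partial_sZ_s|_{s=0}.$$ The last identity is one between elements of $\mathbb L_2(\rho)$: after multiplication by $\rho^{1/4}$ on both sides it reads, on $\mathcal S$, $$\rho^{1/4}\big(\partial_sV_s(f)|_{s=0}\big)\rho^{1/4}=\rho^{1/4}\big(\partial_sf(a_s,a_s^*)|_{s=0}\big)\rho^{1/4}-\tfrac14\big(L f\rho^{1/4}+\rho^{1/4}fL\big)-\tfrac12\,\frac{Z'}{Z}\,\rho^{1/4}f\rho^{1/4}.$$ -/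

import Mathlib

namespace BogoliubovRep

open scoped ComplexConjugate ENNReal

noncomputable section

/-! ### The oscillator Hilbert space and polynomials in `A`, `A*` -/

/-- The one-mode Hilbert space `ℓ²(ℕ, ℂ)`; its standard basis is the eigenbasis of the
particle number operator. -/
abbrev Fock : Type := lp (fun _ : ℕ => ℂ) 2

/-- The `n`-particle vector. -/
def numberState (n : ℕ) : Fock := lp.single 2 n (1 : ℂ)

/-- The annihilation operator on sequences: `(A x)_n = √(n+1) x_{n+1}`. -/
def annihilation : Module.End ℂ (ℕ → ℂ) where
  toFun x := fun n => (Real.sqrt (n + 1) : ℂ) * x (n + 1)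
  map_add' x y := by ext n; simp [mul_add]
  map_smul' c x := by ext n; simp [mul_left_comm]

/-- The creation operator on sequences: `(A* x)_0 = 0` and `(A* x)_n = √n x_{n-1}`. -/
def creation : Module.End ℂ (ℕ → ℂ) where
  toFun x := fun n => (Real.sqrt n : ℂ) * x (n - 1)
  map_add' x y := by ext n; simp [mul_add]
  map_smul' c x := by ext n; simp [mul_left_comm]

/-- The two letters of a polynomial `f(X, X*)`. -/
inductive Letter : Type
  | lower : Letter
  | raise : Letter

/-- Polynomials in two non-commuting letters. -/
abbrev NCPoly : Type := FreeAlgebra ℂ Letter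

/-- The value `f(A, A*)` of a polynomial, acting on sequences. -/
def evalPoly : NCPoly →ₐ[ℂ] Module.End ℂ (ℕ → ℂ) :=
  FreeAlgebra.lift ℂ fun l => match l with
    | Letter.lower => annihilation
    | Letter.raise => creation

/-- The space `𝒮` of rapidly decreasing vectors: those `x` for which `f(A, A*) x` is square
summable for every polynomial `f`. -/
def schwartz : Submodule ℂ Fock where
  carrier := {x | ∀ f : NCPoly, Memℓp (E := fun _ : ℕ => ℂ) (evalPoly f (x : ℕ → ℂ)) 2}
  zero_mem' := by
    intro f
    change Memℓp (E := fun _ : ℕ => ℂ) (evalPoly f (0 : ℕ → ℂ)) 2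
    rw [map_zero]
    exact zero_memℓp
  add_mem' := by
    intro x y hx hy f
    change Memℓp (E := fun _ : ℕ => ℂ) (evalPoly f ((x : ℕ → ℂ) + (y : ℕ → ℂ))) 2
    rw [map_add]
    exact (hx f).add (hy f)
  smul_mem' := by
    intro c x hx f
    change Memℓp (E := fun _ : ℕ => ℂ) (evalPoly f (c • (x : ℕ → ℂ))) 2
    rw [map_smul]
    exact (hx f).const_smul c

/-- The operator `f(A, A*)` on `ℓ²` with domain `𝒮`. -/
def polyOp (f : NCPoly) : Fock →ₗ.[ℂ] Fock where
  domain := schwartz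
  toFun :=
    { toFun := fun x => ⟨evalPoly f ((x : Fock) : ℕ → ℂ), x.2 f⟩
      map_add' := fun x y => Subtype.ext
        (map_add (evalPoly f) ((x : Fock) : ℕ → ℂ) ((y : Fock) : ℕ → ℂ))
      map_smul' := fun c x => Subtype.ext
        (map_smul (evalPoly f) c ((x : Fock) : ℕ → ℂ)) }

/-- A possibly unbounded operator as a total function, with value `0` off its domain. -/
def app (T : Fock →ₗ.[ℂ] Fock) (x : Fock) : Fock :=
  open Classical in if h : x ∈ T.domain then T ⟨x, h⟩ else 0

/-! ### Bogoliubov transformations -/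

/-- The pairs `(τ, θ)` with `|τ|² - |θ|² = 1`. -/
@[ext] structure Bogoliubov : Type where
  τ : ℂ
  θ : ℂ
  norm_sub : ‖τ‖ ^ 2 - ‖θ‖ ^ 2 = 1

namespace Bogoliubov

theorem conj_sub (g : Bogoliubov) : g.τ * conj g.τ - g.θ * conj g.θ = 1 := by
  rw [Complex.mul_conj', Complex.mul_conj']
  exact_mod_cast g.norm_sub

theorem norm_of_conj {t u : ℂ} (h : t * conj t - u * conj u = 1) :
    ‖t‖ ^ 2 - ‖u‖ ^ 2 = 1 := by
  rw [Complex.mul_conj', Complex.mul_conj'] at h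
  exact_mod_cast h

/-- The group structure is composition of substitutions: with `a_g = τ_g A + θ_g A*`,
substituting `(A, A*) ↦ (a_g, a_g*)` in `a_h` gives `a_{g * h}`. -/
instance : Group Bogoliubov where
  mul g h :=
    ⟨g.τ * h.τ + conj g.θ * h.θ, g.θ * h.τ + conj g.τ * h.θ, by
      apply norm_of_conj
      have hg := g.conj_sub
      have hh := h.conj_sub
      simp only [map_add, map_mul, Complex.conj_conj]
      linear_combination (h.τ * conj h.τ - h.θ * conj h.θ) * hg + hh⟩
  one := ⟨1, 0, by simp⟩
  inv g := ⟨conj g.τ, -g.θ, by simpa using g.norm_sub⟩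
  mul_assoc g h k := by
    apply Bogoliubov.ext
    · change (g.τ * h.τ + conj g.θ * h.θ) * k.τ + conj (g.θ * h.τ + conj g.τ * h.θ) * k.θ
        = g.τ * (h.τ * k.τ + conj h.θ * k.θ) + conj g.θ * (h.θ * k.τ + conj h.τ * k.θ)
      simp only [map_add, map_mul, Complex.conj_conj]
      ring
    · change (g.θ * h.τ + conj g.τ * h.θ) * k.τ + conj (g.τ * h.τ + conj g.θ * h.θ) * k.θ
        = g.θ * (h.τ * k.τ + conj h.θ * k.θ) + conj g.τ * (h.θ * k.τ + conj h.τ * k.θ)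
      simp only [map_add, map_mul, Complex.conj_conj]
      ring
  one_mul g := by
    apply Bogoliubov.ext
    · change 1 * g.τ + conj (0 : ℂ) * g.θ = g.τ
      simp
    · change 0 * g.τ + conj (1 : ℂ) * g.θ = g.θ
      simp
  mul_one g := by
    apply Bogoliubov.ext
    · change g.τ * 1 + conj g.θ * 0 = g.τ
      simp
    · change g.θ * 1 + conj g.τ * 0 = g.θ
      simp
  inv_mul_cancel g := by
    have hg := g.conj_sub
    apply Bogoliubov.ext
    · change conj g.τ * g.τ + conj (-g.θ) * g.θ = 1
      simp only [map_neg]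
      linear_combination hg
    · change -g.θ * g.τ + conj (conj g.τ) * g.θ = 0
      simp only [Complex.conj_conj]
      ring

instance : TopologicalSpace Bogoliubov :=
  TopologicalSpace.induced (fun g => (g.τ, g.θ)) inferInstance

end Bogoliubov

/-- The substitution `f(X, X*) ↦ f(τ X + θ X*, τ̄ X* + θ̄ X)` of polynomials. -/
def substPoly (g : Bogoliubov) : NCPoly →ₐ[ℂ] NCPoly :=
  FreeAlgebra.lift ℂ fun l => match l with
    | Letter.lower => g.τ • FreeAlgebra.ι ℂ Letter.lower + g.θ • FreeAlgebra.ι ℂ Letter.raise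
    | Letter.raise =>
        conj g.τ • FreeAlgebra.ι ℂ Letter.raise + conj g.θ • FreeAlgebra.ι ℂ Letter.lower

/-- The operator `W T W*` with its natural domain `W (dom T)`. -/
def conjOp (W : Fock ≃ₗᵢ[ℂ] Fock) (T : Fock →ₗ.[ℂ] Fock) : Fock →ₗ.[ℂ] Fock where
  domain := T.domain.comap (W.symm.toLinearEquiv : Fock →ₗ[ℂ] Fock)
  toFun :=
    { toFun := fun x => W (T ⟨W.symm (x : Fock), x.2⟩)
      map_add' := fun x y => by
        rw [← map_add, ← LinearPMap.map_add]
        congr 2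
        exact Subtype.ext (map_add W.symm (x : Fock) (y : Fock))
      map_smul' := fun c x => by
        rw [RingHom.id_apply, ← map_smul, ← LinearPMap.map_smul]
        congr 2
        exact Subtype.ext (map_smul W.symm c (x : Fock)) }

/-- `W` carries the pair `(A, A*)` to the pair `(a, a*)`, where `a = τ A + θ A*`. -/
def Implements (g : Bogoliubov) (W : Fock ≃ₗᵢ[ℂ] Fock) : Prop :=
  ∀ l : Letter, conjOp W (polyOp (FreeAlgebra.ι ℂ l)) = polyOp (substPoly g (FreeAlgebra.ι ℂ l))

/-- For an arbitrary operator `T = T(A, A*)`, the operator `T(a, a*)`: the image of `T` under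
the unitary equivalence of the pairs `(A, A*)` and `(a, a*)`. That such an equivalence exists and
that the result does not depend on its choice is part of the theorem. -/
def subst (g : Bogoliubov) (T : Fock →ₗ.[ℂ] Fock) : Fock →ₗ.[ℂ] Fock :=
  open Classical in if h : ∃ W, Implements g W then conjOp h.choose T else T

/-! ### Gibbs densities -/

/-- `b` is an orthonormal basis of eigenvectors of `T`, with eigenvalues `E`. -/
def IsEigenbasis (T : Fock →ₗ.[ℂ] Fock) (b : HilbertBasis ℕ ℂ Fock) (E : ℕ → ℝ) : Prop :=
  ∀ n, ∃ h : b n ∈ T.domain, T ⟨b n, h⟩ = (E n : ℂ) • b n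

/-- `B = e^{-pT}` for a self-adjoint `T` with discrete spectrum. -/
def IsExpNeg (T : Fock →ₗ.[ℂ] Fock) (p : ℝ) (B : Fock →L[ℂ] Fock) : Prop :=
  ∃ b E, IsEigenbasis T b E ∧ ∀ n, B (b n) = (Real.exp (-p * E n) : ℂ) • b n

/-- The operator `e^{-pT}` (and `0` if there is none). -/
def expNeg (T : Fock →ₗ.[ℂ] Fock) (p : ℝ) : Fock →L[ℂ] Fock :=
  open Classical in if h : ∃ B, IsExpNeg T p B then h.choose else 0

/-- `Z = Tr e^{-T}`. -/
def partitionFn (T : Fock →ₗ.[ℂ] Fock) : ℝ :=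
  ∑' n, (inner ℂ (numberState n) (expNeg T 1 (numberState n))).re

/-- The power `ρ^p` of the density `ρ = Z⁻¹ e^{-T}`. -/
def gibbsPow (T : Fock →ₗ.[ℂ] Fock) (p : ℝ) : Fock →L[ℂ] Fock :=
  ((partitionFn T ^ (-p) : ℝ) : ℂ) • expNeg T p

/-- `Tr (f(A, A*)* f(A, A*) e^{-T})` is defined and finite for all polynomials `f`; the trace is
computed in an orthonormal basis of eigenvectors of `T`. -/
def FiniteMoments (T : Fock →ₗ.[ℂ] Fock) : Prop :=
  ∃ b E, IsEigenbasis T b E ∧ (∀ n, b n ∈ schwartz) ∧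
    ∀ f : NCPoly, Summable fun n => Real.exp (-E n) * ‖app (polyOp f) (b n)‖ ^ 2

/-! ### The space `L₂(ρ)` -/

/-- Hilbert-Schmidt operators `F` on `Fock`, stored as the sequence of the vectors
`F e_n`, so that `⟪F, G⟫ = ∑ ⟪F e_n, G e_n⟫ = Tr (F* G)`.

The space `L₂(ρ)` has the norm `‖f‖² = Tr |ρ^{1/4} f ρ^{1/4}|²`. Its completion is the space of
Hilbert-Schmidt operators, an operator `f` being represented by `ρ^{1/4} f ρ^{1/4}`. -/
abbrev HS : Type := lp (fun _ : ℕ => Fock) 2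

/-- The vector `F x`: the Hilbert-Schmidt operator `F` sends `x` to `y`. -/
def SendsTo (F : HS) (x y : Fock) : Prop :=
  HasSum (fun n => (x : ℕ → ℂ) n • (F : ℕ → Fock) n) y

/-- The operator `T` belongs to `L₂(ρ)`, where `R = ρ^{1/4}`, and is represented by `F`:
`F = ρ^{1/4} T ρ^{1/4}`. -/
def Represents (R : Fock →L[ℂ] Fock) (T : Fock →ₗ.[ℂ] Fock) (F : HS) : Prop :=
  ∀ x, ∃ h : R x ∈ T.domain, SendsTo F x (R (T ⟨R x, h⟩))

/-! ### Differentiation along a family -/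

/-- The operator `∂_s T_s |_{s=0}`, pointwise. -/
def derivOp (T : ℝ → Fock →ₗ.[ℂ] Fock) (x : Fock) : Fock :=
  deriv (fun s => app (T s) x) 0

/-- The family `T_s` is defined on `𝒮`, and strongly differentiable there at `s = 0`. -/
def DifferentiableOnSchwartz (T : ℝ → Fock →ₗ.[ℂ] Fock) : Prop :=
  (∀ s, schwartz ≤ (T s).domain) ∧
    ∀ x ∈ schwartz, DifferentiableAt ℝ (fun s => app (T s) x) 0

/-- A differentiable family `s ↦ (τ(s), θ(s))` with `a_0 = A`. -/
structure IsBogoliubovFamily (γ : ℝ → Bogoliubov) : Prop where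
  zero : γ 0 = 1
  diff_τ : Differentiable ℝ fun s => (γ s).τ
  diff_θ : Differentiable ℝ fun s => (γ s).θ

/-- The integrand `ρ^{l/4} (∂_s U(a_s, a_s*)|_{s=0}) ρ^{(1-l)/4} x`. -/
def duhamelIntegrand (U : Fock →ₗ.[ℂ] Fock) (γ : ℝ → Bogoliubov) (x : Fock) (l : ℝ) : Fock :=
  gibbsPow U (l / 4) (derivOp (fun s => subst (γ s) U) (gibbsPow U ((1 - l) / 4) x))

/-- The operator `∫₀¹ ρ^{l/4} (∂_s U(a_s, a_s*)|_{s=0}) ρ^{(1-l)/4} dl`. -/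
def duhamel (U : Fock →ₗ.[ℂ] Fock) (γ : ℝ → Bogoliubov) (x : Fock) : Fock :=
  ∫ l in (0 : ℝ)..1, duhamelIntegrand U γ x l

end

end BogoliubovRep

namespace BogoliubovRep

open scoped ComplexConjugate ENNReal Topology
open Filter

noncomputable section

/-! ### Square summable families -/

/-! Everything reduces to unitary conjugation. If `W` implements `g`, then `ρ_g = W ρ W*`, so
`ρ^{1/4} V_g(T) ρ^{1/4} = W (ρ^{1/4} T ρ^{1/4}) W*`: in the Hilbert–Schmidt picture `V_g` is `F ↦ W
F W*`. It is isometric because the Hilbert–Schmidt norm does not depend on the basis. It is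
multiplicative because implementers are unique up to a phase (`Implements.eq_smul`), which
conjugation forgets.

Implementers come from Fock's construction (`exists_intertwines`): solve `a_g v = 0`, then apply
`a_g*` repeatedly to get an orthonormal sequence, hence an isometry. It is onto because its
composite with the isometry for `g⁻¹` commutes with `A` and `A*`, and so is a scalar.

The analytic core is a quantitative estimate of `W_g - 1`, with the phase fixed by a nonnegative
vacuum expectation. Since `(N - n) W* e_n = W* (a_g* a_g - N) e_n`, where `N = A*A` has integer
spectrum, the part of `W* e_n` orthogonal to `e_n` is at most `‖(a_g* a_g - N) e_n‖ = O(|θ| n +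
|θ|)`. The diagonal coefficient follows by recursion on `n`. This gives a Lipschitz bound on `𝒮`
with weight `(N + 1)²` (`exists_impl_lipschitz`), hence strong continuity. The same gap argument
applied to difference quotients gives `∂_s W_s = G` on `𝒮`, with `G = -τ' N - (θ'/2) A*² + (conj
θ'/2) A²` (`hasDerivAt_impl`).

Finite moments for `ρ` propagate to every power `ρ^p`, `p > 0` (`IsGibbs.moment_pos`). Hence `ρ^p`
maps into `𝒮`, every `f(A, A*) ρ^p` is bounded, and `s ↦ V_s(f)` can be differentiated term by term
in a series of rank-one operators. Its derivative is `[G, F]`, with `F = ρ^{1/4} f ρ^{1/4}`.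

It remains to rewrite that commutator. In the eigenbasis of `U` the operator `∂_s U(a_s, a_s*)` has
the matrix of `[G, U]`, and an elementary integral of exponentials gives `L = 4 (ρ^{1/4} G - G
ρ^{1/4})`. Together with `∂_s f(a_s, a_s*) = [G, f]`, the stated formula becomes an algebraic
identity. The term in `Z'` vanishes because `Z_s` is constant. -/

lemma hasSum_norm_sq {E : ℕ → Type*} [∀ i, NormedAddCommGroup (E i)] (x : lp E 2) :
    HasSum (fun n => ‖x n‖ ^ 2) (‖x‖ ^ 2) := by
  simpa using lp.hasSum_norm (p := 2) (by norm_num) x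

lemma memℓp_two_iff {E : ℕ → Type*} [∀ i, NormedAddCommGroup (E i)] {x : ∀ i, E i} :
    Memℓp x 2 ↔ Summable fun n => ‖x n‖ ^ 2 := by
  simpa using memℓp_gen_iff (p := 2) (by norm_num) (f := x)

lemma continuous_apply_lp {E : ℕ → Type*} [∀ i, NormedAddCommGroup (E i)] :
    Continuous fun (x : lp E 2) (n : ℕ) => x n :=
  lp.uniformContinuous_coe.continuous

lemma summable_of_tsum_ofReal_ne_top {a : ℕ → ℝ} (h0 : ∀ n, 0 ≤ a n)
    (h : ∑' n, ENNReal.ofReal (a n) ≠ ∞) : Summable a := by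
  have := ENNReal.summable_toReal h
  simpa [ENNReal.toReal_ofReal, h0] using this

lemma summable_mul_of_sq {a b : ℕ → ℝ} (ha : Summable fun n => a n ^ 2)
    (hb : Summable fun n => b n ^ 2) : Summable fun n => a n * b n := by
  refine Summable.of_norm_bounded (ha.add hb) fun n => ?_
  rw [Real.norm_eq_abs, abs_le]
  constructor <;> nlinarith [sq_nonneg (a n - b n), sq_nonneg (a n + b n)]

/-! ### Hilbert bases and diagonal operators -/

variable {b b' : HilbertBasis ℕ ℂ Fock}

/-- The Hilbert basis of the number states. -/
def numberBasis : HilbertBasis ℕ ℂ Fock :=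
  HilbertBasis.ofRepr (LinearIsometryEquiv.refl ℂ Fock)

@[simp] lemma numberBasis_apply (n : ℕ) : numberBasis n = numberState n := by
  rw [← HilbertBasis.repr_symm_single]
  rfl

lemma numberState_apply (n m : ℕ) : (numberState n : ℕ → ℂ) m = if m = n then 1 else 0 := by
  rw [numberState, lp.single_apply]
  simp [Pi.single_apply]

lemma inner_numberState (n : ℕ) (x : Fock) : inner ℂ (numberState n) x = (x : ℕ → ℂ) n := by
  rw [← numberBasis_apply, ← HilbertBasis.repr_apply_apply]
  rfl

lemma hasSum_numberState (x : Fock) :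
    HasSum (fun n => (x : ℕ → ℂ) n • numberState n) x := by
  have h := numberBasis.hasSum_repr x
  simp only [numberBasis_apply] at h
  exact h

/-- The image of a Hilbert basis under a unitary operator. -/
def mapBasis (W : Fock ≃ₗᵢ[ℂ] Fock) (b : HilbertBasis ℕ ℂ Fock) : HilbertBasis ℕ ℂ Fock :=
  HilbertBasis.ofRepr (W.symm.trans b.repr)

@[simp] lemma mapBasis_apply (W : Fock ≃ₗᵢ[ℂ] Fock) (n : ℕ) : mapBasis W b n = W (b n) := by
  rw [← HilbertBasis.repr_symm_single, ← HilbertBasis.repr_symm_single]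
  rfl

lemma hasSum_inner_sq (b : HilbertBasis ℕ ℂ Fock) (x : Fock) :
    HasSum (fun n => ‖inner ℂ (b n) x‖ ^ 2) (‖x‖ ^ 2) := by
  have h := hasSum_norm_sq (b.repr x)
  simpa only [b.repr_apply_apply, LinearIsometryEquiv.norm_map] using h

lemma basis_ext {F : Type*} [NormedAddCommGroup F] [NormedSpace ℂ F] {S T : Fock →L[ℂ] F}
    (b : HilbertBasis ℕ ℂ Fock) (h : ∀ n, S (b n) = T (b n)) : S = T := by
  refine ContinuousLinearMap.ext_on (Submodule.dense_iff_topologicalClosure_eq_top.mpr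
    b.dense_span) ?_
  rintro _ ⟨n, rfl⟩
  exact h n

lemma basis_inner_ext (b : HilbertBasis ℕ ℂ Fock) {x y : Fock}
    (h : ∀ n, inner ℂ (b n) x = inner ℂ (b n) y) : x = y := by
  apply b.repr.injective
  ext n
  simpa [b.repr_apply_apply] using h n

lemma inner_diag {T : Fock →L[ℂ] Fock} {c : ℕ → ℂ} (h : ∀ n, T (b n) = c n • b n)
    (n : ℕ) (x : Fock) : inner ℂ (b n) (T x) = c n * inner ℂ (b n) x := by
  have : (innerSL ℂ (b n)).comp T = c n • innerSL ℂ (b n) := by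
    refine basis_ext b fun k => ?_
    simp only [ContinuousLinearMap.comp_apply, h, map_smul, innerSL_apply_apply,
      smul_apply, smul_eq_mul]
    rw [orthonormal_iff_ite.mp b.orthonormal]
    split_ifs with hk
    · rw [hk]
    · simp
  simpa using congrArg (fun S : Fock →L[ℂ] ℂ => S x) this

lemma norm_diag_le {T : Fock →L[ℂ] Fock} {c : ℕ → ℂ} (h : ∀ n, T (b n) = c n • b n)
    {C : ℝ} (hC : 0 ≤ C) (hc : ∀ n, ‖c n‖ ≤ C) (x : Fock) : ‖T x‖ ≤ C * ‖x‖ := by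
  refine le_of_sq_le_sq ?_ (by positivity)
  rw [mul_pow, ← (hasSum_inner_sq b (T x)).tsum_eq, ← (hasSum_inner_sq b x).tsum_eq,
    ← tsum_mul_left]
  refine (hasSum_inner_sq b (T x)).summable.tsum_le_tsum (fun n => ?_)
    ((hasSum_inner_sq b x).summable.mul_left _)
  rw [inner_diag h, norm_mul, mul_pow]
  gcongr
  exact hc n

lemma exists_diag (b : HilbertBasis ℕ ℂ Fock) {c : ℕ → ℂ} {C : ℝ} (hc : ∀ n, ‖c n‖ ≤ C) :
    ∃ T : Fock →L[ℂ] Fock, ∀ n, T (b n) = c n • b n := by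
  have hC : 0 ≤ C := (norm_nonneg _).trans (hc 0)
  have hle : ∀ (x : Fock) n, ‖c n * x n‖ ^ 2 ≤ C ^ 2 * ‖x n‖ ^ 2 := fun x n => by
    rw [norm_mul, mul_pow]
    gcongr
    exact hc n
  have hs : ∀ x : Fock, Summable fun n => ‖c n * x n‖ ^ 2 := fun x =>
    Summable.of_nonneg_of_le (fun n => by positivity) (hle x)
      ((hasSum_norm_sq x).summable.mul_left _)
  let M : Fock →L[ℂ] Fock := LinearMap.mkContinuous
    { toFun := fun x => ⟨fun n => c n * x n, memℓp_two_iff.mpr (hs x)⟩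
      map_add' := fun x y => by ext n; exact mul_add _ _ _
      map_smul' := fun a x => by ext n; exact mul_left_comm _ _ _ } C (fun x => by
        refine le_of_sq_le_sq ?_ (by positivity)
        rw [mul_pow, ← (hasSum_norm_sq x).tsum_eq, ← tsum_mul_left, ← (hasSum_norm_sq _).tsum_eq]
        exact (hs x).tsum_le_tsum (hle x) ((hasSum_norm_sq x).summable.mul_left _))
  refine ⟨(b.repr.symm : Fock →L[ℂ] Fock).comp (M.comp (b.repr : Fock →L[ℂ] Fock)), fun n => ?_⟩
  have : M (b.repr (b n)) = c n • b.repr (b n) := by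
    ext m
    change c m * (b.repr (b n) : ℕ → ℂ) m = c n * (b.repr (b n) : ℕ → ℂ) m
    rw [b.repr_self, lp.single_apply]
    by_cases hm : m = n
    · rw [hm]
    · simp [hm]
  change b.repr.symm (M (b.repr (b n))) = _
  rw [this, map_smul, LinearIsometryEquiv.symm_apply_apply]

lemma inner_diag_real {T : Fock →L[ℂ] Fock} {c : ℕ → ℝ}
    (h : ∀ n, T (b n) = (c n : ℂ) • b n) (x y : Fock) :
    inner ℂ (T x) y = inner ℂ x (T y) := by
  have h1 := b.hasSum_inner_mul_inner (T x) y
  have h2 := b.hasSum_inner_mul_inner x (T y)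
  refine h1.unique ?_
  convert h2 using 2 with n
  rw [← inner_conj_symm (T x), inner_diag h, inner_diag h, map_mul, inner_conj_symm,
    Complex.conj_ofReal]
  ring

/-! ### Traces and Hilbert-Schmidt norms do not depend on the basis -/

lemma ofReal_norm_sq (b : HilbertBasis ℕ ℂ Fock) (x : Fock) :
    ENNReal.ofReal (‖x‖ ^ 2) = ∑' n, ENNReal.ofReal (‖inner ℂ (b n) x‖ ^ 2) := by
  rw [← (hasSum_inner_sq b x).tsum_eq,
    ENNReal.ofReal_tsum_of_nonneg (fun n => by positivity) (hasSum_inner_sq b x).summable]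

/-- Parseval on both sides turns each sum into the double sum of squared matrix elements. In `ℝ≥0∞`
the order of summation can be exchanged without any summability assumption. -/
lemma tsum_norm_sq_adjoint (T : Fock →L[ℂ] Fock) (b b' : HilbertBasis ℕ ℂ Fock) :
    ∑' n, ENNReal.ofReal (‖T (b n)‖ ^ 2) =
      ∑' m, ENNReal.ofReal (‖ContinuousLinearMap.adjoint T (b' m)‖ ^ 2) := by
  simp_rw [ofReal_norm_sq b' (T _), ofReal_norm_sq b (ContinuousLinearMap.adjoint T _)]
  rw [ENNReal.tsum_comm]
  refine tsum_congr fun m => tsum_congr fun n => ?_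
  rw [ContinuousLinearMap.adjoint_inner_right, norm_inner_symm]

lemma tsum_norm_sq_basis (T : Fock →L[ℂ] Fock) (b b' : HilbertBasis ℕ ℂ Fock) :
    ∑' n, ENNReal.ofReal (‖T (b n)‖ ^ 2) = ∑' n, ENNReal.ofReal (‖T (b' n)‖ ^ 2) := by
  rw [tsum_norm_sq_adjoint T b b, tsum_norm_sq_adjoint T b' b]

lemma hasSum_norm_sq_basis {T : Fock →L[ℂ] Fock} {s : ℝ}
    (h : HasSum (fun n => ‖T (b n)‖ ^ 2) s) (b' : HilbertBasis ℕ ℂ Fock) :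
    HasSum (fun n => ‖T (b' n)‖ ^ 2) s := by
  have h1 : ∑' n, ENNReal.ofReal (‖T (b' n)‖ ^ 2) = ENNReal.ofReal s := by
    rw [tsum_norm_sq_basis T b' b, ← h.tsum_eq,
      ENNReal.ofReal_tsum_of_nonneg (fun n => by positivity) h.summable]
  have h2 : Summable fun n => ‖T (b' n)‖ ^ 2 :=
    summable_of_tsum_ofReal_ne_top (fun n => by positivity) (by rw [h1]; exact ENNReal.ofReal_ne_top)
  have h3 : ∑' n, ‖T (b' n)‖ ^ 2 = s := by
    rw [← ENNReal.ofReal_tsum_of_nonneg (fun n => by positivity) h2] at h1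
    exact (ENNReal.ofReal_eq_ofReal_iff (tsum_nonneg fun n => by positivity)
      (h.nonneg fun n => by positivity)).mp h1
  exact h3 ▸ h2.hasSum

/-- A positive diagonal operator is the square of its diagonal root `D`, and `⟪x, D² x⟫ = ‖D x‖²`,
so its trace is a Hilbert–Schmidt norm and inherits independence of the basis. -/
lemma hasSum_trace {T : Fock →L[ℂ] Fock} {c : ℕ → ℝ} (hc : ∀ n, 0 ≤ c n) {s : ℝ}
    (hs : HasSum c s) (h : ∀ n, T (b n) = (c n : ℂ) • b n) (b' : HilbertBasis ℕ ℂ Fock) :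
    HasSum (fun n => (inner ℂ (b' n) (T (b' n)) : ℂ)) s := by
  have hb : ∀ n, ‖((Real.sqrt (c n) : ℝ) : ℂ)‖ ≤ Real.sqrt s := fun n => by
    rw [Complex.norm_real, Real.norm_of_nonneg (Real.sqrt_nonneg _)]
    exact Real.sqrt_le_sqrt (le_hasSum hs n fun m _ => hc m)
  obtain ⟨D, hD⟩ := exists_diag b hb
  have h1 : HasSum (fun n => ‖D (b n)‖ ^ 2) s := by
    convert hs using 2 with n
    rw [hD, norm_smul, b.orthonormal.1, mul_one, Complex.norm_real, Real.norm_eq_abs, sq_abs,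
      Real.sq_sqrt (hc n)]
  have h2 : T = D.comp D := basis_ext b fun n => by
    rw [ContinuousLinearMap.comp_apply, hD, map_smul, hD, smul_smul, h, ← Complex.ofReal_mul,
      Real.mul_self_sqrt (hc n)]
  have h3 : HasSum (fun n => ((‖D (b' n)‖ ^ 2 : ℝ) : ℂ)) s :=
    (hasSum_norm_sq_basis h1 b').mapL Complex.ofRealCLM
  convert h3 using 2 with n
  rw [h2, ContinuousLinearMap.comp_apply, ← inner_diag_real hD, inner_self_eq_norm_sq_to_K]
  push_cast
  rfl

/-! ### Hilbert-Schmidt operators as bounded operators -/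

lemma summable_smul_HS (F : HS) (x : Fock) : Summable fun n => ‖(x : ℕ → ℂ) n • (F : ℕ → Fock) n‖ := by
  simp_rw [norm_smul]
  exact summable_mul_of_sq (hasSum_norm_sq x).summable (hasSum_norm_sq F).summable

lemma norm_tsum_smul_HS_le (F : HS) (x : Fock) :
    ‖∑' n, (x : ℕ → ℂ) n • (F : ℕ → Fock) n‖ ≤ ‖F‖ * ‖x‖ := by
  refine (norm_tsum_le_tsum_norm (summable_smul_HS F x)).trans ?_
  simp_rw [norm_smul]
  have h := Real.inner_le_Lp_mul_Lq_tsum_of_nonneg Real.HolderConjugate.two_two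
    (f := fun n => ‖(x : ℕ → ℂ) n‖) (g := fun n => ‖(F : ℕ → Fock) n‖)
    (fun _ => norm_nonneg _) (fun _ => norm_nonneg _)
    (by simpa using (hasSum_norm_sq x).summable) (by simpa using (hasSum_norm_sq F).summable)
  refine h.trans (le_of_eq ?_)
  simp only [Real.rpow_two]
  rw [(hasSum_norm_sq x).tsum_eq, (hasSum_norm_sq F).tsum_eq, ← Real.sqrt_eq_rpow,
    ← Real.sqrt_eq_rpow, Real.sqrt_sq (norm_nonneg _), Real.sqrt_sq (norm_nonneg _), mul_comm]

/-- A Hilbert-Schmidt operator as a bounded operator. -/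
def toCLM : HS →L[ℂ] Fock →L[ℂ] Fock :=
  LinearMap.mkContinuous₂ (LinearMap.mk₂ ℂ
    (fun (F : HS) (x : Fock) => ∑' n, (x : ℕ → ℂ) n • (F : ℕ → Fock) n)
    (fun F G x => by
      rw [← (summable_smul_HS F x).of_norm.tsum_add (summable_smul_HS G x).of_norm]
      exact tsum_congr fun n => smul_add _ _ _)
    (fun a F x => by
      rw [← (summable_smul_HS F x).of_norm.tsum_const_smul a]
      exact tsum_congr fun n => smul_comm ((x : ℕ → ℂ) n) a ((F : ℕ → Fock) n))
    (fun F x y => by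
      rw [← (summable_smul_HS F x).of_norm.tsum_add (summable_smul_HS F y).of_norm]
      exact tsum_congr fun n => add_smul _ _ _)
    (fun a F x => by
      rw [← (summable_smul_HS F x).of_norm.tsum_const_smul a]
      exact tsum_congr fun n => mul_smul _ _ _)) 1
    (fun F x => by simpa using norm_tsum_smul_HS_le F x)

lemma sendsTo_iff {F : HS} {x y : Fock} : SendsTo F x y ↔ toCLM F x = y :=
  ⟨fun h => h.tsum_eq, fun h => h ▸ (summable_smul_HS F x).of_norm.hasSum⟩

@[simp] lemma toCLM_numberState (F : HS) (n : ℕ) :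
    toCLM F (numberState n) = (F : ℕ → Fock) n := by
  change ∑' m, (numberState n : ℕ → ℂ) m • (F : ℕ → Fock) m = _
  rw [tsum_eq_single n fun m hm => by rw [numberState_apply, if_neg hm, zero_smul]]
  simp [numberState_apply]

lemma toCLM_injective : Function.Injective toCLM := fun F G h => by
  ext1
  funext n
  rw [← toCLM_numberState, h, toCLM_numberState]

lemma hasSum_norm_sq_HS (F : HS) (b : HilbertBasis ℕ ℂ Fock) :
    HasSum (fun n => ‖toCLM F (b n)‖ ^ 2) (‖F‖ ^ 2) :=
  hasSum_norm_sq_basis (b := numberBasis) (by simpa using hasSum_norm_sq F) b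

/-- A bounded operator with square summable values on the number states is Hilbert-Schmidt. -/
def ofCLM (T : Fock →L[ℂ] Fock) (h : Summable fun n => ‖T (numberState n)‖ ^ 2) : HS :=
  ⟨fun n => T (numberState n), memℓp_two_iff.mpr h⟩

@[simp] lemma toCLM_ofCLM (T : Fock →L[ℂ] Fock) (h) : toCLM (ofCLM T h) = T :=
  basis_ext numberBasis fun n => by rw [numberBasis_apply, toCLM_numberState]; rfl

lemma summable_conj (W : Fock ≃ₗᵢ[ℂ] Fock) (F : HS) :
    HasSum (fun n => ‖W (toCLM F (W.symm (numberState n)))‖ ^ 2) (‖F‖ ^ 2) := by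
  simpa using hasSum_norm_sq_HS F (mapBasis W.symm numberBasis)

/-- The action `F ↦ W F W*` of a unitary operator on Hilbert-Schmidt operators, as a linear map. -/
def conjHSLin (W : Fock ≃ₗᵢ[ℂ] Fock) : HS →ₗ[ℂ] HS where
  toFun F := ⟨fun n => W (toCLM F (W.symm (numberState n))),
    memℓp_two_iff.mpr (summable_conj W F).summable⟩
  map_add' F G := by
    ext1
    funext n
    change W (toCLM (F + G) _) = W (toCLM F _) + W (toCLM G _)
    simp
  map_smul' a F := by
    ext1
    funext n
    change W (toCLM (a • F) _) = a • W (toCLM F _)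
    simp

lemma toCLM_conjHSLin (W : Fock ≃ₗᵢ[ℂ] Fock) (F : HS) (x : Fock) :
    toCLM (conjHSLin W F) x = W (toCLM F (W.symm x)) := by
  have : toCLM (conjHSLin W F) = (W : Fock →L[ℂ] Fock).comp
      ((toCLM F).comp (W.symm : Fock →L[ℂ] Fock)) := basis_ext numberBasis fun n => by
    rw [numberBasis_apply, toCLM_numberState]
    rfl
  rw [this]
  rfl

/-- The action `F ↦ W F W*` of a unitary operator on Hilbert-Schmidt operators. -/
def conjHS (W : Fock ≃ₗᵢ[ℂ] Fock) : HS ≃ₗᵢ[ℂ] HS where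
  toLinearEquiv := LinearEquiv.ofLinearMap (conjHSLin W) (conjHSLin W.symm)
    (by ext1 F; apply toCLM_injective; ext1 x; simp [toCLM_conjHSLin])
    (by ext1 F; apply toCLM_injective; ext1 x; simp [toCLM_conjHSLin])
  norm_map' F := by
    refine (sq_eq_sq₀ (norm_nonneg _) (norm_nonneg _)).mp ?_
    exact (hasSum_norm_sq (conjHSLin W F)).unique (summable_conj W F)

@[simp] lemma toCLM_conjHS (W : Fock ≃ₗᵢ[ℂ] Fock) (F : HS) (x : Fock) :
    toCLM (conjHS W F) x = W (toCLM F (W.symm x)) :=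
  toCLM_conjHSLin W F x

/-! ### Rank-one operators -/

lemma hasSum_norm_sq_rankOne (u v : Fock) :
    HasSum (fun n => ‖conj ((v : ℕ → ℂ) n) • u‖ ^ 2) ((‖u‖ * ‖v‖) ^ 2) := by
  simp_rw [norm_smul, mul_pow, RCLike.norm_conj]
  rw [mul_comm]
  exact (hasSum_norm_sq v).mul_right _

/-- The Hilbert-Schmidt operator `x ↦ ⟪v, x⟫ u`. -/
def rankOne (u v : Fock) : HS :=
  ⟨fun n => conj ((v : ℕ → ℂ) n) • u, memℓp_two_iff.mpr (hasSum_norm_sq_rankOne u v).summable⟩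

lemma norm_rankOne (u v : Fock) : ‖rankOne u v‖ = ‖u‖ * ‖v‖ :=
  (sq_eq_sq₀ (norm_nonneg _) (by positivity)).mp
    ((hasSum_norm_sq (rankOne u v)).unique (hasSum_norm_sq_rankOne u v))

@[simp] lemma toCLM_rankOne (u v x : Fock) : toCLM (rankOne u v) x = inner ℂ v x • u := by
  have h : toCLM (rankOne u v) = (innerSL ℂ v).smulRight u := basis_ext numberBasis fun n => by
    rw [numberBasis_apply, toCLM_numberState, ContinuousLinearMap.smulRight_apply,
      innerSL_apply_apply, ← inner_conj_symm, inner_numberState]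
    rfl
  rw [h]
  rfl

lemma conjHS_rankOne (W : Fock ≃ₗᵢ[ℂ] Fock) (u v : Fock) :
    conjHS W (rankOne u v) = rankOne (W u) (W v) := by
  apply toCLM_injective
  ext1 x
  rw [toCLM_conjHS, toCLM_rankOne, toCLM_rankOne, map_smul, ← W.inner_map_map,
    LinearIsometryEquiv.apply_symm_apply]

lemma rankOne_sub_left (u u' v : Fock) :
    rankOne (u - u') v = rankOne u v - rankOne u' v := by
  apply toCLM_injective
  ext1 x
  simp [smul_sub]

lemma rankOne_sub_right (u v v' : Fock) :
    rankOne u (v - v') = rankOne u v - rankOne u v' := by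
  apply toCLM_injective
  ext1 x
  simp [sub_smul]

lemma rankOne_smul_left (a : ℂ) (u v : Fock) : rankOne (a • u) v = a • rankOne u v := by
  apply toCLM_injective
  ext1 x
  simp [smul_comm a (inner ℂ v x) u]

lemma rankOne_smul_right (a : ℂ) (u v : Fock) : rankOne u (a • v) = conj a • rankOne u v := by
  apply toCLM_injective
  ext1 x
  simp [mul_smul]
  exact smul_comm _ _ _

/-- Matrix elements of `F` are inner products with rank-one operators; an `F` orthogonal to all
rank-one operators built on a basis is therefore zero. -/
lemma inner_rankOne (u v : Fock) (F : HS) : inner ℂ (rankOne u v) F = inner ℂ u (toCLM F v) := by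
  have h1 := lp.hasSum_inner (𝕜 := ℂ) (rankOne u v) F
  have h2 : HasSum (fun n => (v : ℕ → ℂ) n • (F : ℕ → Fock) n) (toCLM F v) :=
    sendsTo_iff.mpr rfl
  have h3 : HasSum (fun n => inner ℂ u ((v : ℕ → ℂ) n • (F : ℕ → Fock) n))
      (inner ℂ u (toCLM F v)) := h2.mapL (innerSL ℂ u)
  refine h1.unique ((funext fun n => ?_ : (fun n => inner ℂ ((rankOne u v : ℕ → Fock) n)
    ((F : ℕ → Fock) n)) = fun n => inner ℂ u ((v : ℕ → ℂ) n • (F : ℕ → Fock) n)) ▸ h3)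
  change inner ℂ (conj ((v : ℕ → ℂ) n) • u) _ = _
  rw [inner_smul_left, inner_smul_right, Complex.conj_conj]

lemma tendsto_rankOne {ι : Type*} {l : Filter ι} {u v : ι → Fock} {u₀ v₀ : Fock}
    (hu : Tendsto u l (𝓝 u₀)) (hv : Tendsto v l (𝓝 v₀)) :
    Tendsto (fun i => rankOne (u i) (v i)) l (𝓝 (rankOne u₀ v₀)) := by
  rw [tendsto_iff_norm_sub_tendsto_zero] at hu hv ⊢
  have key : ∀ i, ‖rankOne (u i) (v i) - rankOne u₀ v₀‖ ≤
      ‖u i - u₀‖ * ‖v i - v₀‖ + ‖u i - u₀‖ * ‖v₀‖ + ‖u₀‖ * ‖v i - v₀‖ := fun i => by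
    have : rankOne (u i) (v i) - rankOne u₀ v₀ = rankOne (u i - u₀) (v i - v₀) +
        rankOne (u i - u₀) v₀ + rankOne u₀ (v i - v₀) := by
      simp only [rankOne_sub_left, rankOne_sub_right]
      abel
    rw [this, ← norm_rankOne, ← norm_rankOne, ← norm_rankOne]
    exact norm_add₃_le
  refine squeeze_zero (fun i => norm_nonneg _) key ?_
  simpa using ((hu.mul hv).add (hu.mul_const ‖v₀‖)).add (hv.const_mul ‖u₀‖)

/-! ### Polynomials acting on rapidly decreasing vectors -/

/-- The letter `A`. -/
abbrev lo : NCPoly := FreeAlgebra.ι ℂ Letter.lower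

/-- The letter `A*`. -/
abbrev ra : NCPoly := FreeAlgebra.ι ℂ Letter.raise

lemma evalPoly_lo (x : ℕ → ℂ) (n : ℕ) : evalPoly lo x n = (Real.sqrt (n + 1) : ℂ) * x (n + 1) := by
  rw [evalPoly, FreeAlgebra.lift_ι_apply]
  rfl

lemma evalPoly_ra (x : ℕ → ℂ) (n : ℕ) : evalPoly ra x n = (Real.sqrt n : ℂ) * x (n - 1) := by
  rw [evalPoly, FreeAlgebra.lift_ι_apply]
  rfl

/-- Each coordinate of `f(A, A*) x` involves finitely many coordinates of `x`, whence continuity for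
the product topology. This replaces any closability argument when a polynomial is moved through an
infinite sum. -/
lemma continuous_evalPoly (f : NCPoly) : Continuous (evalPoly f) := by
  induction f using FreeAlgebra.induction with
  | grade0 r =>
    rw [AlgHom.commutes]
    exact continuous_const_smul r
  | grade1 l =>
    refine continuous_pi fun n => ?_
    cases l
    · simp_rw [evalPoly_lo]
      exact continuous_const.mul (continuous_apply _)
    · simp_rw [evalPoly_ra]
      exact continuous_const.mul (continuous_apply _)
  | mul f g hf hg =>
    rw [map_mul]
    exact hf.comp hg
  | add f g hf hg =>
    rw [map_add]
    exact hf.add hg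

/-- The operator `f(A, A*)` on `𝒮`. -/
def actLin (f : NCPoly) : Module.End ℂ schwartz where
  toFun x := ⟨⟨evalPoly f ((x : Fock) : ℕ → ℂ), x.2 f⟩, fun g => by
    have := x.2 (g * f)
    rw [map_mul] at this
    exact this⟩
  map_add' x y := Subtype.ext (Subtype.ext
    (map_add (evalPoly f) ((x : Fock) : ℕ → ℂ) ((y : Fock) : ℕ → ℂ)))
  map_smul' c x := Subtype.ext (Subtype.ext
    (map_smul (evalPoly f) c ((x : Fock) : ℕ → ℂ)))

/-- The representation of polynomials on `𝒮`. -/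
def act : NCPoly →ₐ[ℂ] Module.End ℂ schwartz :=
  AlgHom.ofLinearMap
    { toFun := actLin
      map_add' := fun f g => LinearMap.ext fun x => Subtype.ext (Subtype.ext
        (by change evalPoly (f + g) _ = evalPoly f _ + evalPoly g _; rw [map_add]; rfl))
      map_smul' := fun c f => LinearMap.ext fun x => Subtype.ext (Subtype.ext
        (by change evalPoly (c • f) _ = c • evalPoly f _; rw [map_smul]; rfl)) }
    (LinearMap.ext fun x => Subtype.ext (Subtype.ext
        (by change evalPoly 1 _ = _; rw [map_one]; rfl)))
    (fun f g => LinearMap.ext fun x => Subtype.ext (Subtype.ext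
        (by change evalPoly (f * g) _ = evalPoly f (evalPoly g _); rw [map_mul]; rfl)))

lemma coe_act (f : NCPoly) (x : schwartz) :
    ((act f x : Fock) : ℕ → ℂ) = evalPoly f ((x : Fock) : ℕ → ℂ) := rfl

lemma polyOp_apply (f : NCPoly) (x : (polyOp f).domain) :
    polyOp f x = (act f ⟨x, x.2⟩ : Fock) := rfl

lemma app_of_mem {T : Fock →ₗ.[ℂ] Fock} {x : Fock} (h : x ∈ T.domain) : app T x = T ⟨x, h⟩ := by
  rw [app, dif_pos h]

lemma app_polyOp (f : NCPoly) (x : schwartz) : app (polyOp f) x = (act f x : Fock) :=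
  app_of_mem (T := polyOp f) x.2

lemma act_mul (f g : NCPoly) (x : schwartz) : act (f * g) x = act f (act g x) := by
  rw [map_mul, Module.End.mul_apply]

lemma schwartz_ext {x y : schwartz} (h : ∀ n, ((x : Fock) : ℕ → ℂ) n = ((y : Fock) : ℕ → ℂ) n) :
    x = y :=
  Subtype.ext (lp.ext (funext h))

lemma act_lo_apply (x : schwartz) (n : ℕ) : ((act lo x : Fock) : ℕ → ℂ) n =
    (Real.sqrt (n + 1) : ℂ) * ((x : Fock) : ℕ → ℂ) (n + 1) := evalPoly_lo _ _

lemma act_ra_apply (x : schwartz) (n : ℕ) : ((act ra x : Fock) : ℕ → ℂ) n =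
    (Real.sqrt n : ℂ) * ((x : Fock) : ℕ → ℂ) (n - 1) := evalPoly_ra _ _

lemma ofReal_sqrt_mul_self {a : ℝ} (h : 0 ≤ a) : (Real.sqrt a : ℂ) * Real.sqrt a = a := by
  rw [← Complex.ofReal_mul, Real.mul_self_sqrt h]

/-- The canonical commutation relation. -/
lemma act_lo_ra (x : schwartz) : act lo (act ra x) = act ra (act lo x) + x := by
  refine schwartz_ext fun n => ?_
  change _ = ((act ra (act lo x) : Fock) : ℕ → ℂ) n + ((x : Fock) : ℕ → ℂ) n
  rw [act_lo_apply, act_ra_apply, act_ra_apply, act_lo_apply, ← mul_assoc]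
  push_cast
  rw [ofReal_sqrt_mul_self (by positivity)]
  rcases n with _ | n
  · simp
  · simp only [Nat.add_sub_cancel, Nat.cast_add, Nat.cast_one, ← mul_assoc]
    rw [ofReal_sqrt_mul_self (by positivity)]
    push_cast
    ring

/-- The number operator `A* A`. -/
abbrev num : NCPoly := ra * lo

lemma act_num_apply (x : schwartz) (n : ℕ) : ((act num x : Fock) : ℕ → ℂ) n =
    n * ((x : Fock) : ℕ → ℂ) n := by
  rw [act_mul, act_ra_apply, act_lo_apply]
  rcases n with _ | n
  · simp
  · simp only [Nat.add_sub_cancel, Nat.cast_add, Nat.cast_one, ← mul_assoc]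
    rw [ofReal_sqrt_mul_self (by positivity)]
    push_cast
    ring

lemma act_num_add_one_apply (x : schwartz) (n : ℕ) : ((act (num + 1) x : Fock) : ℕ → ℂ) n =
    (n + 1) * ((x : Fock) : ℕ → ℂ) n := by
  rw [map_add, map_one, add_mul, one_mul, ← act_num_apply]
  rfl

lemma inner_act_ra (x y : schwartz) :
    inner ℂ (act ra x : Fock) (y : Fock) = inner ℂ (x : Fock) (act lo y : Fock) := by
  have h1 := lp.hasSum_inner (𝕜 := ℂ) (act ra x : Fock) (y : Fock)
  have h2 := lp.hasSum_inner (𝕜 := ℂ) (x : Fock) (act lo y : Fock)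
  -- The zeroth term contains `√0` and vanishes; this also neutralises the convention `0 - 1 = 0` in
  -- `creation`. Dropping it aligns the two series.
  rw [← hasSum_nat_add_iff' 1] at h1
  simp only [Finset.range_one, Finset.sum_singleton, act_ra_apply, act_lo_apply] at h1 h2
  simp only [CharP.cast_eq_zero, Real.sqrt_zero, Complex.ofReal_zero, zero_mul,
    inner_zero_left, sub_zero] at h1
  refine h1.unique ((funext fun n => ?_ : (fun n => _) = fun n => _) ▸ h2)
  simp only [RCLike.inner_apply, Nat.add_sub_cancel, map_mul, Complex.conj_ofReal]
  push_cast
  ring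

lemma inner_act_lo (x y : schwartz) :
    inner ℂ (act lo x : Fock) (y : Fock) = inner ℂ (x : Fock) (act ra y : Fock) := by
  rw [← inner_conj_symm, ← inner_act_ra, inner_conj_symm]

lemma exists_formal_adjoint (f : NCPoly) : ∃ f' : NCPoly, ∀ x y : schwartz,
    inner ℂ (act f x : Fock) (y : Fock) = inner ℂ (x : Fock) (act f' y : Fock) := by
  induction f using FreeAlgebra.induction with
  | grade0 r =>
    refine ⟨algebraMap ℂ NCPoly (conj r), fun x y => ?_⟩
    rw [AlgHom.commutes, AlgHom.commutes]
    change inner ℂ (r • (x : Fock)) (y : Fock) = inner ℂ (x : Fock) (conj r • (y : Fock))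
    rw [inner_smul_left, inner_smul_right]
  | grade1 l =>
    cases l
    · exact ⟨ra, inner_act_lo⟩
    · exact ⟨lo, inner_act_ra⟩
  | mul f g hf hg =>
    obtain ⟨f', hf⟩ := hf
    obtain ⟨g', hg⟩ := hg
    exact ⟨g' * f', fun x y => by rw [act_mul, act_mul, hf, hg]⟩
  | add f g hf hg =>
    obtain ⟨f', hf⟩ := hf
    obtain ⟨g', hg⟩ := hg
    refine ⟨f' + g', fun x y => ?_⟩
    rw [map_add, map_add, LinearMap.add_apply, LinearMap.add_apply, Submodule.coe_add,
      Submodule.coe_add, inner_add_left, inner_add_right, hf, hg]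

/-! ### Membership in `𝒮` -/

lemma hasSum_coe {a : ℕ → Fock} {x : Fock} (h : HasSum a x) :
    HasSum (fun k => (a k : ℕ → ℂ)) (x : ℕ → ℂ) :=
  h.map (lp.coeFnAddMonoidHom (fun _ : ℕ => ℂ) 2) (continuous_apply_lp (E := fun _ : ℕ => ℂ))

lemma hasSum_evalPoly {c : ℕ → ℂ} {y : ℕ → Fock} {x : Fock}
    (h : HasSum (fun k => c k • y k) x) (f : NCPoly) :
    HasSum (fun k => c k • evalPoly f (y k : ℕ → ℂ)) (evalPoly f (x : ℕ → ℂ)) := by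
  have h2 := (hasSum_coe h).map (evalPoly f) (continuous_evalPoly f)
  have e : (evalPoly f ∘ fun k => ((c k • y k : Fock) : ℕ → ℂ)) =
      fun k => c k • evalPoly f (y k : ℕ → ℂ) := funext fun k => by
    rw [Function.comp_apply, lp.coeFn_smul, map_smul]
  rwa [e] at h2

/-- The series of the `f(A, A*) y_k` converges in `ℓ²`, and coordinatewise its sum is `f(A, A*) x`.
So absolute convergence for every `f` puts `x` in `𝒮`. -/
lemma hasSum_act {y : ℕ → schwartz} {c : ℕ → ℂ} {x : Fock}
    (hx : HasSum (fun k => c k • (y k : Fock)) x)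
    (hf : ∀ f, Summable fun k => ‖c k‖ * ‖(act f (y k) : Fock)‖) :
    ∃ h : x ∈ schwartz, ∀ f, HasSum (fun k => c k • (act f (y k) : Fock))
      (act f (⟨x, h⟩ : schwartz) : Fock) := by
  have key : ∀ f, ∃ z : Fock, HasSum (fun k => c k • (act f (y k) : Fock)) z ∧
      evalPoly f (x : ℕ → ℂ) = (z : ℕ → ℂ) := fun f => by
    have hs : Summable fun k => c k • (act f (y k) : Fock) :=
      Summable.of_norm (by simpa only [norm_smul] using hf f)
    refine ⟨_, hs.hasSum, ?_⟩
    exact (hasSum_evalPoly hx f).unique (hasSum_coe hs.hasSum)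
  refine ⟨fun f => ?_, fun f => ?_⟩
  · obtain ⟨z, -, hz⟩ := key f
    rw [hz]
    exact lp.memℓp z
  · obtain ⟨z, h, hz⟩ := key f
    convert h using 1
    exact lp.ext hz

/-- Sequences dominated by a geometric one. -/
def IsGeometric (x : ℕ → ℂ) : Prop := ∃ q C : ℝ, 0 < q ∧ q < 1 ∧ ∀ n, ‖x n‖ ≤ C * q ^ n

lemma exists_mul_pow_le {q : ℝ} (h0 : 0 < q) (h1 : q < 1) :
    ∃ C, 0 ≤ C ∧ ∀ n : ℕ, ((n : ℝ) + 1) * q ^ n ≤ C := by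
  have h := (tendsto_self_mul_const_pow_of_lt_one h0.le h1).add
    (tendsto_pow_atTop_nhds_zero_of_lt_one h0.le h1)
  obtain ⟨C, hC⟩ := h.bddAbove_range
  refine ⟨C, le_trans (by norm_num) (hC ⟨0, rfl⟩), fun n => ?_⟩
  rw [add_mul, one_mul]
  exact hC ⟨n, rfl⟩

lemma IsGeometric.of_le {x : ℕ → ℂ} {q C : ℝ} (h0 : 0 < q) (h1 : q < 1) (hC : 0 ≤ C)
    (h : ∀ n, ‖x n‖ ≤ C * ((n + 1) * q ^ n)) : IsGeometric x := by
  have hs0 : 0 < Real.sqrt q := Real.sqrt_pos.mpr h0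
  have hs1 : Real.sqrt q < 1 := by
    rw [← Real.sqrt_one]
    exact Real.sqrt_lt_sqrt h0.le h1
  obtain ⟨D, -, hD⟩ := exists_mul_pow_le hs0 hs1
  refine ⟨Real.sqrt q, C * D, hs0, hs1, fun n => (h n).trans ?_⟩
  -- One factor `√q ^ n` absorbs the linear growth `n + 1`; the other remains as the geometric
  -- bound.
  have : q ^ n = Real.sqrt q ^ n * Real.sqrt q ^ n := by
    rw [← mul_pow, Real.mul_self_sqrt h0.le]
  rw [this, mul_assoc, ← mul_assoc ((n : ℝ) + 1)]
  gcongr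
  exact hD n

lemma sqrt_le_add_one (n : ℕ) : Real.sqrt n ≤ n + 1 :=
  Real.sqrt_le_iff.mpr ⟨by positivity, by nlinarith [(Nat.cast_nonneg n : (0 : ℝ) ≤ n)]⟩

lemma sqrt_add_one_le (n : ℕ) : Real.sqrt (n + 1) ≤ n + 1 :=
  Real.sqrt_le_iff.mpr ⟨by positivity, by nlinarith [(Nat.cast_nonneg n : (0 : ℝ) ≤ n)]⟩

lemma IsGeometric.evalPoly {x : ℕ → ℂ} (hx : IsGeometric x) (f : NCPoly) :
    IsGeometric (evalPoly f x) := by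
  induction f using FreeAlgebra.induction generalizing x with
  | grade0 r =>
    obtain ⟨q, C, h0, h1, h⟩ := hx
    refine ⟨q, ‖r‖ * C, h0, h1, fun n => ?_⟩
    rw [AlgHom.commutes]
    change ‖r * x n‖ ≤ _
    rw [norm_mul, mul_assoc]
    gcongr
    exact h n
  | grade1 l =>
    obtain ⟨q, C, h0, h1, h⟩ := hx
    have hC : 0 ≤ C := by simpa using (norm_nonneg _).trans (h 0)
    cases l
    · refine IsGeometric.of_le h0 h1 hC fun n => ?_
      rw [evalPoly_lo, norm_mul, Complex.norm_real, Real.norm_of_nonneg (Real.sqrt_nonneg _)]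
      calc Real.sqrt (n + 1) * ‖x (n + 1)‖ ≤ (n + 1) * (C * q ^ (n + 1)) := by
            gcongr
            · exact sqrt_add_one_le n
            · exact h _
        _ ≤ (n + 1) * (C * q ^ n) := by
            gcongr ?_ * (?_ * ?_)
            exact pow_le_pow_of_le_one h0.le h1.le (Nat.le_succ n)
        _ = _ := by ring
    · refine IsGeometric.of_le h0 h1 (C := C / q) (by positivity) fun n => ?_
      rw [evalPoly_ra, norm_mul, Complex.norm_real, Real.norm_of_nonneg (Real.sqrt_nonneg _)]
      rcases n with _ | n
      · simpa using div_nonneg hC h0.le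
      · calc Real.sqrt ((n + 1 : ℕ) : ℝ) * ‖x n‖ ≤ ((n + 1 : ℕ) + 1) * (C * q ^ n) := by
              gcongr
              · exact sqrt_le_add_one _
              · exact h _
          _ = _ := by field_simp; ring
  | mul f g hf hg =>
    rw [map_mul]
    exact hf (hg hx)
  | add f g hf hg =>
    obtain ⟨q, C, h0, h1, h⟩ := hf hx
    obtain ⟨q', C', h0', h1', h'⟩ := hg hx
    have hC : 0 ≤ C := by simpa using (norm_nonneg _).trans (h 0)
    have hC' : 0 ≤ C' := by simpa using (norm_nonneg _).trans (h' 0)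
    refine ⟨max q q', C + C', lt_max_of_lt_left h0, max_lt h1 h1', fun n => ?_⟩
    rw [map_add, add_mul]
    refine (norm_add_le _ _).trans (add_le_add ((h n).trans ?_) ((h' n).trans ?_))
    · gcongr
      exact le_max_left _ _
    · gcongr
      exact le_max_right _ _

lemma IsGeometric.memℓp {x : ℕ → ℂ} (hx : IsGeometric x) :
    Memℓp (E := fun _ : ℕ => ℂ) x 2 := by
  obtain ⟨q, C, h0, h1, h⟩ := hx
  rw [memℓp_two_iff]
  have : Summable fun n : ℕ => C ^ 2 * (q ^ 2) ^ n :=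
    (summable_geometric_of_lt_one (by positivity) (by nlinarith)).mul_left _
  refine Summable.of_nonneg_of_le (fun n => by positivity) (fun n => ?_) this
  calc ‖x n‖ ^ 2 ≤ (C * q ^ n) ^ 2 := by gcongr; exact h n
    _ = _ := by ring

/-- A geometrically bounded sequence as an element of `𝒮`. -/
def IsGeometric.toSchwartz {x : ℕ → ℂ} (hx : IsGeometric x) : schwartz :=
  ⟨⟨x, hx.memℓp⟩, fun f => (hx.evalPoly f).memℓp⟩

lemma isGeometric_numberState (n : ℕ) : IsGeometric (numberState n) := by
  refine ⟨1 / 2, 2 ^ n, by norm_num, by norm_num, fun m => ?_⟩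
  rw [numberState_apply]
  split_ifs with h
  · rw [h, ← mul_pow]
    norm_num
  · simp only [norm_zero]
    positivity

/-- The number states as elements of `𝒮`. -/
def nst (n : ℕ) : schwartz := (isGeometric_numberState n).toSchwartz

@[simp] lemma coe_nst (n : ℕ) : (nst n : Fock) = numberState n := rfl

lemma nst_apply (n m : ℕ) : ((nst n : Fock) : ℕ → ℂ) m = if m = n then 1 else 0 :=
  numberState_apply n m

lemma norm_numberState (n : ℕ) : ‖numberState n‖ = 1 := by
  rw [← numberBasis_apply]
  exact numberBasis.orthonormal.1 n

lemma act_ra_nst (n : ℕ) : act ra (nst n) = (Real.sqrt (n + 1) : ℂ) • nst (n + 1) := by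
  refine schwartz_ext fun m => ?_
  change _ = (Real.sqrt (n + 1) : ℂ) * ((nst (n + 1) : Fock) : ℕ → ℂ) m
  rw [act_ra_apply, nst_apply, nst_apply]
  rcases m with _ | m
  · simp
  · by_cases h : m = n <;> simp [h]

lemma act_lo_nst_zero : act lo (nst 0) = 0 := by
  refine schwartz_ext fun m => ?_
  rw [act_lo_apply, nst_apply]
  simp

lemma act_lo_nst (n : ℕ) : act lo (nst (n + 1)) = (Real.sqrt (n + 1) : ℂ) • nst n := by
  refine schwartz_ext fun m => ?_
  change _ = (Real.sqrt (n + 1) : ℂ) * ((nst n : Fock) : ℕ → ℂ) m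
  rw [act_lo_apply, nst_apply, nst_apply]
  by_cases h : m = n <;> simp [h]

lemma act_num_nst (n : ℕ) : act num (nst n) = (n : ℂ) • nst n := by
  refine schwartz_ext fun m => ?_
  change _ = (n : ℂ) * ((nst n : Fock) : ℕ → ℂ) m
  rw [act_num_apply, nst_apply]
  by_cases h : m = n <;> simp [h]

/-! ### Decay estimates -/

lemma summable_inv_sq : Summable fun n : ℕ => (1 / ((n : ℝ) + 1)) ^ 2 := by
  have := (summable_nat_add_iff 1).mpr (Real.summable_one_div_nat_pow.mpr one_lt_two)
  simpa using this

/-- `D = (N + 1)⁻¹` is Hilbert–Schmidt because `∑ (n + 1)⁻²` converges. It trades one power of `N +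
1` for square summability over any orthonormal basis. -/
lemma exists_inv_num : ∃ D : Fock →L[ℂ] Fock, (∀ x y, inner ℂ (D x) y = inner ℂ x (D y)) ∧
    (∀ x : schwartz, D (act (num + 1) x : Fock) = x) ∧
    ∀ b : HilbertBasis ℕ ℂ Fock, Summable fun n => ‖D (b n)‖ ^ 2 := by
  have hb : ∀ n : ℕ, ‖((1 / ((n : ℝ) + 1) : ℝ) : ℂ)‖ ≤ 1 := fun n => by
    rw [Complex.norm_real, Real.norm_of_nonneg (by positivity)]
    exact (div_le_one (by positivity)).mpr (by linarith [(Nat.cast_nonneg n : (0 : ℝ) ≤ n)])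
  obtain ⟨D, hD⟩ := exists_diag numberBasis hb
  refine ⟨D, inner_diag_real hD, fun x => ?_, fun b => ?_⟩
  · refine basis_inner_ext numberBasis fun n => ?_
    rw [inner_diag hD, numberBasis_apply, inner_numberState, inner_numberState,
      act_num_add_one_apply, ← mul_assoc]
    push_cast
    rw [one_div_mul_cancel (by exact_mod_cast n.succ_ne_zero), one_mul]
  · have : HasSum (fun n => ‖D (numberBasis n)‖ ^ 2) (∑' n : ℕ, (1 / ((n : ℝ) + 1)) ^ 2) := by
      refine (funext fun n => ?_ : (fun n : ℕ => _) = fun n => _) ▸ summable_inv_sq.hasSum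
      rw [hD, norm_smul, numberBasis.orthonormal.1, mul_one, Complex.norm_real,
        Real.norm_of_nonneg (by positivity)]
    exact (hasSum_norm_sq_basis this b).summable

/-- Cauchy–Schwarz applied to `|x_n| (n + 1) = (n + 1)⁻¹ |((N + 1)² x)_n|`. Any operator with `‖T
e_n‖ = O(n + 1)` is thereby controlled on `𝒮` by the weight `(N + 1)²`. -/
lemma exists_sum_coeff_le : ∃ C : ℝ, 0 ≤ C ∧ ∀ x : schwartz,
    (Summable fun n : ℕ => ‖((x : Fock) : ℕ → ℂ) n‖ * (n + 1)) ∧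
    ∑' n : ℕ, ‖((x : Fock) : ℕ → ℂ) n‖ * (n + 1) ≤ C * ‖(act ((num + 1) * (num + 1)) x : Fock)‖ := by
  refine ⟨Real.sqrt (∑' n : ℕ, (1 / ((n : ℝ) + 1)) ^ 2), Real.sqrt_nonneg _, fun x => ?_⟩
  set y : Fock := (act ((num + 1) * (num + 1)) x : Fock) with hy
  have h : ∀ n : ℕ, ‖((x : Fock) : ℕ → ℂ) n‖ * (n + 1) =
      1 / ((n : ℝ) + 1) * ‖(y : ℕ → ℂ) n‖ := fun n => by
    rw [hy, act_mul, act_num_add_one_apply, act_num_add_one_apply, norm_mul, norm_mul]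
    have : ‖(n : ℂ) + 1‖ = n + 1 := by
      have := Complex.norm_natCast (n + 1)
      push_cast at this
      exact this
    rw [this]
    field_simp
  simp_rw [h]
  have h1 := Real.inner_le_Lp_mul_Lq_tsum_of_nonneg Real.HolderConjugate.two_two
    (f := fun n : ℕ => 1 / ((n : ℝ) + 1)) (g := fun n => ‖(y : ℕ → ℂ) n‖)
    (fun _ => by positivity) (fun _ => norm_nonneg _)
    (by simpa using summable_inv_sq) (by simpa using (hasSum_norm_sq y).summable)
  refine ⟨summable_mul_of_sq summable_inv_sq (hasSum_norm_sq y).summable,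
    h1.trans (le_of_eq ?_)⟩
  simp only [Real.rpow_two]
  rw [(hasSum_norm_sq y).tsum_eq, ← Real.sqrt_eq_rpow,
    ← Real.sqrt_eq_rpow, Real.sqrt_sq (norm_nonneg _)]

/-! ### Operators implementing Bogoliubov transformations -/

lemma substPoly_lo (g : Bogoliubov) : substPoly g lo = g.τ • lo + g.θ • ra := by
  rw [substPoly, FreeAlgebra.lift_ι_apply]

lemma substPoly_ra (g : Bogoliubov) : substPoly g ra = conj g.τ • ra + conj g.θ • lo := by
  rw [substPoly, FreeAlgebra.lift_ι_apply]

lemma substPoly_mul (g h : Bogoliubov) (f : NCPoly) :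
    substPoly (g * h) f = substPoly g (substPoly h f) := by
  have hτ : (g * h).τ = g.τ * h.τ + conj g.θ * h.θ := rfl
  have hθ : (g * h).θ = g.θ * h.τ + conj g.τ * h.θ := rfl
  have : substPoly (g * h) = (substPoly g).comp (substPoly h) := by
    refine FreeAlgebra.hom_ext (funext fun l => ?_)
    cases l
    · change substPoly (g * h) lo = substPoly g (substPoly h lo)
      rw [substPoly_lo, substPoly_lo, map_add, map_smul, map_smul, substPoly_lo, substPoly_ra,
        hτ, hθ]
      module
    · change substPoly (g * h) ra = substPoly g (substPoly h ra)
      rw [substPoly_ra, substPoly_ra, map_add, map_smul, map_smul, substPoly_lo, substPoly_ra,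
        hτ, hθ]
      simp only [map_add, map_mul, Complex.conj_conj]
      module
  rw [this]
  rfl

lemma substPoly_one (f : NCPoly) : substPoly 1 f = f := by
  have hτ : (1 : Bogoliubov).τ = 1 := rfl
  have hθ : (1 : Bogoliubov).θ = 0 := rfl
  have : substPoly 1 = AlgHom.id ℂ NCPoly := by
    refine FreeAlgebra.hom_ext (funext fun l => ?_)
    cases l
    · change substPoly 1 lo = lo
      rw [substPoly_lo, hτ, hθ]
      simp
    · change substPoly 1 ra = ra
      rw [substPoly_ra, hτ, hθ]
      simp
  rw [this]
  rfl

lemma substPoly_inv_right (g : Bogoliubov) (f : NCPoly) :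
    substPoly g (substPoly g⁻¹ f) = f := by
  rw [← substPoly_mul, mul_inv_cancel, substPoly_one]

/-- The isometry `V` carries `f(A, A*)` to `f(a_g, a_g*)` on `𝒮`. -/
def Intertwines (g : Bogoliubov) (V : Fock →ₗᵢ[ℂ] Fock) : Prop :=
  ∀ x : schwartz, ∃ h : V x ∈ schwartz, ∀ f,
    (act (substPoly g f) ⟨V x, h⟩ : Fock) = V (act f x : Fock)

lemma Intertwines.comp {g h : Bogoliubov} {V V' : Fock →ₗᵢ[ℂ] Fock} (hV : Intertwines g V)
    (hV' : Intertwines h V') : Intertwines (g * h) (V.comp V') := fun x => by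
  obtain ⟨h1, h2⟩ := hV' x
  obtain ⟨h3, h4⟩ := hV ⟨V' x, h1⟩
  refine ⟨h3, fun f => ?_⟩
  rw [substPoly_mul]
  exact (h4 _).trans (congrArg V (h2 f))

/-- The relation is stated for sequences because `V x` is not yet known to lie in `𝒮`. The set of
polynomials satisfying it is closed under sums and products. -/
lemma intertwines_of_letters {g : Bogoliubov} {V : Fock →ₗᵢ[ℂ] Fock}
    (h : ∀ (x : schwartz) l, evalPoly (substPoly g (FreeAlgebra.ι ℂ l)) (V x : ℕ → ℂ) =
      (V (act (FreeAlgebra.ι ℂ l) x : Fock) : ℕ → ℂ)) : Intertwines g V := by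
  have key : ∀ f (x : schwartz), evalPoly (substPoly g f) (V x : ℕ → ℂ) =
      (V (act f x : Fock) : ℕ → ℂ) := fun f => by
    induction f using FreeAlgebra.induction with
    | grade0 r =>
      intro x
      rw [AlgHom.commutes, AlgHom.commutes, AlgHom.commutes]
      change r • (V x : ℕ → ℂ) = (V (r • (x : Fock)) : ℕ → ℂ)
      rw [map_smul]
      rfl
    | grade1 l => exact fun x => h x l
    | mul f f' hf hf' =>
      intro x
      rw [map_mul, map_mul, Module.End.mul_apply, hf', hf, act_mul]
    | add f f' hf hf' =>
      intro x
      rw [map_add, map_add, LinearMap.add_apply, hf, hf', map_add]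
      change _ = (V ((act f x : Fock) + (act f' x : Fock)) : ℕ → ℂ)
      rw [map_add]
      rfl
  refine fun x => ⟨fun f => ?_, fun f => lp.ext (key f x)⟩
  -- Every `f` is a substituted polynomial, so `f(A, A*) V x` is `V` of a vector in `ℓ²`, hence
  -- square summable.
  have := key (substPoly g⁻¹ f) x
  rw [substPoly_inv_right] at this
  rw [this]
  exact lp.memℓp _

/-- Schur's lemma for the oscillator: `X e_0` is annihilated by `A`, hence is `c e_0`, and applying
`A*` carries the same scalar `c` to every `e_n`. -/
lemma Intertwines.eq_smul {X : Fock →ₗᵢ[ℂ] Fock} (h : Intertwines 1 X) :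
    ∃ c : ℂ, ‖c‖ = 1 ∧ ∀ x, X x = c • x := by
  have hX : ∀ x : schwartz, ∃ h : X x ∈ schwartz, ∀ f,
      (act f ⟨X x, h⟩ : Fock) = X (act f x : Fock) := fun x => by
    simpa only [substPoly_one] using h x
  obtain ⟨h1, h2⟩ := hX (nst 0)
  have h3 : X (numberState 0) = (X (numberState 0) : ℕ → ℂ) 0 • numberState 0 := by
    ext n
    change _ = (X (numberState 0) : ℕ → ℂ) 0 * (numberState 0 : ℕ → ℂ) n
    rcases n with _ | n
    · simp [numberState_apply]
    · have h4 := congrArg (fun z : Fock => (z : ℕ → ℂ) n) (h2 lo)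
      simp only [act_lo_apply, act_lo_nst_zero, Submodule.coe_zero, map_zero] at h4
      rw [numberState_apply, if_neg n.succ_ne_zero, mul_zero]
      refine (mul_eq_zero.mp h4).resolve_left ?_
      exact_mod_cast (Real.sqrt_pos.mpr (by positivity : (0 : ℝ) < n + 1)).ne'
  set c := (X (numberState 0) : ℕ → ℂ) 0
  have h5 : ∀ n, X (numberState n) = c • numberState n := fun n => by
    induction n with
    | zero => exact h3
    | succ n ih =>
      obtain ⟨h6, h7⟩ := hX (nst n)
      have h8 := h7 ra
      have h9 : (⟨X (nst n : Fock), h6⟩ : schwartz) = c • nst n := Subtype.ext ih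
      rw [h9, map_smul, act_ra_nst] at h8
      have hs : (Real.sqrt (n + 1) : ℂ) ≠ 0 := by
        exact_mod_cast (Real.sqrt_pos.mpr (by positivity : (0 : ℝ) < n + 1)).ne'
      change c • (Real.sqrt (n + 1) : ℂ) • numberState (n + 1) =
        X ((Real.sqrt (n + 1) : ℂ) • numberState (n + 1)) at h8
      rw [map_smul, smul_comm] at h8
      exact (smul_right_injective _ hs h8).symm
  refine ⟨c, ?_, fun x => ?_⟩
  · have := X.norm_map (numberState 0)
    rwa [h3, norm_smul, norm_numberState, mul_one] at this
  · have : X.toContinuousLinearMap = c • ContinuousLinearMap.id ℂ Fock :=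
      basis_ext numberBasis fun n => by
        rw [numberBasis_apply]
        exact h5 n
    exact congrArg (fun T : Fock →L[ℂ] Fock => T x) this

/-! ### Existence of implementing isometries -/

lemma act_subst_lo_ra (g : Bogoliubov) (x : schwartz) :
    act (substPoly g lo) (act (substPoly g ra) x) =
      act (substPoly g ra) (act (substPoly g lo) x) + x := by
  have hg := g.conj_sub
  simp only [substPoly_lo, substPoly_ra, map_add, map_smul, LinearMap.add_apply,
    LinearMap.smul_apply, act_lo_ra]
  linear_combination (norm := module) hg • x

lemma inner_act_subst_ra (g : Bogoliubov) (x y : schwartz) :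
    inner ℂ (act (substPoly g ra) x : Fock) (y : Fock) =
      inner ℂ (x : Fock) (act (substPoly g lo) y : Fock) := by
  simp only [substPoly_lo, substPoly_ra, map_add, map_smul, LinearMap.add_apply,
    LinearMap.smul_apply, Submodule.coe_add, Submodule.coe_smul, inner_add_left, inner_add_right,
    inner_smul_left, inner_smul_right, inner_act_ra, inner_act_lo, Complex.conj_conj]

/-- The coefficients of the transformed vacuum, up to normalisation. -/
def vacSeq (r : ℂ) : ℕ → ℂ
  | 0 => 1
  | 1 => 0
  | n + 2 => -r * ((Real.sqrt (n + 1) : ℂ) / (Real.sqrt (n + 2) : ℂ)) * vacSeq r n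

lemma isGeometric_vacSeq {r : ℂ} (hr : ‖r‖ < 1) : IsGeometric (vacSeq r) := by
  -- The recursion advances by two indices, so the ratio is `√‖r‖`; the maximum with `1/2` keeps it
  -- positive when `r = 0`.
  set q := max (Real.sqrt ‖r‖) (1 / 2) with hq
  have h0 : 0 < q := lt_max_of_lt_right (by norm_num)
  have h1 : q < 1 := max_lt (by
    rw [← Real.sqrt_one]
    exact Real.sqrt_lt_sqrt (norm_nonneg _) hr) (by norm_num)
  have h2 : ‖r‖ ≤ q ^ 2 := by
    rw [← Real.sq_sqrt (norm_nonneg r)]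
    gcongr
    exact le_max_left _ _
  refine ⟨q, 1, h0, h1, fun n => ?_⟩
  rw [one_mul]
  induction n using Nat.twoStepInduction with
  | zero => simp [vacSeq]
  | one => simpa [vacSeq] using h0.le
  | more n ih _ =>
    have h3 : Real.sqrt (n + 1) / Real.sqrt (n + 2) ≤ 1 :=
      (div_le_one (Real.sqrt_pos.mpr (by positivity))).mpr (Real.sqrt_le_sqrt (by linarith))
    rw [vacSeq, norm_mul, norm_mul, norm_neg, norm_div, Complex.norm_real, Complex.norm_real,
      Real.norm_of_nonneg (Real.sqrt_nonneg _), Real.norm_of_nonneg (Real.sqrt_nonneg _)]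
    calc ‖r‖ * (Real.sqrt (n + 1) / Real.sqrt (n + 2)) * ‖vacSeq r n‖ ≤ q ^ 2 * 1 * q ^ n := by
          gcongr
      _ = q ^ (n + 2) := by ring

/-- The equation `a_g v = 0` is the two-step recursion of `vacSeq` with `r = θ/τ`. Since `|τ|² -
|θ|² = 1`, this ratio has modulus below one, so the solution decays geometrically and lies in `𝒮`.
-/
lemma exists_vacuum (g : Bogoliubov) :
    ∃ v : schwartz, ‖(v : Fock)‖ = 1 ∧ act (substPoly g lo) v = 0 := by
  have hτ : g.τ ≠ 0 := fun h => by
    have := g.norm_sub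
    rw [h] at this
    simp only [norm_zero] at this
    nlinarith [sq_nonneg ‖g.θ‖]
  have hr : ‖g.θ / g.τ‖ < 1 := by
    rw [norm_div, div_lt_one (norm_pos_iff.mpr hτ)]
    exact lt_of_pow_lt_pow_left₀ 2 (norm_nonneg _) (by linarith [g.norm_sub])
  set w : schwartz := (isGeometric_vacSeq hr).toSchwartz with hw
  have hwa : ∀ n, ((w : Fock) : ℕ → ℂ) n = vacSeq (g.θ / g.τ) n := fun n => rfl
  have hw0 : (w : Fock) ≠ 0 := fun h => by
    have := hwa 0
    rw [h] at this
    simp [vacSeq] at this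
  have h1 : act (substPoly g lo) w = 0 := by
    refine schwartz_ext fun n => ?_
    rw [substPoly_lo, map_add, map_smul, map_smul]
    change g.τ * ((act lo w : Fock) : ℕ → ℂ) n + g.θ * ((act ra w : Fock) : ℕ → ℂ) n = 0
    rw [act_lo_apply, act_ra_apply, hwa, hwa]
    rcases n with _ | n
    · simp [vacSeq]
    · have hs : (Real.sqrt ((n : ℝ) + 2) : ℂ) ≠ 0 := by
        exact_mod_cast (Real.sqrt_pos.mpr (by positivity : (0 : ℝ) < n + 2)).ne'
      have e : ((n + 1 : ℕ) : ℝ) + 1 = n + 2 := by push_cast; ring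
      rw [e, vacSeq]
      push_cast
      field_simp
      ring
  refine ⟨((‖(w : Fock)‖⁻¹ : ℝ) : ℂ) • w, ?_, by rw [map_smul, h1, smul_zero]⟩
  rw [Submodule.coe_smul, norm_smul, Complex.norm_real, norm_inv, norm_norm,
    inv_mul_cancel₀ (norm_ne_zero_iff.mpr hw0)]

lemma sqrt_succ_ne_zero (n : ℕ) : (Real.sqrt (n + 1) : ℂ) ≠ 0 := by
  exact_mod_cast (Real.sqrt_pos.mpr (by positivity : (0 : ℝ) < n + 1)).ne'

lemma norm_act_letter_le (l : Letter) (n : ℕ) :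
    ‖(act (FreeAlgebra.ι ℂ l) (nst n) : Fock)‖ ≤ n + 1 := by
  cases l
  · rcases n with _ | n
    · rw [act_lo_nst_zero]
      simp
    · rw [act_lo_nst, Submodule.coe_smul, norm_smul, Complex.norm_real, coe_nst, norm_numberState,
        Real.norm_of_nonneg (Real.sqrt_nonneg _), mul_one]
      refine (sqrt_add_one_le n).trans ?_
      push_cast
      linarith
  · rw [act_ra_nst, Submodule.coe_smul, norm_smul, Complex.norm_real, coe_nst, norm_numberState,
        Real.norm_of_nonneg (Real.sqrt_nonneg _), mul_one]
    exact sqrt_add_one_le n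

lemma hasSum_act_numberState {x : schwartz} {f : NCPoly}
    (hs : Summable fun n => ((x : Fock) : ℕ → ℂ) n • (act f (nst n) : Fock)) :
    HasSum (fun n => ((x : Fock) : ℕ → ℂ) n • (act f (nst n) : Fock)) (act f x : Fock) := by
  convert hs.hasSum using 1
  exact lp.ext ((hasSum_evalPoly (hasSum_numberState (x : Fock)) _).unique (hasSum_coe hs.hasSum))

lemma hasSum_act_letter (x : schwartz) (l : Letter) :
    HasSum (fun n => ((x : Fock) : ℕ → ℂ) n • (act (FreeAlgebra.ι ℂ l) (nst n) : Fock))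
      (act (FreeAlgebra.ι ℂ l) x : Fock) := by
  obtain ⟨C, -, hC⟩ := exists_sum_coeff_le
  refine hasSum_act_numberState (Summable.of_norm_bounded (hC x).1 fun n => ?_)
  rw [norm_smul]
  gcongr
  exact norm_act_letter_le l n

/-- Fock's construction relative to the transformed vacuum. The pair `(a_g, a_g*)` obeys the same
commutation and adjoint relations as `(A, A*)`, so the normalised vectors `ψ_n = (n!)^{-1/2}
(a_g*)^n v` reproduce the ladder; the isometry sends `e_n` to `ψ_n`. Completeness of the `ψ_n` is
not needed here. -/
lemma exists_intertwines (g : Bogoliubov) : ∃ V, Intertwines g V := by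
  obtain ⟨v, hv1, hv0⟩ := exists_vacuum g
  obtain ⟨ψ, hψ0, hψ⟩ : ∃ ψ : ℕ → schwartz, ψ 0 = v ∧
      ∀ n : ℕ, ψ (n + 1) = (Real.sqrt (n + 1) : ℂ)⁻¹ • act (substPoly g ra) (ψ n) :=
    ⟨fun n => Nat.rec v (fun n y => (Real.sqrt (n + 1) : ℂ)⁻¹ • act (substPoly g ra) y) n,
      rfl, fun _ => rfl⟩
  rw [← hψ0] at hv0 hv1
  have hra : ∀ n, act (substPoly g ra) (ψ n) = (Real.sqrt (n + 1) : ℂ) • ψ (n + 1) := fun n => by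
    rw [hψ, smul_inv_smul₀ (sqrt_succ_ne_zero n)]
  have step : ∀ n : ℕ, act (substPoly g ra) (act (substPoly g lo) (ψ n)) = (n : ℂ) • ψ n →
      act (substPoly g lo) (ψ (n + 1)) = (Real.sqrt (n + 1) : ℂ) • ψ n := fun n h1 => by
    rw [hψ, map_smul, act_subst_lo_ra, h1, inv_smul_eq_iff₀ (sqrt_succ_ne_zero n), smul_smul,
      ofReal_sqrt_mul_self (by positivity)]
    push_cast
    module
  have hlo : ∀ n, act (substPoly g lo) (ψ (n + 1)) = (Real.sqrt (n + 1) : ℂ) • ψ n := fun n => by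
    have h1 : act (substPoly g ra) (act (substPoly g lo) (ψ n)) = (n : ℂ) • ψ n := by
      induction n with
      | zero => rw [hv0, map_zero]; simp
      | succ n ih =>
        have h2 : act (substPoly g lo) (ψ (n + 1)) = (Real.sqrt (n + 1) : ℂ) • ψ n := step n ih
        rw [h2, map_smul, hra, smul_smul, ofReal_sqrt_mul_self (by positivity)]
        push_cast
        rfl
    exact step n h1
  -- Orthonormality by induction: moving `a_g*` across the inner product lowers both indices, until
  -- one of them reaches the vacuum, which `a_g` annihilates.
  have hinner : ∀ m n : ℕ, inner ℂ (ψ m).1 (ψ n).1 = if m = n then (1 : ℂ) else 0 := by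
    have h0 : ∀ n, inner ℂ (ψ (n + 1)).1 (ψ 0).1 = (0 : ℂ) := fun n => by
      have h1 := inner_act_subst_ra g (ψ n) (ψ 0)
      rw [hra, hv0, Submodule.coe_smul, inner_smul_left,
        Submodule.coe_zero, inner_zero_right, Complex.conj_ofReal] at h1
      exact (mul_eq_zero.mp h1).resolve_left (sqrt_succ_ne_zero n)
    intro m
    induction m with
    | zero =>
      intro n
      rcases n with _ | n
      · rw [inner_self_eq_norm_sq_to_K, hv1]
        simp
      · rw [← inner_conj_symm, h0]
        simp
    | succ m ih =>
      intro n
      rcases n with _ | n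
      · rw [h0]
        simp
      · have h1 := inner_act_subst_ra g (ψ m) (ψ (n + 1))
        rw [hra, hlo, Submodule.coe_smul, Submodule.coe_smul, inner_smul_left, inner_smul_right,
          ih, Complex.conj_ofReal] at h1
        apply mul_left_cancel₀ (sqrt_succ_ne_zero m)
        rw [h1]
        by_cases hmn : m = n <;> simp [hmn]
  have hon : Orthonormal ℂ fun n => (ψ n).1 := orthonormal_iff_ite.mpr hinner
  let V : Fock →ₗᵢ[ℂ] Fock := hon.orthogonalFamily.linearIsometry
  have hV : ∀ x : Fock, HasSum (fun n => (x : ℕ → ℂ) n • (ψ n).1) (V x) := fun x =>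
    hon.orthogonalFamily.hasSum_linearIsometry x
  have hVn : ∀ n, V (numberState n) = ψ n := fun n => by
    refine (hV _).unique ?_
    have := hasSum_single (f := fun m => (numberState n : ℕ → ℂ) m • (ψ m).1) n
      fun m hm => by rw [numberState_apply, if_neg hm, zero_smul]
    simpa [numberState_apply] using this
  refine ⟨V, intertwines_of_letters fun x l => ?_⟩
  have h1 := hasSum_evalPoly (hV x) (substPoly g (FreeAlgebra.ι ℂ l))
  have h2 : HasSum (fun n => (V ((x : Fock) n • (act (FreeAlgebra.ι ℂ l) (nst n) : Fock)) : ℕ → ℂ))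
      (V (act (FreeAlgebra.ι ℂ l) x : Fock) : ℕ → ℂ) := hasSum_coe ((hasSum_act_letter x l).mapL V.toContinuousLinearMap)
  refine h1.unique ?_
  convert h2 using 2 with n
  rw [map_smul, lp.coeFn_smul, ← coe_act]
  congr 2
  cases l
  · rcases n with _ | n
    · rw [act_lo_nst_zero, hv0, Submodule.coe_zero,
        map_zero]
    · rw [act_lo_nst, hlo, Submodule.coe_smul, Submodule.coe_smul, map_smul, coe_nst, hVn]
  · rw [act_ra_nst, hra, Submodule.coe_smul, Submodule.coe_smul, map_smul, coe_nst, hVn]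

/-! ### Implementing unitary operators -/

@[simp] lemma mem_conjOp {W : Fock ≃ₗᵢ[ℂ] Fock} {T : Fock →ₗ.[ℂ] Fock} {x : Fock} :
    x ∈ (conjOp W T).domain ↔ W.symm x ∈ T.domain := Iff.rfl

lemma conjOp_apply {W : Fock ≃ₗᵢ[ℂ] Fock} {T : Fock →ₗ.[ℂ] Fock} {x : Fock}
    (h : x ∈ (conjOp W T).domain) : conjOp W T ⟨x, h⟩ = W (T ⟨W.symm x, h⟩) := rfl

lemma app_conjOp (W : Fock ≃ₗᵢ[ℂ] Fock) (T : Fock →ₗ.[ℂ] Fock) (x : Fock) :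
    app (conjOp W T) x = W (app T (W.symm x)) := by
  by_cases h : x ∈ (conjOp W T).domain
  · rw [app_of_mem h, app_of_mem (mem_conjOp.mp h), conjOp_apply]
  · rw [app, app, dif_neg h, dif_neg (fun h' => h (mem_conjOp.mpr h')), map_zero]

/-- An equality of partially defined operators includes equality of domains: `h` gives `W 𝒮 ⊆ 𝒮`,
and `h'` gives the reverse inclusion. -/
lemma implements_of_intertwines {g : Bogoliubov} {W : Fock ≃ₗᵢ[ℂ] Fock}
    (h : Intertwines g W.toLinearIsometry) (h' : ∀ x ∈ schwartz, W.symm x ∈ schwartz) (f : NCPoly) :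
    conjOp W (polyOp f) = polyOp (substPoly g f) := by
  refine LinearPMap.ext (Submodule.ext fun x => ⟨fun hx => ?_, fun hx => h' x hx⟩) ?_
  · obtain ⟨h1, -⟩ := h ⟨W.symm x, hx⟩
    exact (by simpa using h1 : x ∈ schwartz)
  · intro x hx hx'
    obtain ⟨h1, h2⟩ := h ⟨W.symm x, hx⟩
    rw [conjOp_apply, polyOp_apply, polyOp_apply]
    refine (h2 f).symm.trans ?_
    congr 3
    simp

lemma Implements.intertwines {g : Bogoliubov} {W : Fock ≃ₗᵢ[ℂ] Fock} (h : Implements g W) :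
    Intertwines g W.toLinearIsometry := by
  have hmem : ∀ x : schwartz, W x ∈ schwartz := fun x => by
    have : W x ∈ (conjOp W (polyOp lo)).domain := by
      rw [mem_conjOp, LinearIsometryEquiv.symm_apply_apply]
      exact x.2
    rw [h Letter.lower] at this
    exact this
  refine intertwines_of_letters fun x l => ?_
  have h1 := congrArg (fun T => app T (W x)) (h l)
  simp only [app_conjOp, LinearIsometryEquiv.symm_apply_apply, app_polyOp] at h1
  have h2 := app_polyOp (substPoly g (FreeAlgebra.ι ℂ l)) ⟨W x, hmem x⟩
  exact congrArg (fun z : Fock => (z : ℕ → ℂ)) (h2.symm.trans h1.symm)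

lemma Implements.symm_mem {g : Bogoliubov} {W : Fock ≃ₗᵢ[ℂ] Fock} (h : Implements g W)
    {x : Fock} (hx : x ∈ schwartz) : W.symm x ∈ schwartz := by
  have : x ∈ (polyOp (substPoly g lo)).domain := hx
  rw [← h Letter.lower] at this
  exact this

lemma Implements.mem {g : Bogoliubov} {W : Fock ≃ₗᵢ[ℂ] Fock} (h : Implements g W)
    {x : Fock} (hx : x ∈ schwartz) : W x ∈ schwartz :=
  (h.intertwines ⟨x, hx⟩).1

lemma Implements.intertwines_symm {g : Bogoliubov} {W : Fock ≃ₗᵢ[ℂ] Fock} (h : Implements g W) :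
    Intertwines g⁻¹ W.symm.toLinearIsometry := fun x => by
  refine ⟨h.symm_mem x.2, fun f => W.injective ?_⟩
  obtain ⟨h1, h2⟩ := h.intertwines ⟨W.symm x, h.symm_mem x.2⟩
  refine (h2 _).symm.trans ?_
  rw [substPoly_inv_right]
  change _ = W (W.symm _)
  rw [LinearIsometryEquiv.apply_symm_apply]
  congr 2
  exact Subtype.ext (W.apply_symm_apply x)

/-- Surjectivity without a completeness argument: the isometry for `g` composed with the one for
`g⁻¹` intertwines the identity, so it is a scalar of modulus one, and the first factor must be onto.
-/
lemma exists_implements (g : Bogoliubov) : ∃ W, Implements g W := by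
  obtain ⟨V, hV⟩ := exists_intertwines g
  obtain ⟨V', hV'⟩ := exists_intertwines g⁻¹
  have h1 := hV.comp hV'
  rw [mul_inv_cancel] at h1
  obtain ⟨c, hc, h2⟩ := h1.eq_smul
  have hc0 : c ≠ 0 := norm_ne_zero_iff.mp (by rw [hc]; exact one_ne_zero)
  have h3 : ∀ x, V (c⁻¹ • V' x) = x := fun x => by
    rw [map_smul]
    change c⁻¹ • (V.comp V') x = x
    rw [h2, inv_smul_smul₀ hc0]
  let W : Fock ≃ₗᵢ[ℂ] Fock := LinearIsometryEquiv.ofSurjective V fun x => ⟨_, h3 x⟩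
  refine ⟨W, fun l => implements_of_intertwines (W := W) hV (fun x hx => ?_) _⟩
  have : W.symm x = c⁻¹ • V' x := W.injective (by
    rw [LinearIsometryEquiv.apply_symm_apply]
    exact (h3 x).symm)
  rw [this]
  exact schwartz.smul_mem _ (hV' ⟨x, hx⟩).1

lemma Implements.eq_smul {g : Bogoliubov} {W W' : Fock ≃ₗᵢ[ℂ] Fock} (h : Implements g W)
    (h' : Implements g W') : ∃ c : ℂ, ‖c‖ = 1 ∧ ∀ x, W' x = c • W x := by
  have h1 := h.intertwines_symm.comp h'.intertwines
  rw [inv_mul_cancel] at h1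
  obtain ⟨c, hc, h2⟩ := h1.eq_smul
  refine ⟨c, hc, fun x => ?_⟩
  rw [← map_smul, ← h2]
  exact (W.apply_symm_apply (W' x)).symm

lemma symm_eq_smul {W W' : Fock ≃ₗᵢ[ℂ] Fock} {c : ℂ} (hc : ‖c‖ = 1)
    (h : ∀ x, W' x = c • W x) (x : Fock) : W'.symm x = c⁻¹ • W.symm x := by
  have hc0 : c ≠ 0 := norm_ne_zero_iff.mp (by rw [hc]; exact one_ne_zero)
  apply W'.injective
  rw [LinearIsometryEquiv.apply_symm_apply, h, map_smul, LinearIsometryEquiv.apply_symm_apply,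
    smul_inv_smul₀ hc0]

lemma conjOp_eq_of_smul {W W' : Fock ≃ₗᵢ[ℂ] Fock} {c : ℂ} (hc : ‖c‖ = 1)
    (h : ∀ x, W' x = c • W x) (T : Fock →ₗ.[ℂ] Fock) : conjOp W' T = conjOp W T := by
  have hc0 : c ≠ 0 := norm_ne_zero_iff.mp (by rw [hc]; exact one_ne_zero)
  refine LinearPMap.ext (Submodule.ext fun x => ?_) ?_
  · rw [mem_conjOp, mem_conjOp, symm_eq_smul hc h,
      Submodule.smul_mem_iff _ (inv_ne_zero hc0)]
  · intro x hx hx'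
    rw [conjOp_apply, conjOp_apply, h, ← map_smul, ← LinearPMap.map_smul]
    congr 2
    refine Subtype.ext ?_
    change c • W'.symm x = W.symm x
    rw [symm_eq_smul hc h, smul_inv_smul₀ hc0]

lemma subst_eq {g : Bogoliubov} {W : Fock ≃ₗᵢ[ℂ] Fock} (h : Implements g W)
    (T : Fock →ₗ.[ℂ] Fock) : subst g T = conjOp W T := by
  have h' : ∃ W, Implements g W := ⟨W, h⟩
  obtain ⟨c, hc, h1⟩ := h.eq_smul h'.choose_spec
  rw [subst, dif_pos h']
  exact conjOp_eq_of_smul hc h1 T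

lemma subst_polyOp (g : Bogoliubov) (f : NCPoly) :
    subst g (polyOp f) = polyOp (substPoly g f) := by
  obtain ⟨W, hW⟩ := exists_implements g
  rw [subst_eq hW]
  exact implements_of_intertwines hW.intertwines (fun x hx => hW.symm_mem hx) f

lemma mem_graph_conjOp {W : Fock ≃ₗᵢ[ℂ] Fock} {T : Fock →ₗ.[ℂ] Fock} {z : Fock × Fock} :
    z ∈ (conjOp W T).graph ↔ (W.symm z.1, W.symm z.2) ∈ T.graph := by
  rw [LinearPMap.mem_graph_iff, LinearPMap.mem_graph_iff]
  constructor
  · rintro ⟨x, h1, h2⟩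
    refine ⟨⟨W.symm x, x.2⟩, by rw [← h1], ?_⟩
    rw [← h2]
    exact (W.symm_apply_apply _).symm
  · rintro ⟨x, h1, h2⟩
    refine ⟨⟨z.1, by rw [mem_conjOp, ← show (x : Fock) = W.symm z.1 from h1]; exact x.2⟩, rfl, ?_⟩
    apply W.symm.injective
    refine Eq.trans ?_ h2
    rw [conjOp_apply, LinearIsometryEquiv.symm_apply_apply]
    congr 1
    exact Subtype.ext h1.symm

lemma graph_closure_conjOp (W : Fock ≃ₗᵢ[ℂ] Fock) {T T' : Fock →ₗ.[ℂ] Fock}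
    (h : T.graph.topologicalClosure = T'.graph) :
    (conjOp W T).graph.topologicalClosure = (conjOp W T').graph := by
  let e : Fock × Fock ≃ₜ Fock × Fock := W.symm.toHomeomorph.prodCongr W.symm.toHomeomorph
  have h1 : ((conjOp W T).graph : Set (Fock × Fock)) = e ⁻¹' (T.graph : Set (Fock × Fock)) :=
    Set.ext fun z => mem_graph_conjOp
  have h2 : ((conjOp W T').graph : Set (Fock × Fock)) = e ⁻¹' (T'.graph : Set (Fock × Fock)) :=
    Set.ext fun z => mem_graph_conjOp
  apply SetLike.coe_injective
  rw [Submodule.topologicalClosure_coe, h1, h2, ← h, Submodule.topologicalClosure_coe,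
    e.preimage_closure]

lemma conjOp_symm_conjOp (W : Fock ≃ₗᵢ[ℂ] Fock) (T : Fock →ₗ.[ℂ] Fock) :
    conjOp W.symm (conjOp W T) = T := by
  refine LinearPMap.eq_of_eq_graph (Submodule.ext fun z => ?_)
  rw [mem_graph_conjOp, mem_graph_conjOp]
  simp

lemma conjOp_closure (W : Fock ≃ₗᵢ[ℂ] Fock) (T : Fock →ₗ.[ℂ] Fock) :
    conjOp W T.closure = (conjOp W T).closure := by
  by_cases h : T.IsClosable
  · have h1 := graph_closure_conjOp W h.graph_closure_eq_closure_graph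
    have h2 : (conjOp W T).IsClosable := ⟨_, h1⟩
    rw [h2.graph_closure_eq_closure_graph] at h1
    exact (LinearPMap.eq_of_eq_graph h1).symm
  -- The closure of a non-closable operator is by convention the operator itself, so both sides
  -- agree once non-closability is known to be preserved.
  · have h2 : ¬ (conjOp W T).IsClosable := fun ⟨T', hT'⟩ => h ⟨conjOp W.symm T', by
      have := graph_closure_conjOp W.symm hT'
      rwa [conjOp_symm_conjOp] at this⟩
    rw [LinearPMap.closure_def' h, LinearPMap.closure_def' h2]

/-! ### Phase-normalised implementing operators -/

/-- An arbitrary choice of phase would make `g ↦ W_g` discontinuous. Requiring a nonnegative vacuum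
coefficient makes `W_g` close to the identity when `g` is. -/
lemma exists_implements_normalized (g : Bogoliubov) : ∃ W, Implements g W ∧
    ∃ r : ℝ, 0 ≤ r ∧ (W.symm (numberState 0) : ℕ → ℂ) 0 = r := by
  obtain ⟨W, hW⟩ := exists_implements g
  set z := (W.symm (numberState 0) : ℕ → ℂ) 0 with hz
  obtain ⟨c, hc, hcz⟩ : ∃ c : ℂ, ‖c‖ = 1 ∧ c⁻¹ * z = ‖z‖ := by
    by_cases h : z = 0
    · exact ⟨1, norm_one, by simp [h]⟩
    · have h' : (‖z‖ : ℂ) ≠ 0 := by exact_mod_cast norm_ne_zero_iff.mpr h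
      refine ⟨z / ‖z‖, ?_, by field_simp⟩
      rw [norm_div, Complex.norm_real, norm_norm, div_self (norm_ne_zero_iff.mpr h)]
  have hc0 : c ≠ 0 := norm_ne_zero_iff.mp (by rw [hc]; exact one_ne_zero)
  let W' : Fock ≃ₗᵢ[ℂ] Fock :=
    { W.toLinearEquiv.trans (LinearEquiv.smulOfNeZero ℂ Fock c hc0) with
      norm_map' := fun x => by
        change ‖c • W x‖ = ‖x‖
        rw [norm_smul, hc, one_mul, W.norm_map] }
  have hW' : ∀ x, W' x = c • W x := fun x => rfl
  refine ⟨W', fun l => (conjOp_eq_of_smul hc hW' _).trans (hW l), ‖z‖, norm_nonneg _, ?_⟩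
  rw [symm_eq_smul hc hW']
  exact hcz

/-- The implementing unitary operator whose vacuum expectation is nonnegative. -/
def impl (g : Bogoliubov) : Fock ≃ₗᵢ[ℂ] Fock := (exists_implements_normalized g).choose

lemma impl_implements (g : Bogoliubov) : Implements g (impl g) :=
  (exists_implements_normalized g).choose_spec.1

lemma impl_normalized (g : Bogoliubov) :
    ∃ r : ℝ, 0 ≤ r ∧ ((impl g).symm (numberState 0) : ℕ → ℂ) 0 = r :=
  (exists_implements_normalized g).choose_spec.2

/-- The implementing operator on `𝒮`. -/
def implS (g : Bogoliubov) (x : schwartz) : schwartz := ⟨impl g x, (impl_implements g).mem x.2⟩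

/-- The inverse of the implementing operator on `𝒮`. -/
def implSymmS (g : Bogoliubov) (x : schwartz) : schwartz :=
  ⟨(impl g).symm x, (impl_implements g).symm_mem x.2⟩

lemma act_implS (g : Bogoliubov) (f : NCPoly) (x : schwartz) :
    (act (substPoly g f) (implS g x) : Fock) = impl g (act f x : Fock) :=
  ((impl_implements g).intertwines x).2 f

lemma impl_symm_act (g : Bogoliubov) (f : NCPoly) (x : schwartz) :
    (impl g).symm (act (substPoly g f) x : Fock) = (act f (implSymmS g x) : Fock) := by
  have h : implS g (implSymmS g x) = x := Subtype.ext ((impl g).apply_symm_apply _)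
  rw [← h, act_implS, LinearIsometryEquiv.symm_apply_apply, h]

lemma act_subst_eq (g : Bogoliubov) (f : NCPoly) (x : schwartz) :
    (act (substPoly g f) x : Fock) = impl g (act f (implSymmS g x) : Fock) := by
  rw [← impl_symm_act, LinearIsometryEquiv.apply_symm_apply]

/-! ### The spectral gap of the number operator -/

lemma norm_sq_eq_add (v : Fock) (n : ℕ) : ‖v‖ ^ 2 =
    ‖(v : ℕ → ℂ) n‖ ^ 2 + ‖v - (v : ℕ → ℂ) n • numberState n‖ ^ 2 := by
  have h : inner ℂ ((v : ℕ → ℂ) n • numberState n) (v - (v : ℕ → ℂ) n • numberState n) = (0 : ℂ) := by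
    rw [inner_smul_left, inner_sub_right, inner_smul_right, inner_numberState, inner_numberState,
      numberState_apply, if_pos rfl]
    ring
  have h1 := norm_add_sq_eq_norm_sq_add_norm_sq_of_inner_eq_zero _ _ h
  rw [add_sub_cancel, norm_smul, norm_numberState, mul_one] at h1
  nlinarith

/-- The relation says `u = (N - n) v`. Distinct integers differ by at least one, so `N - n` is
bounded below by one on the complement of `e_n`. -/
lemma norm_gap {v u : Fock} {n : ℕ}
    (h : ∀ m : ℕ, (u : ℕ → ℂ) m = ((m : ℂ) - n) * (v : ℕ → ℂ) m) :
    ‖v - (v : ℕ → ℂ) n • numberState n‖ ≤ ‖u‖ := by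
  refine le_of_sq_le_sq ?_ (norm_nonneg _)
  rw [← (hasSum_norm_sq u).tsum_eq, ← (hasSum_norm_sq (v - (v : ℕ → ℂ) n • numberState n)).tsum_eq]
  refine (hasSum_norm_sq _).summable.tsum_le_tsum (fun m => ?_) (hasSum_norm_sq u).summable
  have h1 : ((v - (v : ℕ → ℂ) n • numberState n : Fock) : ℕ → ℂ) m =
      (v : ℕ → ℂ) m - (v : ℕ → ℂ) n * (numberState n : ℕ → ℂ) m := rfl
  rw [h1, h m, numberState_apply]
  gcongr
  split_ifs with hm
  · rw [hm]
    simp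
  · rw [mul_zero, sub_zero, norm_mul]
    refine le_mul_of_one_le_left (norm_nonneg _) ?_
    have h2 : (1 : ℝ) ≤ ‖(((m : ℤ) - n : ℤ) : ℂ)‖ := by
      rw [Complex.norm_intCast]
      exact_mod_cast Int.one_le_abs (by omega : (m : ℤ) - n ≠ 0)
    push_cast at h2
    exact h2

lemma norm_le_of_gap {v u : Fock} {n : ℕ}
    (h : ∀ m : ℕ, (u : ℕ → ℂ) m = ((m : ℂ) - n) * (v : ℕ → ℂ) m) :
    ‖v‖ ≤ ‖u‖ + ‖(v : ℕ → ℂ) n‖ := by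
  have h1 : v = (v - (v : ℕ → ℂ) n • numberState n) + (v : ℕ → ℂ) n • numberState n := by abel
  calc ‖v‖ ≤ ‖v - (v : ℕ → ℂ) n • numberState n‖ + ‖(v : ℕ → ℂ) n • numberState n‖ := by
        conv_lhs => rw [h1]
        exact norm_add_le _ _
    _ ≤ _ := by
        rw [norm_smul, norm_numberState, mul_one]
        gcongr
        exact norm_gap h

/-- The vector `(a_g* a_g - A* A) e_n`. -/
def numDiff (g : Bogoliubov) (n : ℕ) : Fock :=
  (act (substPoly g num) (nst n) : Fock) - (n : ℂ) • numberState n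

/-- `W* a_g* a_g = N W*`, so `W* numDiff` is `(N - n) W* e_n`: the input for the gap estimates. -/
lemma impl_symm_numDiff (g : Bogoliubov) (n m : ℕ) :
    ((impl g).symm (numDiff g n) : ℕ → ℂ) m =
      ((m : ℂ) - n) * ((impl g).symm (numberState n) : ℕ → ℂ) m := by
  rw [numDiff, map_sub, map_smul, impl_symm_act]
  change ((act num (implSymmS g (nst n)) : Fock) : ℕ → ℂ) m -
    n * ((impl g).symm (numberState n) : ℕ → ℂ) m = _
  rw [act_num_apply, sub_mul]
  rfl

/-- After `|τ|² = 1 + |θ|²` is used, every coefficient carries a factor `θ` or its conjugate. This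
explicit smallness is what the gap converts into smallness of `W* e_n - e_n` off the diagonal. -/
lemma numDiff_eq (g : Bogoliubov) (n : ℕ) : numDiff g n =
    (conj g.τ * g.θ) • (act (ra * ra) (nst n) : Fock) +
    (conj g.θ * g.τ) • (act (lo * lo) (nst n) : Fock) +
    (g.θ * conj g.θ * (2 * n + 1)) • numberState n := by
  have hg := g.conj_sub
  have h : act (substPoly g num) (nst n) = (conj g.τ * g.θ) • act (ra * ra) (nst n) +
      (conj g.θ * g.τ) • act (lo * lo) (nst n) + (g.τ * conj g.τ) • (n : ℂ) • nst n +
      (g.θ * conj g.θ) • ((n : ℂ) • nst n + nst n) := by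
    rw [← act_num_nst, act_mul, act_mul, act_mul, ← act_lo_ra, map_mul, act_mul]
    simp only [substPoly_lo, substPoly_ra, map_add, map_smul, LinearMap.add_apply,
      LinearMap.smul_apply]
    module
  rw [numDiff, h]
  simp only [Submodule.coe_add, Submodule.coe_smul, coe_nst]
  linear_combination (norm := module) hg • (n : ℂ) • numberState n

lemma norm_ra_ra_le (n : ℕ) : ‖(act (ra * ra) (nst n) : Fock)‖ ≤ 2 * (n + 1) := by
  rw [act_mul, act_ra_nst, map_smul, act_ra_nst]
  simp only [Submodule.coe_smul, norm_smul, Complex.norm_real, coe_nst, norm_numberState,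
    Real.norm_of_nonneg (Real.sqrt_nonneg _), mul_one]
  rw [← Real.sqrt_mul (by positivity)]
  refine Real.sqrt_le_iff.mpr ⟨by positivity, ?_⟩
  push_cast
  nlinarith [(Nat.cast_nonneg n : (0 : ℝ) ≤ n)]

lemma norm_lo_lo_le (n : ℕ) : ‖(act (lo * lo) (nst n) : Fock)‖ ≤ 2 * (n + 1) := by
  have h0 : (0 : ℝ) ≤ 2 * (n + 1) := by positivity
  rw [act_mul]
  rcases n with _ | _ | n
  · simp [act_lo_nst_zero]
  · simp [act_lo_nst, act_lo_nst_zero]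
  · rw [act_lo_nst, map_smul, act_lo_nst]
    simp only [Submodule.coe_smul, norm_smul, Complex.norm_real, coe_nst, norm_numberState,
      Real.norm_of_nonneg (Real.sqrt_nonneg _), mul_one]
    rw [← Real.sqrt_mul (by positivity)]
    refine Real.sqrt_le_iff.mpr ⟨h0, ?_⟩
    push_cast
    nlinarith [(Nat.cast_nonneg n : (0 : ℝ) ≤ n)]

lemma norm_numDiff_le {g : Bogoliubov} (hτ : ‖g.τ‖ ≤ 2) (hθ : ‖g.θ‖ ≤ 1) (n : ℕ) :
    ‖numDiff g n‖ ≤ 10 * ‖g.θ‖ * (n + 1) := by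
  rw [numDiff_eq]
  refine norm_add₃_le.trans ?_
  simp only [norm_smul, norm_mul, RCLike.norm_conj, norm_numberState, mul_one]
  have h1 : ‖(2 * n + 1 : ℂ)‖ ≤ 2 * (n + 1) := by
    have := Complex.norm_natCast (2 * n + 1)
    push_cast at this
    rw [this]
    linarith
  have h2 := norm_ra_ra_le n
  have h3 := norm_lo_lo_le n
  have h0 := norm_nonneg g.θ
  calc ‖g.τ‖ * ‖g.θ‖ * ‖(act (ra * ra) (nst n) : Fock)‖ +
        ‖g.θ‖ * ‖g.τ‖ * ‖(act (lo * lo) (nst n) : Fock)‖ + ‖g.θ‖ * ‖g.θ‖ * ‖(2 * n + 1 : ℂ)‖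
      ≤ 2 * ‖g.θ‖ * (2 * (n + 1)) + ‖g.θ‖ * 2 * (2 * (n + 1)) + ‖g.θ‖ * 1 * (2 * (n + 1)) := by
        gcongr
    _ = _ := by ring

/-- The diagonal coefficient `⟪W e_n, e_n⟫`. -/
def diagCoeff (g : Bogoliubov) (n : ℕ) : ℂ := ((impl g).symm (numberState n) : ℕ → ℂ) n

/-- The `n`-th coordinate of `W* a_g e_{n+1} = A W* e_{n+1}`, divided by `√(n + 1)`. It propagates
control of the diagonal from the vacuum upwards. -/
lemma diagCoeff_succ (g : Bogoliubov) (n : ℕ) : diagCoeff g (n + 1) = g.τ * diagCoeff g n +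
    ((Real.sqrt (n + 1 + 1) / Real.sqrt (n + 1) : ℝ) : ℂ) *
      (g.θ * ((impl g).symm (numberState (n + 2)) : ℕ → ℂ) n) := by
  have h := congrArg (fun z : Fock => (z : ℕ → ℂ) n) (impl_symm_act g lo (nst (n + 1)))
  have h2 : act (substPoly g lo) (nst (n + 1)) = (g.τ * (Real.sqrt (n + 1) : ℂ)) • nst n +
      (g.θ * (Real.sqrt (n + 1 + 1) : ℂ)) • nst (n + 2) := by
    rw [substPoly_lo, map_add, LinearMap.add_apply, map_smul, map_smul, LinearMap.smul_apply,
      LinearMap.smul_apply, act_lo_nst, act_ra_nst, smul_smul, smul_smul]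
    push_cast
    rfl
  rw [h2, act_lo_apply, Submodule.coe_add, Submodule.coe_smul, Submodule.coe_smul, map_add,
    map_smul, map_smul] at h
  change g.τ * (Real.sqrt (n + 1) : ℂ) * diagCoeff g n + g.θ * (Real.sqrt (n + 1 + 1) : ℂ) *
    ((impl g).symm (numberState (n + 2)) : ℕ → ℂ) n = Real.sqrt (n + 1) * diagCoeff g (n + 1) at h
  apply mul_left_cancel₀ (sqrt_succ_ne_zero n)
  rw [← h]
  have := sqrt_succ_ne_zero n
  push_cast
  field_simp

lemma norm_impl_symm_apply_le (g : Bogoliubov) (n m : ℕ) :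
    ‖((impl g).symm (numberState n) : ℕ → ℂ) m‖ ≤ 1 := by
  refine (lp.norm_apply_le_norm (by norm_num) _ m).trans ?_
  rw [LinearIsometryEquiv.norm_map, norm_numberState]

/-- With `r ≥ 0` the vacuum coefficient, `1 - r ≤ 1 - r²`, and `1 - r²` is the squared norm of the
off-diagonal part, at most `(10 |θ|)²`. The bound is quadratic in `θ`, which later gives derivative
zero. -/
lemma norm_diagCoeff_zero_sub_one_le {g : Bogoliubov} (hτ : ‖g.τ‖ ≤ 2) (hθ : ‖g.θ‖ ≤ 1) :
    ‖diagCoeff g 0 - 1‖ ≤ 100 * ‖g.θ‖ ^ 2 := by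
  obtain ⟨r, hr0, hr⟩ := impl_normalized g
  have h1 := norm_gap (impl_symm_numDiff g 0)
  have h2 := norm_sq_eq_add ((impl g).symm (numberState 0)) 0
  have h3 := norm_impl_symm_apply_le g 0 0
  have h4 := norm_numDiff_le hτ hθ 0
  rw [LinearIsometryEquiv.norm_map] at h1
  rw [LinearIsometryEquiv.norm_map, norm_numberState] at h2
  rw [hr, Complex.norm_real, Real.norm_of_nonneg hr0] at h2 h3
  rw [diagCoeff, hr]
  rw [hr] at h1
  have h5 : ‖((r : ℂ) - 1)‖ = 1 - r := by
    rw [← Complex.ofReal_one, ← Complex.ofReal_sub, Complex.norm_real, Real.norm_eq_abs,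
      abs_of_nonpos (by linarith)]
    ring
  rw [h5]
  have h6 := h1.trans h4
  simp only [CharP.cast_eq_zero, zero_add, mul_one] at h6
  have h7 := pow_le_pow_left₀ (norm_nonneg _) h6 2
  nlinarith

lemma norm_diagCoeff_sub_one_le {g : Bogoliubov} (hτ : ‖g.τ‖ ≤ 2) (hθ : ‖g.θ‖ ≤ 1) (n : ℕ) :
    ‖diagCoeff g n - 1‖ ≤ 100 * (‖g.θ‖ + ‖g.τ - 1‖) * (n + 1) := by
  induction n with
  | zero =>
    refine (norm_diagCoeff_zero_sub_one_le hτ hθ).trans ?_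
    push_cast
    nlinarith [norm_nonneg g.θ, norm_nonneg (g.τ - 1)]
  | succ n ih =>
    have h1 : ‖diagCoeff g n‖ ≤ 1 := norm_impl_symm_apply_le g n n
    have h2 : Real.sqrt (n + 1 + 1) / Real.sqrt (n + 1) ≤ 2 := by
      rw [div_le_iff₀ (Real.sqrt_pos.mpr (by positivity))]
      refine Real.sqrt_le_iff.mpr ⟨by positivity, ?_⟩
      rw [mul_pow, Real.sq_sqrt (by positivity)]
      linarith [(Nat.cast_nonneg n : (0 : ℝ) ≤ n)]
    have h3 := norm_impl_symm_apply_le g (n + 2) n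
    have e : diagCoeff g (n + 1) - 1 = (diagCoeff g n - 1) + (g.τ - 1) * diagCoeff g n +
        ((Real.sqrt (n + 1 + 1) / Real.sqrt (n + 1) : ℝ) : ℂ) *
          (g.θ * ((impl g).symm (numberState (n + 2)) : ℕ → ℂ) n) := by
      rw [diagCoeff_succ]
      ring
    rw [e]
    refine norm_add₃_le.trans ?_
    rw [norm_mul, norm_mul, norm_mul, Complex.norm_real, Real.norm_of_nonneg (by positivity)]
    calc ‖diagCoeff g n - 1‖ + ‖g.τ - 1‖ * ‖diagCoeff g n‖ +
          Real.sqrt (n + 1 + 1) / Real.sqrt (n + 1) *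
            (‖g.θ‖ * ‖((impl g).symm (numberState (n + 2)) : ℕ → ℂ) n‖)
        ≤ 100 * (‖g.θ‖ + ‖g.τ - 1‖) * (n + 1) + ‖g.τ - 1‖ * 1 + 2 * (‖g.θ‖ * 1) := by
          gcongr
      _ ≤ _ := by
          push_cast
          nlinarith [norm_nonneg g.θ, norm_nonneg (g.τ - 1)]

/-- Off-diagonal part by the gap (constant 10) plus diagonal part by the recursion (constant 100).
-/
lemma norm_impl_symm_sub_le {g : Bogoliubov} (hτ : ‖g.τ‖ ≤ 2) (hθ : ‖g.θ‖ ≤ 1) (n : ℕ) :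
    ‖(impl g).symm (numberState n) - numberState n‖ ≤
      110 * (‖g.θ‖ + ‖g.τ - 1‖) * (n + 1) := by
  have h1 : ∀ m : ℕ, ((impl g).symm (numDiff g n) : ℕ → ℂ) m = ((m : ℂ) - n) *
      (((impl g).symm (numberState n) - numberState n : Fock) : ℕ → ℂ) m := fun m => by
    change _ = _ * (((impl g).symm (numberState n) : ℕ → ℂ) m - (numberState n : ℕ → ℂ) m)
    rw [impl_symm_numDiff, numberState_apply]
    split_ifs with h
    · rw [h]
      ring
    · ring
  refine (norm_le_of_gap h1).trans ?_
  have h2 : (((impl g).symm (numberState n) - numberState n : Fock) : ℕ → ℂ) n =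
      diagCoeff g n - 1 := by
    change ((impl g).symm (numberState n) : ℕ → ℂ) n - (numberState n : ℕ → ℂ) n = _
    rw [numberState_apply, if_pos rfl]
    rfl
  rw [h2, LinearIsometryEquiv.norm_map]
  have h3 := norm_numDiff_le hτ hθ n
  have h4 := norm_diagCoeff_sub_one_le hτ hθ n
  have h5 : 0 ≤ ‖g.τ - 1‖ * ((n : ℝ) + 1) := by positivity
  nlinarith

/-- The weight `(A* A + 1)²` that controls the action of the group. -/
abbrev weight : NCPoly := (num + 1) * (num + 1)

lemma norm_impl_sub (g : Bogoliubov) (x : Fock) : ‖impl g x - x‖ = ‖(impl g).symm x - x‖ := by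
  rw [← (impl g).norm_map ((impl g).symm x - x), map_sub, LinearIsometryEquiv.apply_symm_apply,
    norm_sub_rev]

/-- Expand `x` in number states: the `n`-th term costs `O(|x_n| (n + 1))`, and `exists_sum_coeff_le`
sums these costs. -/
lemma exists_impl_lipschitz : ∃ C : ℝ, 0 ≤ C ∧ ∀ g : Bogoliubov, ‖g.τ‖ ≤ 2 → ‖g.θ‖ ≤ 1 →
    ∀ x : schwartz, ‖impl g x - x‖ ≤
      C * (‖g.θ‖ + ‖g.τ - 1‖) * ‖(act weight x : Fock)‖ := by
  obtain ⟨C, hC0, hC⟩ := exists_sum_coeff_le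
  refine ⟨110 * C, by positivity, fun g hτ hθ x => ?_⟩
  rw [norm_impl_sub]
  have h1 : HasSum (fun n => ((x : Fock) : ℕ → ℂ) n •
      ((impl g).symm (numberState n) - numberState n)) ((impl g).symm (x : Fock) - x) := by
    have h2 : HasSum (fun n => (impl g).symm (((x : Fock) : ℕ → ℂ) n • numberState n))
        ((impl g).symm (x : Fock)) := (hasSum_numberState (x : Fock)).mapL ((impl g).symm : Fock →L[ℂ] Fock)
    have h3 := h2.sub (hasSum_numberState (x : Fock))
    convert h3 using 2 with n
    rw [map_smul, smul_sub]
  have h4 : ∀ n, ‖((x : Fock) : ℕ → ℂ) n • ((impl g).symm (numberState n) - numberState n)‖ ≤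
      110 * (‖g.θ‖ + ‖g.τ - 1‖) * (‖((x : Fock) : ℕ → ℂ) n‖ * (n + 1)) := fun n => by
    rw [norm_smul]
    calc _ ≤ ‖((x : Fock) : ℕ → ℂ) n‖ * (110 * (‖g.θ‖ + ‖g.τ - 1‖) * (n + 1)) := by
          gcongr
          exact norm_impl_symm_sub_le hτ hθ n
      _ = _ := by ring
  have h5 := (hC x).1.mul_left (110 * (‖g.θ‖ + ‖g.τ - 1‖))
  rw [← h1.tsum_eq]
  refine (tsum_of_norm_bounded h5.hasSum h4).trans ?_
  rw [tsum_mul_left]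
  calc _ ≤ 110 * (‖g.θ‖ + ‖g.τ - 1‖) * (C * ‖(act weight x : Fock)‖) := by
        gcongr
        exact (hC x).2
    _ = _ := by ring

lemma dense_schwartz : Dense (schwartz : Set Fock) := by
  have h : Submodule.span ℂ (Set.range numberBasis) ≤ schwartz := Submodule.span_le.mpr (by
    rintro _ ⟨n, rfl⟩
    rw [numberBasis_apply]
    exact (nst n).2)
  exact (Submodule.dense_iff_topologicalClosure_eq_top.mpr numberBasis.dense_span).mono h

/-! ### Strong continuity of the implementers at the identity -/

section Continuity

variable {ι : Type*} {l : Filter ι} {g : ι → Bogoliubov}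

lemma eventually_bounds (hτ : Tendsto (fun i => (g i).τ) l (𝓝 1))
    (hθ : Tendsto (fun i => (g i).θ) l (𝓝 0)) : ∀ᶠ i in l, ‖(g i).τ‖ ≤ 2 ∧ ‖(g i).θ‖ ≤ 1 := by
  have h1 := hτ.norm.eventually (ge_mem_nhds (by rw [norm_one]; norm_num : ‖(1 : ℂ)‖ < 2))
  have h2 := hθ.norm.eventually (ge_mem_nhds (by rw [norm_zero]; norm_num : ‖(0 : ℂ)‖ < 1))
  exact h1.and h2

lemma tendsto_impl (hτ : Tendsto (fun i => (g i).τ) l (𝓝 1))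
    (hθ : Tendsto (fun i => (g i).θ) l (𝓝 0)) (x : Fock) :
    Tendsto (fun i => impl (g i) x) l (𝓝 x) := by
  obtain ⟨C, hC0, hC⟩ := exists_impl_lipschitz
  rw [Metric.tendsto_nhds]
  intro ε hε
  obtain ⟨y, hy, hxy⟩ := Metric.mem_closure_iff.mp (dense_schwartz x) (ε / 3) (by positivity)
  have h1 : Tendsto (fun i => C * (‖(g i).θ‖ + ‖(g i).τ - 1‖) *
      ‖(act weight ⟨y, hy⟩ : Fock)‖) l (𝓝 0) := by
    have := ((hθ.norm.add (hτ.sub_const 1).norm).const_mul C).mul_const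
      ‖(act weight ⟨y, hy⟩ : Fock)‖
    simpa using this
  filter_upwards [h1.eventually (gt_mem_nhds (by positivity : (0 : ℝ) < ε / 3)),
    eventually_bounds hτ hθ] with i h2 h3
  have h4 := (hC (g i) h3.1 h3.2 ⟨y, hy⟩).trans_lt h2
  rw [dist_eq_norm] at hxy ⊢
  have e : impl (g i) x - x = impl (g i) (x - y) + (impl (g i) y - y) - (x - y) := by
    rw [map_sub]
    abel
  rw [e]
  refine (norm_sub_le _ _).trans_lt ?_
  have := norm_add_le (impl (g i) (x - y)) (impl (g i) y - y)
  rw [LinearIsometryEquiv.norm_map] at this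
  change ‖impl (g i) y - y‖ < _ at h4
  linarith

lemma tendsto_impl_of_tendsto (hτ : Tendsto (fun i => (g i).τ) l (𝓝 1))
    (hθ : Tendsto (fun i => (g i).θ) l (𝓝 0)) {y : ι → Fock} {x : Fock}
    (hy : Tendsto y l (𝓝 x)) : Tendsto (fun i => impl (g i) (y i)) l (𝓝 x) := by
  have h := tendsto_impl hτ hθ x
  rw [tendsto_iff_norm_sub_tendsto_zero] at h hy ⊢
  refine squeeze_zero (fun i => norm_nonneg _) (fun i => ?_) (by simpa using hy.add h)
  have e : impl (g i) (y i) - x = impl (g i) (y i - x) + (impl (g i) x - x) := by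
    rw [map_sub]
    abel
  rw [e]
  refine (norm_add_le _ _).trans ?_
  rw [LinearIsometryEquiv.norm_map]

lemma tendsto_impl_symm_of_tendsto (hτ : Tendsto (fun i => (g i).τ) l (𝓝 1))
    (hθ : Tendsto (fun i => (g i).θ) l (𝓝 0)) {y : ι → Fock} {x : Fock}
    (hy : Tendsto y l (𝓝 x)) : Tendsto (fun i => (impl (g i)).symm (y i)) l (𝓝 x) := by
  have h := tendsto_impl hτ hθ x
  rw [tendsto_iff_norm_sub_tendsto_zero] at h hy ⊢
  refine squeeze_zero (fun i => norm_nonneg _) (fun i => ?_) (by simpa using hy.add h)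
  have e : (impl (g i)).symm (y i) - x =
      (impl (g i)).symm (y i - x) + ((impl (g i)).symm x - x) := by
    rw [map_sub]
    abel
  rw [e]
  refine (norm_add_le _ _).trans ?_
  rw [LinearIsometryEquiv.norm_map, norm_impl_sub]

end Continuity

/-! ### Differentiation of the implementing operators along a family -/

/-- Continuity along a constant family over a one-point filter forces the normalised implementer of
the identity to be the identity. -/
lemma impl_one (x : Fock) : impl 1 x = x := by
  have h := tendsto_impl (l := (⊤ : Filter Unit)) (g := fun _ => 1) tendsto_const_nhds
    tendsto_const_nhds x
  exact tendsto_nhds_unique tendsto_const_nhds h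

lemma impl_one_symm (x : Fock) : (impl 1).symm x = x := by
  rw [LinearIsometryEquiv.symm_apply_eq, impl_one]

lemma ofReal_smul_fock (r : ℝ) (x : Fock) : r • x = (r : ℂ) • x := by
  ext n
  change r • (x : ℕ → ℂ) n = (r : ℂ) * (x : ℕ → ℂ) n
  rw [Complex.real_smul]

lemma hasDerivAt_fock_iff {f : ℝ → Fock} {f' : Fock} : HasDerivAt f f' 0 ↔
    Tendsto (fun s : ℝ => ((s⁻¹ : ℝ) : ℂ) • (f s - f 0)) (𝓝[≠] 0) (𝓝 f') := by
  rw [hasDerivAt_iff_tendsto_slope_zero]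
  simp only [zero_add, ofReal_smul_fock]

lemma hasDerivAt_complex_iff {f : ℝ → ℂ} {f' : ℂ} : HasDerivAt f f' 0 ↔
    Tendsto (fun s : ℝ => ((s⁻¹ : ℝ) : ℂ) * (f s - f 0)) (𝓝[≠] 0) (𝓝 f') := by
  rw [hasDerivAt_iff_tendsto_slope_zero]
  simp only [zero_add, Complex.real_smul]

/-- The anti-Hermitian quadratic polynomial generating the implementing operators, for a family
with derivatives `t`, `u` of its parameters. -/
def gen (t u : ℂ) : NCPoly := -(t • num) - (u / 2) • (ra * ra) + (conj u / 2) • (lo * lo)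

lemma act_gen (t u : ℂ) (x : schwartz) : act (gen t u) x =
    -(t • act num x) - (u / 2) • act (ra * ra) x + (conj u / 2) • act (lo * lo) x := by
  simp only [gen, map_add, map_sub, map_neg, map_smul, LinearMap.add_apply, LinearMap.sub_apply,
    LinearMap.neg_apply, LinearMap.smul_apply]

/-- `A*²` raises the eigenvalue of `N` by two, so `N - n` multiplies `A*² e_n` by two. This is the
origin of the factors `1/2` in `gen`. -/
lemma act_ra_ra_nst_apply (n m : ℕ) : ((m : ℂ) - n) * ((act (ra * ra) (nst n) : Fock) : ℕ → ℂ) m =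
    2 * ((act (ra * ra) (nst n) : Fock) : ℕ → ℂ) m := by
  rw [act_mul, act_ra_nst, map_smul, act_ra_nst, smul_smul]
  change _ * (_ * ((nst (n + 1 + 1) : Fock) : ℕ → ℂ) m) =
    2 * (_ * ((nst (n + 1 + 1) : Fock) : ℕ → ℂ) m)
  rw [nst_apply]
  split_ifs with h
  · rw [h]
    push_cast
    ring
  · simp

lemma act_lo_lo_nst_apply (n m : ℕ) : ((m : ℂ) - n) * ((act (lo * lo) (nst n) : Fock) : ℕ → ℂ) m =
    -2 * ((act (lo * lo) (nst n) : Fock) : ℕ → ℂ) m := by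
  rw [act_mul]
  rcases n with _ | _ | n
  · simp [act_lo_nst_zero]
  · simp [act_lo_nst, act_lo_nst_zero]
  · rw [act_lo_nst, map_smul, act_lo_nst, smul_smul]
    change _ * (_ * ((nst n : Fock) : ℕ → ℂ) m) = -2 * (_ * ((nst n : Fock) : ℕ → ℂ) m)
    rw [nst_apply]
    split_ifs with h
    · rw [h]
      push_cast
      ring
    · simp

section Family

variable {γ : ℝ → Bogoliubov} {t u : ℂ}

lemma tendsto_τ (h0 : γ 0 = 1) (hτ : HasDerivAt (fun s => (γ s).τ) t 0) :
    Tendsto (fun s => (γ s).τ) (𝓝 0) (𝓝 1) := by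
  have := hτ.continuousAt.tendsto
  rwa [h0] at this

lemma tendsto_θ (h0 : γ 0 = 1) (hθ : HasDerivAt (fun s => (γ s).θ) u 0) :
    Tendsto (fun s => (γ s).θ) (𝓝 0) (𝓝 0) := by
  have := hθ.continuousAt.tendsto
  rwa [h0] at this

lemma hasDerivAt_conj {f : ℝ → ℂ} {f' : ℂ} {x : ℝ} (h : HasDerivAt f f' x) :
    HasDerivAt (fun s => conj (f s)) (conj f') x := h.star

lemma hasDerivAt_numDiff (h0 : γ 0 = 1) (hτ : HasDerivAt (fun s => (γ s).τ) t 0)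
    (hθ : HasDerivAt (fun s => (γ s).θ) u 0) (n : ℕ) :
    HasDerivAt (fun s => numDiff (γ s) n)
      (u • (act (ra * ra) (nst n) : Fock) + conj u • (act (lo * lo) (nst n) : Fock)) 0 := by
  have e1 : (γ 0).τ = 1 := by rw [h0]; rfl
  have e2 : (γ 0).θ = 0 := by rw [h0]; rfl
  have h1 := ((hasDerivAt_conj hτ).mul hθ).smul_const (act (ra * ra) (nst n) : Fock)
  have h2 := ((hasDerivAt_conj hθ).mul hτ).smul_const (act (lo * lo) (nst n) : Fock)
  have h3 := ((hθ.mul (hasDerivAt_conj hθ)).mul_const (2 * n + 1 : ℂ)).smul_const (numberState n)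
  rw [funext fun s => numDiff_eq (γ s) n]
  refine ((h1.add h2).add h3).congr_deriv ?_
  simp [e1, e2]

/-- At `n = 0` the deviation from one is `O(|θ|²)`, so the derivative is zero. Each step of the
recursion then adds `t`; the `θ` term contributes nothing, since its other factor tends to `⟪e_n,
e_{n+2}⟫ = 0`. -/
lemma hasDerivAt_diagCoeff (h0 : γ 0 = 1) (hτ : HasDerivAt (fun s => (γ s).τ) t 0)
    (hθ : HasDerivAt (fun s => (γ s).θ) u 0) (n : ℕ) :
    HasDerivAt (fun s => diagCoeff (γ s) n) (n * t) 0 := by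
  have hTτ := tendsto_τ h0 hτ
  have hTθ := tendsto_θ h0 hθ
  have e1 : (γ 0).τ = 1 := by rw [h0]; rfl
  have e2 : (γ 0).θ = 0 := by rw [h0]; rfl
  have e3 : ∀ n, diagCoeff (γ 0) n = 1 := fun n => by
    rw [diagCoeff, h0, impl_one_symm, numberState_apply, if_pos rfl]
  have hslope := hasDerivAt_complex_iff.mp hθ
  simp only [e2, sub_zero] at hslope
  induction n with
  | zero =>
    rw [hasDerivAt_complex_iff, e3]
    have h1 : Tendsto (fun s : ℝ => 100 * (‖((s⁻¹ : ℝ) : ℂ) * (γ s).θ‖ * ‖(γ s).θ‖)) (𝓝[≠] 0)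
        (𝓝 0) := by
      have := (hslope.norm.mul (hTθ.mono_left nhdsWithin_le_nhds).norm).const_mul 100
      simpa using this
    rw [Nat.cast_zero, zero_mul, tendsto_zero_iff_norm_tendsto_zero]
    refine squeeze_zero' (Eventually.of_forall fun s => norm_nonneg _) ?_ h1
    filter_upwards [(eventually_bounds hTτ hTθ).filter_mono nhdsWithin_le_nhds] with s hs
    rw [norm_mul, norm_mul]
    calc _ ≤ ‖((s⁻¹ : ℝ) : ℂ)‖ * (100 * ‖(γ s).θ‖ ^ 2) := by
          gcongr
          exact norm_diagCoeff_zero_sub_one_le hs.1 hs.2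
      _ = _ := by ring
  | succ n ih =>
    rw [funext fun s => diagCoeff_succ (γ s) n]
    set d : ℝ → ℂ := fun s => ((impl (γ s)).symm (numberState (n + 2)) : ℕ → ℂ) n with hd
    have hd0 : Tendsto d (𝓝[≠] 0) (𝓝 0) := by
      have h1 := tendsto_impl_symm_of_tendsto hTτ hTθ
        (tendsto_const_nhds (x := numberState (n + 2)))
      have h2 := ((lp.evalCLM ℂ (fun _ : ℕ => ℂ) 2 n).continuous.tendsto _).comp h1
      have h3 : (numberState (n + 2) : ℕ → ℂ) n = 0 := by
        rw [numberState_apply, if_neg (by omega)]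
      change Tendsto d (𝓝 0) (𝓝 ((numberState (n + 2) : ℕ → ℂ) n)) at h2
      rw [h3] at h2
      exact h2.mono_left nhdsWithin_le_nhds
    have h4 : HasDerivAt (fun s => (γ s).θ * d s) 0 0 := by
      rw [hasDerivAt_complex_iff]
      have := hslope.mul hd0
      rw [mul_zero] at this
      refine this.congr fun s => ?_
      rw [e2]
      ring
    have h5 := (hτ.mul ih).add (h4.const_mul
      ((Real.sqrt (n + 1 + 1) / Real.sqrt (n + 1) : ℝ) : ℂ))
    refine h5.congr_deriv ?_
    rw [e1, e3]
    push_cast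
    ring

/-- The gap estimate again, now for the difference quotient minus its expected limit: `N - n` turns
it into `W*` of the quotient of `numDiff` minus the derivative of `numDiff`, and both this and the
diagonal error tend to zero. -/
lemma hasDerivAt_impl_symm_numberState (h0 : γ 0 = 1) (hτ : HasDerivAt (fun s => (γ s).τ) t 0)
    (hθ : HasDerivAt (fun s => (γ s).θ) u 0) (n : ℕ) :
    HasDerivAt (fun s => (impl (γ s)).symm (numberState n)) (-(act (gen t u) (nst n) : Fock)) 0 := by
  have hTτ := (tendsto_τ h0 hτ).mono_left (nhdsWithin_le_nhds (s := {0}ᶜ))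
  have hTθ := (tendsto_θ h0 hθ).mono_left (nhdsWithin_le_nhds (s := {0}ᶜ))
  set N' : Fock := u • (act (ra * ra) (nst n) : Fock) + conj u • (act (lo * lo) (nst n) : Fock)
    with hN'
  have hn0 : numDiff (γ 0) n = 0 := by
    rw [numDiff, h0, substPoly_one, act_num_nst]
    exact sub_self _
  have h1 := hasDerivAt_fock_iff.mp (hasDerivAt_numDiff h0 hτ hθ n)
  have h2 := (tendsto_impl_symm_of_tendsto hTτ hTθ h1).sub_const N'
  rw [sub_self, hn0] at h2
  have h3 := (hasDerivAt_complex_iff.mp (hasDerivAt_diagCoeff h0 hτ hθ n)).sub_const (n * t)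
  rw [sub_self] at h3
  have e3 : diagCoeff (γ 0) n = 1 := by
    rw [diagCoeff, h0, impl_one_symm, numberState_apply, if_pos rfl]
  rw [hasDerivAt_fock_iff, h0, impl_one_symm, tendsto_iff_norm_sub_tendsto_zero]
  have h4 := h2.norm.add h3.norm
  simp only [norm_zero, add_zero] at h4
  refine squeeze_zero (fun s => norm_nonneg _) (fun s => ?_) h4
  have hG : ∀ m, ((act (gen t u) (nst n) : Fock) : ℕ → ℂ) m =
      -(t * (n * (numberState n : ℕ → ℂ) m)) -
        u / 2 * ((act (ra * ra) (nst n) : Fock) : ℕ → ℂ) m +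
        conj u / 2 * ((act (lo * lo) (nst n) : Fock) : ℕ → ℂ) m := fun m => by
    rw [act_gen, act_num_nst]
    rfl
  have hN : ∀ m, (N' : ℕ → ℂ) m = u * ((act (ra * ra) (nst n) : Fock) : ℕ → ℂ) m +
      conj u * ((act (lo * lo) (nst n) : Fock) : ℕ → ℂ) m := fun m => rfl
  -- The candidate limit `-G e_n` is determined off the diagonal by `(N - n)(-G e_n) = N'`; its
  -- diagonal entry `n t` is the derivative of `diagCoeff`.
  have hgap := norm_le_of_gap (n := n)
    (v := ((s⁻¹ : ℝ) : ℂ) • ((impl (γ s)).symm (numberState n) - numberState n) -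
      -(act (gen t u) (nst n) : Fock))
    (u := (impl (γ s)).symm (((s⁻¹ : ℝ) : ℂ) • (numDiff (γ s) n - 0)) - N') (fun m => by
      conv_lhs => rw [sub_zero, map_smul]
      change ((s⁻¹ : ℝ) : ℂ) * ((impl (γ s)).symm (numDiff (γ s) n) : ℕ → ℂ) m - (N' : ℕ → ℂ) m =
        ((m : ℂ) - n) * (((s⁻¹ : ℝ) : ℂ) * (((impl (γ s)).symm (numberState n) : ℕ → ℂ) m -
          (numberState n : ℕ → ℂ) m) - -((act (gen t u) (nst n) : Fock) : ℕ → ℂ) m)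
      rw [impl_symm_numDiff, hG, hN]
      have e : ((m : ℂ) - n) * (numberState n : ℕ → ℂ) m = 0 := by
        rw [numberState_apply]
        split_ifs with h
        · rw [h]; ring
        · ring
      linear_combination (((s⁻¹ : ℝ) : ℂ) + t * n) * e + u / 2 * act_ra_ra_nst_apply n m -
        conj u / 2 * act_lo_lo_nst_apply n m)
  refine hgap.trans (add_le_add le_rfl (le_of_eq ?_))
  congr 1
  change ((s⁻¹ : ℝ) : ℂ) * (diagCoeff (γ s) n - (numberState n : ℕ → ℂ) n) -
    -((act (gen t u) (nst n) : Fock) : ℕ → ℂ) n = _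
  have z1 : ((act (ra * ra) (nst n) : Fock) : ℕ → ℂ) n = 0 := by
    have := act_ra_ra_nst_apply n n
    rw [sub_self, zero_mul] at this
    simpa using this.symm
  have z2 : ((act (lo * lo) (nst n) : Fock) : ℕ → ℂ) n = 0 := by
    have := act_lo_lo_nst_apply n n
    rw [sub_self, zero_mul] at this
    simpa using this.symm
  rw [hG, z1, z2, numberState_apply, if_pos rfl, e3]
  ring

lemma exists_eventually_bounds (h0 : γ 0 = 1) (hτ : HasDerivAt (fun s => (γ s).τ) t 0)
    (hθ : HasDerivAt (fun s => (γ s).θ) u 0) : ∃ K : ℝ, 0 ≤ K ∧ ∀ᶠ s in 𝓝[≠] (0 : ℝ),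
      ‖(γ s).τ‖ ≤ 2 ∧ ‖(γ s).θ‖ ≤ 1 ∧ ‖((s⁻¹ : ℝ) : ℂ)‖ * (‖(γ s).θ‖ + ‖(γ s).τ - 1‖) ≤ K := by
  have hTτ := (tendsto_τ h0 hτ).mono_left (nhdsWithin_le_nhds (s := {0}ᶜ))
  have hTθ := (tendsto_θ h0 hθ).mono_left (nhdsWithin_le_nhds (s := {0}ᶜ))
  have h1 := (hasDerivAt_complex_iff.mp hθ).norm.add (hasDerivAt_complex_iff.mp hτ).norm
  refine ⟨‖u‖ + ‖t‖ + 1, by positivity, ?_⟩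
  filter_upwards [eventually_bounds hTτ hTθ, h1.eventually (ge_mem_nhds (lt_add_one _))] with s h2 h3
  refine ⟨h2.1, h2.2, ?_⟩
  rw [norm_mul, norm_mul, h0, show (1 : Bogoliubov).τ = 1 from rfl,
    show (1 : Bogoliubov).θ = 0 from rfl, sub_zero] at h3
  rwa [mul_add]

/-- A uniform bound for the difference quotients of the implementing operators on `𝒮`. -/
lemma exists_norm_slope_impl_le (h0 : γ 0 = 1) (hτ : HasDerivAt (fun s => (γ s).τ) t 0)
    (hθ : HasDerivAt (fun s => (γ s).θ) u 0) : ∃ K : ℝ, 0 ≤ K ∧ ∀ᶠ s in 𝓝[≠] (0 : ℝ),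
      ∀ x : schwartz, ‖((s⁻¹ : ℝ) : ℂ) • (impl (γ s) x - x)‖ ≤ K * ‖(act weight x : Fock)‖ := by
  obtain ⟨K, hK0, hK⟩ := exists_eventually_bounds h0 hτ hθ
  obtain ⟨C, hC0, hC⟩ := exists_impl_lipschitz
  refine ⟨C * K, by positivity, ?_⟩
  filter_upwards [hK] with s hs x
  rw [norm_smul]
  calc _ ≤ ‖((s⁻¹ : ℝ) : ℂ)‖ *
        (C * (‖(γ s).θ‖ + ‖(γ s).τ - 1‖) * ‖(act weight x : Fock)‖) := by
        gcongr
        exact hC _ hs.1 hs.2.1 x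
    _ = C * (‖((s⁻¹ : ℝ) : ℂ)‖ * (‖(γ s).θ‖ + ‖(γ s).τ - 1‖)) * ‖(act weight x : Fock)‖ := by ring
    _ ≤ _ := by
        gcongr
        exact hs.2.2

/-- Dominated convergence for the number-state expansion of `x`; the uniform Lipschitz estimate
bounds the quotients on `e_n` by a multiple of `n + 1`. -/
lemma hasDerivAt_impl_symm (h0 : γ 0 = 1) (hτ : HasDerivAt (fun s => (γ s).τ) t 0)
    (hθ : HasDerivAt (fun s => (γ s).θ) u 0) (x : schwartz) :
    HasDerivAt (fun s => (impl (γ s)).symm (x : Fock)) (-(act (gen t u) x : Fock)) 0 := by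
  obtain ⟨K, hK0, hK⟩ := exists_eventually_bounds h0 hτ hθ
  obtain ⟨C, hC0, hC⟩ := exists_sum_coeff_le
  have hquot : ∀ n, Tendsto (fun s : ℝ => ((s⁻¹ : ℝ) : ℂ) •
      ((impl (γ s)).symm (numberState n) - numberState n)) (𝓝[≠] 0)
      (𝓝 (-(act (gen t u) (nst n) : Fock))) := fun n => by
    have := hasDerivAt_fock_iff.mp (hasDerivAt_impl_symm_numberState h0 hτ hθ n)
    rwa [h0, impl_one_symm] at this
  have hbound : ∀ᶠ s in 𝓝[≠] (0 : ℝ), ∀ n : ℕ, ‖((s⁻¹ : ℝ) : ℂ) •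
      ((impl (γ s)).symm (numberState n) - numberState n)‖ ≤ 110 * K * (n + 1) := by
    filter_upwards [hK] with s hs n
    rw [norm_smul]
    calc _ ≤ ‖((s⁻¹ : ℝ) : ℂ)‖ * (110 * (‖(γ s).θ‖ + ‖(γ s).τ - 1‖) * (n + 1)) := by
          gcongr
          exact norm_impl_symm_sub_le hs.1 hs.2.1 n
      _ = 110 * (‖((s⁻¹ : ℝ) : ℂ)‖ * (‖(γ s).θ‖ + ‖(γ s).τ - 1‖)) * (n + 1) := by ring
      _ ≤ _ := by
          gcongr
          exact hs.2.2
  -- The bound on `G e_n` is inherited from the quotients by passing to the limit.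
  have hlim : ∀ n : ℕ, ‖(act (gen t u) (nst n) : Fock)‖ ≤ 110 * K * (n + 1) := fun n => by
    rw [← norm_neg]
    exact le_of_tendsto (hquot n).norm (hbound.mono fun s hs => hs n)
  have hsum : HasSum (fun n => ((x : Fock) : ℕ → ℂ) n • -(act (gen t u) (nst n) : Fock))
      (-(act (gen t u) x : Fock)) := by
    simp only [smul_neg]
    refine (hasSum_act_numberState ?_).neg
    refine Summable.of_norm_bounded ((hC x).1.mul_left (110 * K)) fun n => ?_
    rw [norm_smul, mul_left_comm]
    gcongr
    exact hlim n
  rw [hasDerivAt_fock_iff, h0, impl_one_symm, ← hsum.tsum_eq]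
  have hT := tendsto_tsum_of_dominated_convergence (𝓕 := 𝓝[≠] (0 : ℝ))
    (f := fun s n => ((x : Fock) : ℕ → ℂ) n • ((s⁻¹ : ℝ) : ℂ) •
      ((impl (γ s)).symm (numberState n) - numberState n))
    ((hC x).1.mul_left (110 * K)) (fun n => (hquot n).const_smul _) (by
      filter_upwards [hbound] with s hs n
      rw [norm_smul, mul_left_comm]
      gcongr
      exact hs n)
  refine hT.congr fun s => ?_
  have h1 : HasSum (fun n => ((x : Fock) : ℕ → ℂ) n • (impl (γ s)).symm (numberState n))
      ((impl (γ s)).symm (x : Fock)) := by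
    have := (hasSum_numberState (x : Fock)).mapL ((impl (γ s)).symm : Fock →L[ℂ] Fock)
    simpa using this
  have h2 := (h1.sub (hasSum_numberState (x : Fock))).const_smul ((s⁻¹ : ℝ) : ℂ)
  rw [← h2.tsum_eq]
  refine tsum_congr fun n => ?_
  rw [← smul_sub, smul_comm]

lemma hasDerivAt_impl (h0 : γ 0 = 1) (hτ : HasDerivAt (fun s => (γ s).τ) t 0)
    (hθ : HasDerivAt (fun s => (γ s).θ) u 0) (x : schwartz) :
    HasDerivAt (fun s => impl (γ s) (x : Fock)) (act (gen t u) x : Fock) 0 := by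
  have hTτ := (tendsto_τ h0 hτ).mono_left (nhdsWithin_le_nhds (s := {0}ᶜ))
  have hTθ := (tendsto_θ h0 hθ).mono_left (nhdsWithin_le_nhds (s := {0}ᶜ))
  have h1 := hasDerivAt_fock_iff.mp (hasDerivAt_impl_symm h0 hτ hθ x)
  have h2 := (tendsto_impl_of_tendsto hTτ hTθ h1).neg
  rw [neg_neg] at h2
  rw [hasDerivAt_fock_iff]
  refine h2.congr fun s => ?_
  rw [h0, impl_one, impl_one_symm, map_smul, map_sub, LinearIsometryEquiv.apply_symm_apply,
    ← smul_neg, neg_sub]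

/-- Anti-Hermiticity by differentiating `⟪W_s x, y⟫ = ⟪x, W_s* y⟫`; no computation with the
coefficients is needed. -/
lemma inner_gen (h0 : γ 0 = 1) (hτ : HasDerivAt (fun s => (γ s).τ) t 0)
    (hθ : HasDerivAt (fun s => (γ s).θ) u 0) (x y : schwartz) :
    inner ℂ (act (gen t u) x : Fock) (y : Fock) =
      -inner ℂ (x : Fock) (act (gen t u) y : Fock) := by
  have h1 := (hasDerivAt_impl h0 hτ hθ x)
  have h2 := (hasDerivAt_impl_symm h0 hτ hθ y)
  rw [hasDerivAt_fock_iff] at h1 h2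
  have h3 := h1.inner (𝕜 := ℂ) (tendsto_const_nhds (x := (y : Fock)))
  have h4 := (tendsto_const_nhds (x := (x : Fock))).inner (𝕜 := ℂ) h2
  rw [inner_neg_right] at h4
  refine tendsto_nhds_unique h3 (h4.congr fun s => ?_)
  simp only [h0, impl_one, impl_one_symm, inner_smul_left, inner_smul_right, Complex.conj_ofReal,
    inner_sub_left, inner_sub_right]
  congr 2
  rw [← (impl (γ s)).inner_map_map, LinearIsometryEquiv.apply_symm_apply]

/-- Comparison of the derivative of a conjugated operator with the commutator with the
generator, in matrix elements. -/
lemma inner_deriv_add (h0 : γ 0 = 1) (hτ : HasDerivAt (fun s => (γ s).τ) t 0)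
    (hθ : HasDerivAt (fun s => (γ s).θ) u 0) {P : ℝ → Fock} {P' y : Fock} (hP : HasDerivAt P P' 0)
    (x z : schwartz) (h : ∀ s, inner ℂ (P s) (impl (γ s) (x : Fock)) =
      (inner ℂ y (impl (γ s) (z : Fock)) : ℂ)) :
    inner ℂ P' (x : Fock) + inner ℂ (P 0) (act (gen t u) x : Fock) =
      (inner ℂ y (act (gen t u) z : Fock) : ℂ) := by
  have h1 := hasDerivAt_fock_iff.mp (hasDerivAt_impl h0 hτ hθ x)
  have h2 := hasDerivAt_fock_iff.mp (hasDerivAt_impl h0 hτ hθ z)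
  have hTτ := (tendsto_τ h0 hτ).mono_left (nhdsWithin_le_nhds (s := {0}ᶜ))
  have hTθ := (tendsto_θ h0 hθ).mono_left (nhdsWithin_le_nhds (s := {0}ᶜ))
  have h3 := (hasDerivAt_fock_iff.mp hP).inner (𝕜 := ℂ) (tendsto_impl hTτ hTθ (x : Fock))
  have h4 := (tendsto_const_nhds (x := P 0)).inner (𝕜 := ℂ) h1
  have h5 := (tendsto_const_nhds (x := y)).inner (𝕜 := ℂ) h2
  refine tendsto_nhds_unique (h3.add h4) (h5.congr fun s => ?_)
  have e0 := h 0
  have es := h s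
  simp only [h0, impl_one, inner_smul_left, inner_smul_right, Complex.conj_ofReal,
    inner_sub_left, inner_sub_right] at e0 ⊢
  linear_combination ((s⁻¹ : ℝ) : ℂ) * (e0 - es)

end Family

/-! ### Differentiation of polynomials along a family -/

section PolyFamily

variable {γ : ℝ → Bogoliubov} {t u : ℂ}

/-- The dependence on `s` sits in finitely many differentiable scalars in front of fixed
polynomials, so strong differentiability on `𝒮` reduces to finite sums. -/
lemma exists_subst_eq_sum (hτ : DifferentiableAt ℝ (fun s => (γ s).τ) 0)
    (hθ : DifferentiableAt ℝ (fun s => (γ s).θ) 0) (f : NCPoly) :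
    ∃ (ι : Type) (_ : Fintype ι) (c : ι → ℝ → ℂ) (p : ι → NCPoly),
      (∀ i, DifferentiableAt ℝ (c i) 0) ∧ ∀ s, substPoly (γ s) f = ∑ i, c i s • p i := by
  induction f using FreeAlgebra.induction with
  | grade0 r =>
    refine ⟨Unit, inferInstance, fun _ _ => r, fun _ => 1, fun _ => differentiableAt_const _,
      fun s => ?_⟩
    rw [AlgHom.commutes, Algebra.algebraMap_eq_smul_one]
    simp
  | grade1 l =>
    have hτ' : DifferentiableAt ℝ (fun s => conj (γ s).τ) 0 :=
      (hasDerivAt_conj hτ.hasDerivAt).differentiableAt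
    have hθ' : DifferentiableAt ℝ (fun s => conj (γ s).θ) 0 :=
      (hasDerivAt_conj hθ.hasDerivAt).differentiableAt
    cases l
    · refine ⟨Bool, inferInstance, fun i s => cond i (γ s).τ (γ s).θ, fun i => cond i lo ra,
        fun i => ?_, fun s => ?_⟩
      · cases i
        exacts [hθ, hτ]
      · rw [substPoly_lo]
        simp
    · refine ⟨Bool, inferInstance, fun i s => cond i (conj (γ s).τ) (conj (γ s).θ),
        fun i => cond i ra lo, fun i => ?_, fun s => ?_⟩
      · cases i
        exacts [hθ', hτ']
      · rw [substPoly_ra]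
        simp
  | mul f f' hf hf' =>
    obtain ⟨ι, _, c, p, hc, h⟩ := hf
    obtain ⟨ι', _, c', p', hc', h'⟩ := hf'
    refine ⟨ι × ι', inferInstance, fun i s => c i.1 s * c' i.2 s, fun i => p i.1 * p' i.2,
      fun i => (hc i.1).mul (hc' i.2), fun s => ?_⟩
    rw [map_mul, h, h', Finset.sum_mul_sum, Fintype.sum_prod_type]
    refine Finset.sum_congr rfl fun i _ => Finset.sum_congr rfl fun j _ => ?_
    rw [smul_mul_smul_comm]
  | add f f' hf hf' =>
    obtain ⟨ι, _, c, p, hc, h⟩ := hf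
    obtain ⟨ι', _, c', p', hc', h'⟩ := hf'
    refine ⟨ι ⊕ ι', inferInstance, Sum.elim c c', Sum.elim p p', fun i => ?_, fun s => ?_⟩
    · cases i
      exacts [hc _, hc' _]
    · rw [map_add, h, h', Fintype.sum_sum_type]
      rfl

lemma differentiableAt_act_subst (hτ : DifferentiableAt ℝ (fun s => (γ s).τ) 0)
    (hθ : DifferentiableAt ℝ (fun s => (γ s).θ) 0) (f : NCPoly) (x : schwartz) :
    DifferentiableAt ℝ (fun s => (act (substPoly (γ s) f) x : Fock)) 0 := by
  obtain ⟨ι, _, c, p, hc, h⟩ := exists_subst_eq_sum hτ hθ f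
  have e : (fun s => (act (substPoly (γ s) f) x : Fock)) =
      fun s => ∑ i, c i s • (act (p i) x : Fock) := funext fun s => by
    rw [h, map_sum, LinearMap.sum_apply, Submodule.coe_sum]
    refine Finset.sum_congr rfl fun i _ => ?_
    rw [map_smul]
    rfl
  rw [e]
  exact DifferentiableAt.fun_sum fun i _ => (hc i).smul_const _

/-- The derivative exists by the finite expansion; it is identified with `[G, f] x` through matrix
elements, by differentiating `f(a_s, a_s*) = W_s f W_s*` weakly. -/
lemma hasDerivAt_act_subst (h0 : γ 0 = 1) (hτ : HasDerivAt (fun s => (γ s).τ) t 0)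
    (hθ : HasDerivAt (fun s => (γ s).θ) u 0) (f : NCPoly) (x : schwartz) :
    HasDerivAt (fun s => (act (substPoly (γ s) f) x : Fock))
      (act (gen t u) (act f x) - act f (act (gen t u) x) : Fock) 0 := by
  obtain ⟨f', hf'⟩ := exists_formal_adjoint f
  have h1 := (differentiableAt_act_subst hτ.differentiableAt hθ.differentiableAt f x).hasDerivAt
  refine h1.congr_deriv (basis_inner_ext numberBasis fun n => ?_)
  rw [numberBasis_apply, ← coe_nst]
  have h2 := inner_deriv_add h0 hτ hθ h1 (nst n) (act f' (nst n)) (y := x) fun s => by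
    rw [act_subst_eq, LinearIsometryEquiv.inner_map_map, hf',
      ← (impl (γ s)).inner_map_map, implSymmS, LinearIsometryEquiv.apply_symm_apply]
  rw [h0, substPoly_one] at h2
  have h3 := inner_gen h0 hτ hθ (act f x) (nst n)
  have h4 := inner_gen h0 hτ hθ x (act f' (nst n))
  have h5 := hf' (act (gen t u) x) (nst n)
  rw [← inner_conj_symm, ← inner_conj_symm (nst n : Fock), inner_sub_left]
  congr 1
  linear_combination h2 - h3 + h4 + h5

end PolyFamily

/-! ### Exponentials of operators with discrete spectrum -/

section Exp

variable {T : Fock →ₗ.[ℂ] Fock} {b : HilbertBasis ℕ ℂ Fock} {E : ℕ → ℝ}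

lemma isFormalAdjoint_self (hT : IsSelfAdjoint T) : T.IsFormalAdjoint T := by
  have h := LinearPMap.adjoint_isFormalAdjoint (hT.dense_domain)
  rwa [LinearPMap.isSelfAdjoint_def.mp hT] at h

lemma isFormalAdjoint_conjOp (hT : T.IsFormalAdjoint T) (W : Fock ≃ₗᵢ[ℂ] Fock) :
    (conjOp W T).IsFormalAdjoint (conjOp W T) := fun x y => by
  have h := hT ⟨W.symm x, x.2⟩ ⟨W.symm y, y.2⟩
  have e1 : inner ℂ (conjOp W T x) (y : Fock) =
      inner ℂ (T ⟨W.symm x, x.2⟩) (W.symm (y : Fock)) := by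
    have := W.inner_map_map (T ⟨W.symm x, x.2⟩) (W.symm (y : Fock))
    rwa [W.apply_symm_apply] at this
  have e2 : inner ℂ (x : Fock) (conjOp W T y) =
      inner ℂ (W.symm (x : Fock)) (T ⟨W.symm y, y.2⟩) := by
    have := W.inner_map_map (W.symm (x : Fock)) (T ⟨W.symm y, y.2⟩)
    rwa [W.apply_symm_apply] at this
  rw [e1, e2]
  exact h

/-- Symmetry makes eigenvectors with distinct eigenvalues orthogonal. Hence two eigenbases couple
only at equal energies, where the two exponentials agree. -/
lemma isExpNeg_unique (hT : T.IsFormalAdjoint T) {p : ℝ} {B B' : Fock →L[ℂ] Fock}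
    (hB : IsExpNeg T p B) (hB' : IsExpNeg T p B') : B = B' := by
  obtain ⟨b, E, hb, h⟩ := hB
  obtain ⟨b', E', hb', h'⟩ := hB'
  refine basis_ext b' fun n => basis_inner_ext b fun m => ?_
  rw [inner_diag h, h', inner_smul_right]
  obtain ⟨h1, h2⟩ := hb m
  obtain ⟨h3, h4⟩ := hb' n
  have h5 : inner ℂ (T ⟨b m, h1⟩) (b' n) = inner ℂ (b m) (T ⟨b' n, h3⟩) :=
    hT ⟨b m, h1⟩ ⟨b' n, h3⟩
  rw [h2, h4, inner_smul_left, inner_smul_right, Complex.conj_ofReal] at h5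
  by_cases h6 : inner ℂ (b m) (b' n) = (0 : ℂ)
  · rw [h6, mul_zero, mul_zero]
  · rw [Complex.ofReal_injective (mul_right_cancel₀ h6 h5)]

lemma expNeg_eq (hT : T.IsFormalAdjoint T) {p : ℝ} {B : Fock →L[ℂ] Fock} (hB : IsExpNeg T p B) :
    expNeg T p = B := by
  have h : ∃ B, IsExpNeg T p B := ⟨B, hB⟩
  rw [expNeg, dif_pos h]
  exact isExpNeg_unique hT h.choose_spec hB

lemma exists_isExpNeg (hb : IsEigenbasis T b E) {M : ℝ} (hM : ∀ n, -M ≤ E n) {p : ℝ} (hp : 0 ≤ p) :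
    ∃ B : Fock →L[ℂ] Fock, IsExpNeg T p B ∧
      ∀ n, B (b n) = (Real.exp (-p * E n) : ℂ) • b n := by
  have h1 : ∀ n, ‖((Real.exp (-p * E n) : ℝ) : ℂ)‖ ≤ Real.exp (p * M) := fun n => by
    rw [Complex.norm_real, Real.norm_of_nonneg (Real.exp_nonneg _)]
    exact Real.exp_le_exp.mpr (by nlinarith [hM n])
  obtain ⟨B, hB⟩ := exists_diag b h1
  exact ⟨B, ⟨b, E, hb, hB⟩, hB⟩

lemma isEigenbasis_conjOp (hb : IsEigenbasis T b E) (W : Fock ≃ₗᵢ[ℂ] Fock) :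
    IsEigenbasis (conjOp W T) (mapBasis W b) E := fun n => by
  obtain ⟨h1, h2⟩ := hb n
  have h3 : (⟨W.symm (mapBasis W b n), by simpa using h1⟩ : T.domain) = ⟨b n, h1⟩ :=
    Subtype.ext (by simp)
  refine ⟨by simpa using h1, ?_⟩
  rw [conjOp_apply, h3, h2, map_smul, mapBasis_apply]

/-- Conjugation of a bounded operator by a unitary operator. -/
def conjCLM (W : Fock ≃ₗᵢ[ℂ] Fock) (B : Fock →L[ℂ] Fock) : Fock →L[ℂ] Fock :=
  (W : Fock →L[ℂ] Fock).comp (B.comp (W.symm : Fock →L[ℂ] Fock))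

@[simp] lemma conjCLM_apply (W : Fock ≃ₗᵢ[ℂ] Fock) (B : Fock →L[ℂ] Fock) (x : Fock) :
    conjCLM W B x = W (B (W.symm x)) := rfl

lemma isExpNeg_conjOp {p : ℝ} {B : Fock →L[ℂ] Fock} (hB : IsExpNeg T p B) (W : Fock ≃ₗᵢ[ℂ] Fock) :
    IsExpNeg (conjOp W T) p (conjCLM W B) := by
  obtain ⟨b, E, hb, h⟩ := hB
  refine ⟨mapBasis W b, E, isEigenbasis_conjOp hb W, fun n => ?_⟩
  rw [conjCLM_apply, mapBasis_apply, LinearIsometryEquiv.symm_apply_apply, h, map_smul]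

end Exp

/-! ### Gibbs semigroups -/

/-- The operators `R p = ρ^p`, `p ≥ 0`, are diagonal in a basis `v` of vectors of `𝒮`, with
eigenvalues `e^{-p ε}`, and `ρ = R 1` has finite moments. -/
structure IsGibbs (b : HilbertBasis ℕ ℂ Fock) (v : ℕ → schwartz) (ε : ℕ → ℝ)
    (R : ℝ → Fock →L[ℂ] Fock) : Prop where
  coe_v : ∀ n, (v n : Fock) = b n
  diag : ∀ p, 0 ≤ p → ∀ n, R p (b n) = (Real.exp (-p * ε n) : ℂ) • b n
  moment : ∀ f, Summable fun n => Real.exp (-1 * ε n) * ‖(act f (v n) : Fock)‖ ^ 2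

namespace IsGibbs

variable {b : HilbertBasis ℕ ℂ Fock} {v : ℕ → schwartz} {ε : ℕ → ℝ} {R : ℝ → Fock →L[ℂ] Fock}

lemma norm_v (h : IsGibbs b v ε R) (n : ℕ) : ‖(v n : Fock)‖ = 1 := by
  rw [h.coe_v, b.orthonormal.1]

/-- With `D = (N + 1)⁻¹`, `‖f v_n‖² = ⟪D v_n, (N + 1) f* f v_n⟫`, and `‖D v_n‖` is square summable.
Cauchy–Schwarz then needs only the weight `e^{-pε/2}` squared, so moments at `p` for all polynomials
imply moments at `p/2`. -/
lemma moment_half (h : IsGibbs b v ε R) {p : ℝ}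
    (hp : ∀ f, Summable fun n => Real.exp (-p * ε n) * ‖(act f (v n) : Fock)‖ ^ 2) (f : NCPoly) :
    Summable fun n => Real.exp (-(p / 2) * ε n) * ‖(act f (v n) : Fock)‖ ^ 2 := by
  obtain ⟨f', hf'⟩ := exists_formal_adjoint f
  obtain ⟨D, hD1, hD2, hD3⟩ := exists_inv_num
  have h1 : ∀ n, ‖(act f (v n) : Fock)‖ ^ 2 ≤
      ‖D (b n)‖ * ‖(act ((num + 1) * f' * f) (v n) : Fock)‖ := fun n => by
    have h2 : (‖(act f (v n) : Fock)‖ ^ 2 : ℝ) =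
        ‖(inner ℂ (act f (v n) : Fock) (act f (v n) : Fock) : ℂ)‖ := by
      rw [inner_self_eq_norm_sq_to_K, norm_pow, RCLike.norm_ofReal, abs_norm]
    rw [h2, hf', ← hD2 (act f' _), ← hD1, ← act_mul, ← act_mul, h.coe_v]
    exact norm_inner_le_norm (𝕜 := ℂ) (D (b n)) (act ((num + 1) * f' * f) (v n) : Fock)
  have h3 : Summable fun n => ‖D (b n)‖ * (Real.exp (-(p / 2) * ε n) *
      ‖(act ((num + 1) * f' * f) (v n) : Fock)‖) := by
    refine summable_mul_of_sq (hD3 b) ((hp ((num + 1) * f' * f)).congr fun n => ?_)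
    rw [mul_pow, ← Real.exp_nat_mul]
    congr 2
    push_cast
    ring
  refine Summable.of_nonneg_of_le (fun n => by positivity) (fun n => ?_) h3
  calc _ ≤ Real.exp (-(p / 2) * ε n) *
        (‖D (b n)‖ * ‖(act ((num + 1) * f' * f) (v n) : Fock)‖) := by
        gcongr
        exact h1 n
    _ = _ := by ring

lemma exists_lower_bound (h : IsGibbs b v ε R) : ∃ M, 0 ≤ M ∧ ∀ n, -M ≤ ε n := by
  have h1 : Summable fun n => Real.exp (-1 * ε n) := by
    refine (h.moment 1).congr fun n => ?_
    rw [map_one, Module.End.one_apply, h.norm_v, one_pow, mul_one]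
  refine ⟨max 0 (Real.log (∑' n, Real.exp (-1 * ε n))), le_max_left _ _, fun n => ?_⟩
  have h2 := h1.le_tsum n fun m _ => Real.exp_nonneg _
  have h3 := Real.log_le_log (Real.exp_pos _) h2
  rw [Real.log_exp] at h3
  linarith [le_max_right 0 (Real.log (∑' n, Real.exp (-1 * ε n)))]

/-- Halve from `p = 1` until below `p`, then compare weights using that `ε` is bounded below. -/
lemma moment_pos (h : IsGibbs b v ε R) {p : ℝ} (hp : 0 < p) (f : NCPoly) :
    Summable fun n => Real.exp (-p * ε n) * ‖(act f (v n) : Fock)‖ ^ 2 := by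
  obtain ⟨k, hk⟩ := exists_pow_lt_of_lt_one hp (by norm_num : (1 / 2 : ℝ) < 1)
  obtain ⟨M, hM0, hM⟩ := h.exists_lower_bound
  have h1 : ∀ k : ℕ, ∀ f, Summable fun n =>
      Real.exp (-((1 / 2 : ℝ) ^ k) * ε n) * ‖(act f (v n) : Fock)‖ ^ 2 := fun k => by
    induction k with
    | zero => simpa using h.moment
    | succ k ih =>
      intro f
      have := h.moment_half ih f
      rwa [pow_succ, mul_one_div]
  refine Summable.of_nonneg_of_le (fun n => by positivity) (fun n => ?_)
    ((h1 k f).mul_left (Real.exp ((p - (1 / 2 : ℝ) ^ k) * M)))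
  rw [← mul_assoc, ← Real.exp_add]
  gcongr
  nlinarith [hM n]

lemma summable_exp (h : IsGibbs b v ε R) {p : ℝ} (hp : 0 < p) :
    Summable fun n => Real.exp (-p * ε n) := by
  refine (h.moment_pos hp 1).congr fun n => ?_
  rw [map_one, Module.End.one_apply, h.norm_v, one_pow, mul_one]

lemma summable_mul_norm (h : IsGibbs b v ε R) {p : ℝ} (hp : 0 < p) (f f' : NCPoly) :
    Summable fun n => Real.exp (-p * ε n) *
      (‖(act f (v n) : Fock)‖ * ‖(act f' (v n) : Fock)‖) := by
  refine Summable.of_nonneg_of_le (fun n => by positivity) (fun n => ?_)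
    ((h.moment_pos hp f).add (h.moment_pos hp f'))
  rw [← mul_add]
  gcongr
  nlinarith [sq_nonneg (‖(act f (v n) : Fock)‖ - ‖(act f' (v n) : Fock)‖),
    sq_nonneg ‖(act f (v n) : Fock)‖, sq_nonneg ‖(act f' (v n) : Fock)‖]

lemma summable_norm (h : IsGibbs b v ε R) {p : ℝ} (hp : 0 < p) (f : NCPoly) :
    Summable fun n => Real.exp (-p * ε n) * ‖(act f (v n) : Fock)‖ := by
  refine (h.summable_mul_norm hp f 1).congr fun n => ?_
  rw [map_one, Module.End.one_apply, h.norm_v, mul_one]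

lemma hasSum_R (h : IsGibbs b v ε R) {p : ℝ} (hp : 0 ≤ p) (x : Fock) :
    HasSum (fun n => ((Real.exp (-p * ε n) : ℂ) * inner ℂ (b n) x) • (v n : Fock)) (R p x) := by
  have h1 : HasSum (fun n => R p ((b.repr x : ℕ → ℂ) n • b n)) (R p x) :=
    (b.hasSum_repr x).mapL (R p)
  have h2 : (fun n => R p ((b.repr x : ℕ → ℂ) n • b n)) =
      fun n => ((Real.exp (-p * ε n) : ℂ) * inner ℂ (b n) x) • (v n : Fock) := funext fun n => by
    rw [map_smul, h.diag p hp, b.repr_apply_apply, smul_smul, h.coe_v, mul_comm]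
  rwa [h2] at h1

/-- The moments make the eigenvector expansion of `ρ^p x` converge absolutely after any polynomial
is applied: `ρ^p` is smoothing. -/
lemma exists_act_R (h : IsGibbs b v ε R) {p : ℝ} (hp : 0 < p) (x : Fock) :
    ∃ hx : R p x ∈ schwartz, ∀ f,
      HasSum (fun n => ((Real.exp (-p * ε n) : ℂ) * inner ℂ (b n) x) • (act f (v n) : Fock))
        (act f (⟨R p x, hx⟩ : schwartz) : Fock) := by
  refine hasSum_act (h.hasSum_R hp.le x) fun f => ?_
  refine Summable.of_nonneg_of_le (fun n => by positivity) (fun n => ?_)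
    ((h.summable_norm hp f).mul_left ‖x‖)
  rw [norm_mul, Complex.norm_real, Real.norm_of_nonneg (Real.exp_nonneg _), ← mul_assoc,
    mul_comm ‖x‖]
  gcongr
  refine (norm_inner_le_norm _ _).trans ?_
  rw [b.orthonormal.1, one_mul]

lemma R_mem (h : IsGibbs b v ε R) {p : ℝ} (hp : 0 < p) (x : Fock) : R p x ∈ schwartz :=
  (h.exists_act_R hp x).1

/-- `ρ^p x` as an element of `𝒮`. -/
def toS (h : IsGibbs b v ε R) {p : ℝ} (hp : 0 < p) (x : Fock) : schwartz := ⟨R p x, h.R_mem hp x⟩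

/-- The bounded operator `f(A, A*) ρ^p`. -/
lemma exists_actR (h : IsGibbs b v ε R) {p : ℝ} (hp : 0 < p) (f : NCPoly) :
    ∃ K : Fock →L[ℂ] Fock, ∀ x, K x = (act f (h.toS hp x) : Fock) := by
  let L : Fock →ₗ[ℂ] Fock :=
    { toFun := fun x => (act f (h.toS hp x) : Fock)
      map_add' := fun x y => by
        have : h.toS hp (x + y) = h.toS hp x + h.toS hp y := Subtype.ext (map_add (R p) x y)
        rw [this, map_add]
        rfl
      map_smul' := fun c x => by
        have : h.toS hp (c • x) = c • h.toS hp x := Subtype.ext (map_smul (R p) c x)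
        rw [this, map_smul]
        rfl }
  refine ⟨L.mkContinuous (∑' n, Real.exp (-p * ε n) * ‖(act f (v n) : Fock)‖) fun x => ?_,
    fun x => rfl⟩
  have h1 := (h.exists_act_R hp x).2 f
  change ‖(act f (h.toS hp x) : Fock)‖ ≤ _
  rw [toS, ← h1.tsum_eq, ← tsum_mul_right]
  refine tsum_of_norm_bounded ((h.summable_norm hp f).mul_right ‖x‖).hasSum fun n => ?_
  rw [norm_smul, norm_mul, Complex.norm_real, Real.norm_of_nonneg (Real.exp_nonneg _),
    mul_right_comm]
  gcongr
  refine (norm_inner_le_norm _ _).trans ?_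
  rw [b.orthonormal.1, one_mul]

lemma R_add (h : IsGibbs b v ε R) {p q : ℝ} (hp : 0 ≤ p) (hq : 0 ≤ q) (x : Fock) :
    R (p + q) x = R p (R q x) := by
  have : R (p + q) = (R p).comp (R q) := basis_ext b fun n => by
    rw [ContinuousLinearMap.comp_apply, h.diag q hq, map_smul, h.diag p hp,
      h.diag _ (add_nonneg hp hq), smul_smul, ← Complex.ofReal_mul, ← Real.exp_add]
    congr 3
    ring
  rw [this]
  rfl

lemma inner_R (h : IsGibbs b v ε R) {p : ℝ} (hp : 0 ≤ p) (x y : Fock) :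
    inner ℂ (R p x) y = inner ℂ x (R p y) := inner_diag_real (h.diag p hp) x y

lemma exists_norm_R_le (h : IsGibbs b v ε R) :
    ∃ C, 0 ≤ C ∧ ∀ p, 0 ≤ p → p ≤ 1 → ∀ x, ‖R p x‖ ≤ C * ‖x‖ := by
  obtain ⟨M, hM0, hM⟩ := h.exists_lower_bound
  refine ⟨Real.exp M, Real.exp_nonneg _, fun p hp0 hp1 x =>
    norm_diag_le (h.diag p hp0) (Real.exp_nonneg _) (fun n => ?_) x⟩
  rw [Complex.norm_real, Real.norm_of_nonneg (Real.exp_nonneg _)]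
  exact Real.exp_le_exp.mpr (by nlinarith [hM n])

lemma summable_norm_sq_R (h : IsGibbs b v ε R) {p : ℝ} (hp : 0 < p) :
    Summable fun n => ‖R p (numberState n)‖ ^ 2 := by
  have h1 : Summable fun n => ‖R p (b n)‖ ^ 2 := by
    refine (h.summable_exp (p := 2 * p) (by positivity)).congr fun n => ?_
    rw [h.diag p hp.le, norm_smul, b.orthonormal.1, mul_one, Complex.norm_real,
      Real.norm_of_nonneg (Real.exp_nonneg _), ← Real.exp_nat_mul]
    congr 1
    push_cast
    ring
  simpa using (hasSum_norm_sq_basis h1.hasSum numberBasis).summable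

lemma summable_norm_sq_comp_R (h : IsGibbs b v ε R) {p : ℝ} (hp : 0 < p) (K : Fock →L[ℂ] Fock) :
    Summable fun n => ‖(K.comp (R p)) (numberState n)‖ ^ 2 := by
  refine Summable.of_nonneg_of_le (fun n => by positivity) (fun n => ?_)
    ((h.summable_norm_sq_R hp).mul_left (‖K‖ ^ 2))
  rw [← mul_pow]
  gcongr
  exact K.le_opNorm _

end IsGibbs

/-! ### The Gibbs densities of an operator and of its transforms -/

section Density

variable {T : Fock →ₗ.[ℂ] Fock} {b : HilbertBasis ℕ ℂ Fock} {E : ℕ → ℝ} {Z : ℝ}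

lemma exists_lower_bound_of_hasSum (hs : HasSum (fun n => Real.exp (-E n)) Z) :
    ∃ M, ∀ n, -M ≤ E n := by
  refine ⟨Real.log Z, fun n => ?_⟩
  have h := Real.log_le_log (Real.exp_pos _) (le_hasSum hs n fun m _ => Real.exp_nonneg _)
  rw [Real.log_exp] at h
  linarith

lemma exists_isExpNeg_of_hasSum (hb : IsEigenbasis T b E)
    (hs : HasSum (fun n => Real.exp (-E n)) Z) {p : ℝ} (hp : 0 ≤ p) :
    ∃ B : Fock →L[ℂ] Fock, IsExpNeg T p B ∧
      ∀ n, B (b n) = (Real.exp (-p * E n) : ℂ) • b n := by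
  obtain ⟨M, hM⟩ := exists_lower_bound_of_hasSum hs
  exact exists_isExpNeg hb hM hp

lemma expNeg_apply_basis (hT : T.IsFormalAdjoint T) (hb : IsEigenbasis T b E)
    (hs : HasSum (fun n => Real.exp (-E n)) Z) {p : ℝ} (hp : 0 ≤ p) (n : ℕ) :
    expNeg T p (b n) = (Real.exp (-p * E n) : ℂ) • b n := by
  obtain ⟨B, hB, h⟩ := exists_isExpNeg_of_hasSum hb hs hp
  rw [expNeg_eq hT hB, h]

lemma hasSum_expNeg_trace (hT : T.IsFormalAdjoint T) (hb : IsEigenbasis T b E)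
    (hs : HasSum (fun n => Real.exp (-E n)) Z) :
    HasSum (fun n => (inner ℂ (numberState n) (expNeg T 1 (numberState n)) : ℂ)) (Z : ℂ) := by
  have h := hasSum_trace (fun n => Real.exp_nonneg (-E n)) hs (T := expNeg T 1) (b := b)
    (fun n => by rw [expNeg_apply_basis hT hb hs zero_le_one, neg_one_mul]) numberBasis
  simpa only [numberBasis_apply] using h

lemma partitionFn_eq (hT : T.IsFormalAdjoint T) (hb : IsEigenbasis T b E)
    (hs : HasSum (fun n => Real.exp (-E n)) Z) : partitionFn T = Z := by
  have h : HasSum (fun n => (inner ℂ (numberState n) (expNeg T 1 (numberState n))).re) Z :=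
    (hasSum_expNeg_trace hT hb hs).mapL Complex.reCLM
  exact h.tsum_eq

/-- The normalisation `Z^{-p}` is absorbed as a shift of the energies by `log Z`, so the powers of
`ρ` form a diagonal semigroup. -/
lemma gibbsPow_apply_basis (hT : T.IsFormalAdjoint T) (hb : IsEigenbasis T b E)
    (hs : HasSum (fun n => Real.exp (-E n)) Z) (hZ : 0 < Z) {p : ℝ} (hp : 0 ≤ p) (n : ℕ) :
    gibbsPow T p (b n) = (Real.exp (-p * (E n + Real.log Z)) : ℂ) • b n := by
  rw [gibbsPow, smul_apply, expNeg_apply_basis hT hb hs hp, smul_smul,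
    partitionFn_eq hT hb hs, Real.rpow_def_of_pos hZ, ← Complex.ofReal_mul, ← Real.exp_add]
  congr 3
  ring

lemma gibbsPow_conjOp (hT : T.IsFormalAdjoint T) (hb : IsEigenbasis T b E)
    (hs : HasSum (fun n => Real.exp (-E n)) Z) {p : ℝ} (hp : 0 ≤ p)
    (W : Fock ≃ₗᵢ[ℂ] Fock) : gibbsPow (conjOp W T) p = conjCLM W (gibbsPow T p) := by
  obtain ⟨B, hB, -⟩ := exists_isExpNeg_of_hasSum hb hs hp
  have h1 := isFormalAdjoint_conjOp hT W
  have h2 := isEigenbasis_conjOp hb W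
  rw [gibbsPow, gibbsPow, expNeg_eq hT hB, expNeg_eq h1 (isExpNeg_conjOp hB W),
    partitionFn_eq hT hb hs, partitionFn_eq h1 h2 hs]
  ext1 x
  exact (map_smul W _ _).symm

lemma existsUnique_isExpNeg (hT : T.IsFormalAdjoint T) (hb : IsEigenbasis T b E)
    (hs : HasSum (fun n => Real.exp (-E n)) Z) {p : ℝ} (hp : 0 ≤ p) :
    ∃! B, IsExpNeg T p B := by
  obtain ⟨B, hB, -⟩ := exists_isExpNeg_of_hasSum hb hs hp
  exact ⟨B, hB, fun B' hB' => isExpNeg_unique hT hB' hB⟩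

end Density

lemma exists_isGibbs {U : Fock →ₗ.[ℂ] Fock} (hU : IsSelfAdjoint U) (hmom : FiniteMoments U) :
    ∃ b v E, IsEigenbasis U b E ∧ 0 < partitionFn U ∧
      HasSum (fun n => Real.exp (-E n)) (partitionFn U) ∧
      IsGibbs b v (fun n => E n + Real.log (partitionFn U)) (gibbsPow U) := by
  obtain ⟨b, E, hb, hS, hsum⟩ := hmom
  have hT := isFormalAdjoint_self hU
  let v : ℕ → schwartz := fun n => ⟨b n, hS n⟩
  have hf : ∀ f, Summable fun n => Real.exp (-E n) * ‖(act f (v n) : Fock)‖ ^ 2 := fun f => by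
    refine (hsum f).congr fun n => ?_
    rw [← app_polyOp]
  have hs : Summable fun n => Real.exp (-E n) := by
    refine (hf 1).congr fun n => ?_
    rw [map_one, Module.End.one_apply, show (v n : Fock) = b n from rfl, b.orthonormal.1, one_pow,
      mul_one]
  have hZ : partitionFn U = ∑' n, Real.exp (-E n) := partitionFn_eq hT hb hs.hasSum
  have hZ0 : 0 < partitionFn U := by
    rw [hZ]
    exact hs.tsum_pos (fun n => Real.exp_nonneg _) 0 (Real.exp_pos _)
  have hs' : HasSum (fun n => Real.exp (-E n)) (partitionFn U) := hZ ▸ hs.hasSum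
  refine ⟨b, v, E, hb, hZ0, hs', fun n => rfl,
    fun p hp n => gibbsPow_apply_basis hT hb hs' hZ0 hp n, fun f => ?_⟩
  refine ((hf f).mul_left (partitionFn U)⁻¹).congr fun n => ?_
  rw [← mul_assoc, neg_one_mul, neg_add, Real.exp_add, Real.exp_neg (Real.log _),
    Real.exp_log hZ0, mul_comm (Real.exp _)]

/-! ### Operators represented by Hilbert-Schmidt operators -/

lemma represents_iff {R : Fock →L[ℂ] Fock} {T : Fock →ₗ.[ℂ] Fock} {F : HS} :
    Represents R T F ↔ ∀ x, ∃ h : R x ∈ T.domain, toCLM F x = R (T ⟨R x, h⟩) :=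
  forall_congr' fun _ => exists_congr fun _ => sendsTo_iff

lemma represents_conj {R : Fock →L[ℂ] Fock} {T : Fock →ₗ.[ℂ] Fock} {F : HS}
    (h : Represents R T F) (W : Fock ≃ₗᵢ[ℂ] Fock) :
    Represents (conjCLM W R) (conjOp W T) (conjHS W F) := by
  rw [represents_iff] at h ⊢
  intro x
  obtain ⟨h1, h2⟩ := h (W.symm x)
  have h3 : conjCLM W R x ∈ (conjOp W T).domain := by
    rw [mem_conjOp, conjCLM_apply, LinearIsometryEquiv.symm_apply_apply]
    exact h1
  refine ⟨h3, ?_⟩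
  rw [toCLM_conjHS, h2, conjOp_apply, conjCLM_apply, LinearIsometryEquiv.symm_apply_apply]
  congr 4
  exact Subtype.ext (by simp)

lemma IsGibbs.exists_represents_bounded {b : HilbertBasis ℕ ℂ Fock} {v : ℕ → schwartz} {ε : ℕ → ℝ}
    {R : ℝ → Fock →L[ℂ] Fock} (h : IsGibbs b v ε R) {p : ℝ} (hp : 0 < p) (B : Fock →L[ℂ] Fock) :
    ∃ F, Represents (R p) ((B : Fock →ₗ[ℂ] Fock).toPMap ⊤) F := by
  refine ⟨ofCLM (((R p).comp B).comp (R p)) (h.summable_norm_sq_comp_R hp _), ?_⟩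
  rw [represents_iff]
  intro x
  exact ⟨trivial, by rw [toCLM_ofCLM]; rfl⟩

/-- Write `ρ^p f ρ^p` as `ρ^p (f ρ^{p/2}) ρ^{p/2}`: half of the power makes `f` bounded and the
other half is Hilbert–Schmidt. -/
lemma IsGibbs.exists_represents_polyOp {b : HilbertBasis ℕ ℂ Fock} {v : ℕ → schwartz} {ε : ℕ → ℝ}
    {R : ℝ → Fock →L[ℂ] Fock} (h : IsGibbs b v ε R) {p : ℝ} (hp : 0 < p) (f : NCPoly) :
    ∃ F, Represents (R p) (polyOp f) F := by
  have hp2 : 0 < p / 2 := by positivity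
  obtain ⟨K, hK⟩ := h.exists_actR hp2 f
  refine ⟨ofCLM (((R p).comp K).comp (R (p / 2))) (h.summable_norm_sq_comp_R hp2 _), ?_⟩
  rw [represents_iff]
  intro x
  refine ⟨h.R_mem hp x, ?_⟩
  rw [toCLM_ofCLM, polyOp_apply]
  change R p (K (R (p / 2) x)) = _
  rw [hK]
  congr 3
  refine Subtype.ext ?_
  change R (p / 2) (R (p / 2) x) = R p x
  rw [← h.R_add hp2.le hp2.le, add_halves]

/-- A Hilbert–Schmidt operator orthogonal to all these rank-one operators has vanishing matrix
elements. -/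
lemma dense_of_rankOne_mem {M : Submodule ℂ HS} (b : HilbertBasis ℕ ℂ Fock)
    (h : ∀ m n, rankOne (b m) (b n) ∈ M) : Dense (M : Set HS) := by
  rw [Submodule.dense_iff_topologicalClosure_eq_top, Submodule.topologicalClosure_eq_top_iff,
    Submodule.eq_bot_iff]
  intro F hF
  apply toCLM_injective
  rw [map_zero]
  refine basis_ext b fun n => basis_inner_ext b fun m => ?_
  rw [← inner_rankOne, (Submodule.mem_orthogonal M F).mp hF _ (h m n)]
  simp

lemma IsGibbs.dense_bounded {b : HilbertBasis ℕ ℂ Fock} {v : ℕ → schwartz} {ε : ℕ → ℝ}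
    {R : ℝ → Fock →L[ℂ] Fock} (h : IsGibbs b v ε R) {p : ℝ} (hp : 0 < p) :
    Dense {F : HS | ∃ B : Fock →L[ℂ] Fock, Represents (R p) ((B : Fock →ₗ[ℂ] Fock).toPMap ⊤) F} := by
  let M : Submodule ℂ HS :=
    { carrier := {F | ∃ B : Fock →L[ℂ] Fock, toCLM F = (R p).comp (B.comp (R p))}
      zero_mem' := ⟨0, by ext1 x; simp⟩
      add_mem' := by
        rintro F G ⟨B, hB⟩ ⟨B', hB'⟩
        exact ⟨B + B', by rw [map_add, hB, hB']; ext1 x; simp⟩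
      smul_mem' := by
        rintro c F ⟨B, hB⟩
        exact ⟨c • B, by rw [map_smul, hB]; ext1 x; simp⟩ }
  have hM : Dense (M : Set HS) := by
    refine dense_of_rankOne_mem b fun m n => ?_
    have hne : ∀ k, ((Real.exp (-p * ε k) : ℝ) : ℂ) ≠ 0 := fun k => by
      exact_mod_cast (Real.exp_pos _).ne'
    -- On eigenvectors `ρ^p` is invertible: a rescaled rank-one `B` satisfies `ρ^p B ρ^p = rankOne
    -- (b m) (b n)`.
    refine ⟨((Real.exp (-p * ε m) : ℂ)⁻¹ * (Real.exp (-p * ε n) : ℂ)⁻¹) •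
      (innerSL ℂ (b n)).smulRight (b m), ?_⟩
    ext1 x
    rw [toCLM_rankOne]
    simp only [ContinuousLinearMap.comp_apply, smul_apply, ContinuousLinearMap.smulRight_apply,
      innerSL_apply_apply, map_smul]
    rw [inner_diag (h.diag p hp.le), h.diag p hp.le, smul_smul, smul_smul]
    congr 1
    have h1 := hne m
    have h2 := hne n
    field_simp
  refine hM.mono ?_
  rintro F ⟨B, hB⟩
  refine ⟨B, represents_iff.mpr fun x => ⟨trivial, ?_⟩⟩
  rw [hB]
  rfl

/-! ### The unitary representation -/

lemma conjHS_eq_of_smul {W W' : Fock ≃ₗᵢ[ℂ] Fock} {c : ℂ} (hc : ‖c‖ = 1)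
    (h : ∀ x, W' x = c • W x) : conjHS W' = conjHS W := by
  have hc0 : c ≠ 0 := norm_ne_zero_iff.mp (by rw [hc]; exact one_ne_zero)
  ext1 F
  apply toCLM_injective
  ext1 x
  rw [toCLM_conjHS, toCLM_conjHS, h, symm_eq_smul hc h, map_smul, map_smul, smul_inv_smul₀ hc0]

lemma implements_mul (g h : Bogoliubov) : Implements (g * h) ((impl h).trans (impl g)) := by
  have e : ((impl h).trans (impl g)).toLinearIsometry =
      (impl g).toLinearIsometry.comp (impl h).toLinearIsometry := rfl
  have h1 : Intertwines (g * h) ((impl h).trans (impl g)).toLinearIsometry := by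
    rw [e]
    exact (impl_implements g).intertwines.comp (impl_implements h).intertwines
  exact fun l => implements_of_intertwines h1
    (fun _ hx => (impl_implements h).symm_mem ((impl_implements g).symm_mem hx)) _

/-- The representation `V_g(F) = W_g F W_g*` on Hilbert-Schmidt operators. -/
def bogoliubovRep : Bogoliubov →* (HS ≃ₗᵢ[ℂ] HS) where
  toFun g := conjHS (impl g)
  map_one' := by
    ext1 F
    apply toCLM_injective
    ext1 x
    rw [toCLM_conjHS, impl_one, impl_one_symm]
    rfl
  map_mul' g h := by
    -- The implementers multiply only up to a phase `c`, which cancels in `W F W*`; the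
    -- representation is genuine, not projective.
    obtain ⟨c, hc, h1⟩ := (implements_mul g h).eq_smul (impl_implements (g * h))
    rw [conjHS_eq_of_smul hc h1]
    ext1 F
    apply toCLM_injective
    ext1 x
    change _ = toCLM (conjHS (impl g) (conjHS (impl h) F)) x
    rw [toCLM_conjHS, toCLM_conjHS, toCLM_conjHS]
    rfl

lemma bogoliubovRep_apply (g : Bogoliubov) (F : HS) : bogoliubovRep g F = conjHS (impl g) F := rfl

lemma tendsto_of_dense {E ι : Type*} [NormedAddCommGroup E] [NormedSpace ℂ E] {l : Filter ι}
    {A : ι → E ≃ₗᵢ[ℂ] E} {s : Set E} (hs : Dense s)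
    (h : ∀ y ∈ s, Tendsto (fun i => A i y) l (𝓝 y)) (x : E) :
    Tendsto (fun i => A i x) l (𝓝 x) := by
  rw [Metric.tendsto_nhds]
  intro ε hε
  obtain ⟨y, hy, hxy⟩ := Metric.mem_closure_iff.mp (hs x) (ε / 3) (by positivity)
  filter_upwards [Metric.tendsto_nhds.mp (h y hy) (ε / 3) (by positivity)] with i hi
  have h1 : dist (A i x) (A i y) = dist x y := (A i).isometry.dist_eq x y
  have h2 := dist_triangle4 (A i x) (A i y) y x
  rw [h1, dist_comm y x] at h2
  linarith

lemma tendsto_bogoliubovRep {ι : Type*} {l : Filter ι} {g : ι → Bogoliubov}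
    (hτ : Tendsto (fun i => (g i).τ) l (𝓝 1)) (hθ : Tendsto (fun i => (g i).θ) l (𝓝 0)) (F : HS) :
    Tendsto (fun i => bogoliubovRep (g i) F) l (𝓝 F) := by
  let M : Submodule ℂ HS :=
    { carrier := {F | Tendsto (fun i => bogoliubovRep (g i) F) l (𝓝 F)}
      zero_mem' := by
        change Tendsto (fun i => bogoliubovRep (g i) 0) l (𝓝 0)
        simp only [map_zero]
        exact tendsto_const_nhds
      add_mem' := fun {F G} hF hG => by
        change Tendsto (fun i => bogoliubovRep (g i) (F + G)) l (𝓝 (F + G))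
        simp only [map_add]
        exact Tendsto.add hF hG
      smul_mem' := fun c F hF => by
        change Tendsto (fun i => bogoliubovRep (g i) (c • F)) l (𝓝 (c • F))
        simp only [map_smul]
        exact Tendsto.const_smul hF c }
  refine tendsto_of_dense (s := M) (dense_of_rankOne_mem numberBasis fun m n => ?_)
    (fun G hG => hG) F
  change Tendsto (fun i => conjHS (impl (g i)) _) l (𝓝 _)
  simp only [conjHS_rankOne]
  exact tendsto_rankOne (tendsto_impl hτ hθ _) (tendsto_impl hτ hθ _)

lemma continuous_bogoliubov : Continuous fun g : Bogoliubov => (g.τ, g.θ) := continuous_induced_dom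

lemma continuous_bogoliubovRep (F : HS) : Continuous fun g => bogoliubovRep g F := by
  rw [continuous_iff_continuousAt]
  intro g₀
  have hcτ : Continuous fun g : Bogoliubov => g.τ := continuous_fst.comp continuous_bogoliubov
  have hcθ : Continuous fun g : Bogoliubov => g.θ := continuous_snd.comp continuous_bogoliubov
  have hτ : Tendsto (fun g => (g₀⁻¹ * g).τ) (𝓝 g₀) (𝓝 1) := by
    have h1 : Continuous fun g => (g₀⁻¹ * g).τ :=
      (continuous_const.mul hcτ).add (continuous_const.mul hcθ)
    have h2 := h1.tendsto g₀
    rwa [inv_mul_cancel] at h2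
  have hθ : Tendsto (fun g => (g₀⁻¹ * g).θ) (𝓝 g₀) (𝓝 0) := by
    have h1 : Continuous fun g => (g₀⁻¹ * g).θ :=
      (continuous_const.mul hcτ).add (continuous_const.mul hcθ)
    have h2 := h1.tendsto g₀
    rwa [inv_mul_cancel] at h2
  -- Continuity at `g₀` follows from continuity at the identity, through `V_g = V_{g₀} V_{g₀⁻¹ g}`.
  have h3 := ((bogoliubovRep g₀).continuous.tendsto F).comp (tendsto_bogoliubovRep hτ hθ F)
  refine h3.congr fun g => ?_
  change (bogoliubovRep g₀ * bogoliubovRep (g₀⁻¹ * g)) F = _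
  rw [← map_mul, mul_inv_cancel_left]

/-! ### The Duhamel integral -/

namespace IsGibbs

variable {b : HilbertBasis ℕ ℂ Fock} {v : ℕ → schwartz} {ε : ℕ → ℝ} {R : ℝ → Fock →L[ℂ] Fock}
  {D : schwartz →ₗ[ℂ] Fock}

/-- A symmetric operator defined on `𝒮` becomes bounded when composed with `ρ^p`. -/
lemma exists_symmetric_comp_R (h : IsGibbs b v ε R)
    (hD : ∀ x y : schwartz, inner ℂ (D x) (y : Fock) = (inner ℂ (x : Fock) (D y) : ℂ))
    {p : ℝ} (hp : 0 < p) : ∃ K : Fock →L[ℂ] Fock, ∀ x, K x = D (h.toS hp x) := by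
  let L : Fock →ₗ[ℂ] Fock :=
    { toFun := fun x => D (h.toS hp x)
      map_add' := fun x y => by
        rw [← map_add]
        exact congrArg D (Subtype.ext (map_add (R p) x y))
      map_smul' := fun c x => by
        rw [RingHom.id_apply, ← map_smul]
        exact congrArg D (Subtype.ext (map_smul (R p) c x)) }
  have hL : ∀ (m : ℕ) x, inner ℂ (b m) (L x) = (inner ℂ (D (v m)) (R p x) : ℂ) := fun m x => by
    have h1 := hD (v m) (h.toS hp x)
    rw [h.coe_v] at h1
    exact h1.symm
  -- The closed graph theorem applies because symmetry moves `D` onto the fixed vectors `v m`,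
  -- leaving coefficients that are continuous in `x`.
  refine ⟨ContinuousLinearMap.ofSeqClosedGraph (g := L) fun u x y hu hy => ?_, fun x => rfl⟩
  refine basis_inner_ext b fun m => ?_
  have h1 := (tendsto_const_nhds (x := b m)).inner (𝕜 := ℂ) hy
  have h2 := (tendsto_const_nhds (x := D (v m))).inner (𝕜 := ℂ) (((R p).continuous.tendsto x).comp hu)
  rw [hL]
  exact tendsto_nhds_unique h1 (h2.congr fun n => (hL m (u n)).symm)

lemma inner_R_symmetric (h : IsGibbs b v ε R)
    (hD : ∀ x y : schwartz, inner ℂ (D x) (y : Fock) = (inner ℂ (x : Fock) (D y) : ℂ))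
    {p q : ℝ} (hp : 0 ≤ p) (hq : 0 < q) (x : Fock) (m : ℕ) :
    HasSum (fun k => ((Real.exp (-p * ε m) * Real.exp (-q * ε k) : ℝ) : ℂ) *
        (inner ℂ (D (v m)) (b k) * inner ℂ (b k) x))
      (inner ℂ (b m) (R p (D (h.toS hq x)))) := by
  have h1 := (b.hasSum_inner_mul_inner (D (v m)) (R q x)).mul_left (Real.exp (-p * ε m) : ℂ)
  have e : inner ℂ (b m) (R p (D (h.toS hq x))) =
      (Real.exp (-p * ε m) : ℂ) * inner ℂ (D (v m)) (R q x) := by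
    rw [inner_diag (h.diag p hp), ← h.coe_v, ← hD]
    rfl
  rw [e]
  refine h1.congr_fun fun k => ?_
  rw [inner_diag (h.diag q hq.le)]
  push_cast
  ring

/-- A bound uniform up to both ends of the Duhamel interval. As `p + q = 1/4`, one exponent is at
least `1/8`: either `D ρ^{1/8}` is bounded, or its adjoint serves as `ρ^{1/8} D`. -/
lemma exists_norm_R_symmetric_le (h : IsGibbs b v ε R)
    (hD : ∀ x y : schwartz, inner ℂ (D x) (y : Fock) = (inner ℂ (x : Fock) (D y) : ℂ)) :
    ∃ C, ∀ p q : ℝ, 0 ≤ p → ∀ hq : 0 < q, p + q = 1 / 4 → ∀ x,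
      ‖R p (D (h.toS hq x))‖ ≤ C * ‖x‖ := by
  obtain ⟨C, hC0, hC⟩ := h.exists_norm_R_le
  obtain ⟨K, hK⟩ := h.exists_symmetric_comp_R hD (p := 1 / 8) (by norm_num)
  refine ⟨C * (‖K‖ * C), fun p q hp hq hpq x => ?_⟩
  rcases le_total (1 / 8) q with h8 | h8
  · have e : D (h.toS hq x) = K (R (q - 1 / 8) x) := by
      rw [hK]
      refine congrArg D (Subtype.ext ?_)
      change R q x = R (1 / 8) (R (q - 1 / 8) x)
      rw [← h.R_add (by norm_num) (by linarith), add_sub_cancel]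
    rw [e]
    calc _ ≤ C * ‖K (R (q - 1 / 8) x)‖ := hC p hp (by linarith) _
      _ ≤ C * (‖K‖ * (C * ‖x‖)) := by
        gcongr
        refine (K.le_opNorm _).trans ?_
        gcongr
        exact hC _ (by linarith) (by linarith) _
      _ = _ := by ring
  · have e : R (1 / 8) (D (h.toS hq x)) = ContinuousLinearMap.adjoint K (R q x) := by
      refine basis_inner_ext b fun m => ?_
      rw [← h.inner_R (by norm_num), ContinuousLinearMap.adjoint_inner_right, hK]
      exact (hD (h.toS _ (b m)) (h.toS hq x)).symm
    have e' : R p (D (h.toS hq x)) = R (p - 1 / 8) (ContinuousLinearMap.adjoint K (R q x)) := by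
      rw [← e, ← h.R_add (by linarith) (by norm_num), sub_add_cancel]
    rw [e']
    calc _ ≤ C * ‖ContinuousLinearMap.adjoint K (R q x)‖ := hC _ (by linarith) (by linarith) _
      _ ≤ C * (‖K‖ * (C * ‖x‖)) := by
        gcongr
        refine (ContinuousLinearMap.le_opNorm _ _).trans ?_
        rw [LinearIsometryEquiv.norm_map]
        gcongr
        exact hC _ hq.le (by linarith) _
      _ = _ := by ring

/-- A summable bound, uniform on `[0, 1]`, for the expansion of the coefficients of
`ρ^{l/4} D ρ^{(1-l)/4} x`. -/
lemma exists_bound_coeff (h : IsGibbs b v ε R) (x : Fock) (m : ℕ) :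
    ∃ B : ℕ → ℝ, Summable B ∧ ∀ k, ∀ l ∈ Set.Icc (0 : ℝ) 1,
      ‖((Real.exp (-(l / 4) * ε m) * Real.exp (-((1 - l) / 4) * ε k) : ℝ) : ℂ) *
        (inner ℂ (D (v m)) (b k) * inner ℂ (b k) x)‖ ≤ B k := by
  obtain ⟨M, hM0, hM⟩ := h.exists_lower_bound
  have hs : Summable fun k => ‖(inner ℂ (D (v m)) (b k) : ℂ)‖ * ‖(inner ℂ (b k) x : ℂ)‖ := by
    refine summable_mul_of_sq ?_ (hasSum_inner_sq b x).summable
    refine (hasSum_inner_sq b (D (v m))).summable.congr fun k => ?_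
    rw [norm_inner_symm]
  refine ⟨_, hs.mul_left (Real.exp M), fun k l hl => ?_⟩
  rw [norm_mul, norm_mul, Complex.norm_real, Real.norm_of_nonneg (by positivity), ← Real.exp_add]
  gcongr
  nlinarith [hM m, hM k, hl.1, hl.2, mul_nonneg hl.1 (neg_le_iff_add_nonneg.mp (hM m)),
    mul_nonneg (sub_nonneg.mpr hl.2) (neg_le_iff_add_nonneg.mp (hM k))]

lemma intervalIntegrable_duhamel (h : IsGibbs b v ε R)
    (hD : ∀ x y : schwartz, inner ℂ (D x) (y : Fock) = (inner ℂ (x : Fock) (D y) : ℂ))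
    (x : Fock) {Φ : ℝ → Fock}
    (hΦ : ∀ l, 0 < l → ∀ hl : 0 < (1 - l) / 4, Φ l = R (l / 4) (D (h.toS hl x))) :
    IntervalIntegrable Φ MeasureTheory.volume 0 1 := by
  obtain ⟨C, hC⟩ := h.exists_norm_R_symmetric_le hD
  -- The endpoints are discarded: at `l = 1` no power of `ρ` acts on `x` before `D`, so the vector
  -- need not lie in `𝒮`.
  rw [intervalIntegrable_iff, Set.uIoc_of_le zero_le_one, integrableOn_Ioc_iff_integrableOn_Ioo]
  have hcoeff : ∀ m, MeasureTheory.AEStronglyMeasurable (fun l => (inner ℂ (b m) (Φ l) : ℂ))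
      (MeasureTheory.volume.restrict (Set.Ioo 0 1)) := fun m => by
    obtain ⟨B, hB, hle⟩ := h.exists_bound_coeff (D := D) x m
    have h1 : ContinuousOn (fun l : ℝ => ∑' k,
        ((Real.exp (-(l / 4) * ε m) * Real.exp (-((1 - l) / 4) * ε k) : ℝ) : ℂ) *
        (inner ℂ (D (v m)) (b k) * inner ℂ (b k) x)) (Set.Ioo 0 1) :=
      continuousOn_tsum (fun k => by fun_prop) hB fun k l hl => hle k l (Set.Ioo_subset_Icc_self hl)
    refine (h1.congr fun l hl => ?_).aestronglyMeasurable measurableSet_Ioo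
    have hl' : 0 < (1 - l) / 4 := by linarith [hl.2]
    simp only [hΦ l hl.1 hl']
    exact (h.inner_R_symmetric hD (by linarith [hl.1]) hl' x m).tsum_eq.symm
  -- Each coefficient is a uniformly convergent series of continuous functions; `Φ` is the pointwise
  -- limit of its finite partial expansions.
  have hmeas : MeasureTheory.AEStronglyMeasurable Φ
      (MeasureTheory.volume.restrict (Set.Ioo 0 1)) := by
    refine aestronglyMeasurable_of_tendsto_ae atTop
      (f := fun (n : ℕ) l => ∑ m ∈ Finset.range n, (inner ℂ (b m) (Φ l) : ℂ) • b m) (fun n => ?_)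
      (Eventually.of_forall fun l => ?_)
    · exact Finset.aestronglyMeasurable_fun_sum _ fun m _ => (hcoeff m).smul_const (b m)
    · have := (b.hasSum_repr (Φ l)).tendsto_sum_nat
      simpa only [b.repr_apply_apply] using this
  refine MeasureTheory.IntegrableOn.of_bound (by simp) hmeas (C * ‖x‖) ?_
  refine (MeasureTheory.ae_restrict_iff' measurableSet_Ioo).mpr (Eventually.of_forall fun l hl => ?_)
  have hl' : 0 < (1 - l) / 4 := by linarith [hl.2]
  rw [hΦ l hl.1 hl']
  exact hC _ _ (by linarith [hl.1]) hl' (by ring) x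

lemma integral_exp_interp (p q : ℝ) :
    ∫ l in (0 : ℝ)..1, (((4 * (q - p)) * (Real.exp (-(l / 4) * (4 * p)) *
      Real.exp (-((1 - l) / 4) * (4 * q))) : ℝ) : ℂ) = ((4 * (Real.exp (-p) - Real.exp (-q)) : ℝ) : ℂ) := by
  rw [intervalIntegral.integral_ofReal]
  congr 1
  have h1 : ∀ l : ℝ, HasDerivAt (fun l : ℝ => 4 * Real.exp (l * (q - p) - q))
      ((4 * (q - p)) * (Real.exp (-(l / 4) * (4 * p)) * Real.exp (-((1 - l) / 4) * (4 * q)))) l :=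
    fun l => by
      refine ((((hasDerivAt_id l).mul_const (q - p)).sub_const q).exp.const_mul 4).congr_deriv ?_
      rw [← Real.exp_add, id, show -(l / 4) * (4 * p) + -((1 - l) / 4) * (4 * q) =
        l * (q - p) - q by ring]
      ring
  rw [intervalIntegral.integral_eq_sub_of_hasDerivAt (fun l _ => h1 l)
    (Continuous.intervalIntegrable (by fun_prop) _ _), one_mul, zero_mul, zero_sub,
    show q - p - q = -p by ring]
  ring

/-- The unbounded operator `G` may be expanded in the eigenbasis because anti-Hermiticity lets it
act on the fixed vector `v m`. -/
lemma hasSum_inner_gen {g : NCPoly}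
    (hG : ∀ x y : schwartz, inner ℂ (act g x : Fock) (y : Fock) =
      (-inner ℂ (x : Fock) (act g y : Fock) : ℂ)) (h : IsGibbs b v ε R) (m : ℕ) (x : schwartz) :
    HasSum (fun k => inner ℂ (b m) (act g (v k) : Fock) * inner ℂ (b k) (x : Fock))
      (inner ℂ (b m) (act g x : Fock) : ℂ) := by
  have h1 := (b.hasSum_inner_mul_inner (act g (v m) : Fock) (x : Fock)).neg
  rw [hG, neg_neg, h.coe_v] at h1
  refine h1.congr_fun fun k => ?_
  rw [← h.coe_v k, hG, h.coe_v m]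
  ring

/-- Evaluation of the Duhamel integral when `D` is the commutator with `g(A, A*)`. -/
lemma integral_duhamel (h : IsGibbs b v ε R)
    (hD : ∀ x y : schwartz, inner ℂ (D x) (y : Fock) = (inner ℂ (x : Fock) (D y) : ℂ))
    {g : NCPoly}
    (hG : ∀ x y : schwartz, inner ℂ (act g x : Fock) (y : Fock) =
      (-inner ℂ (x : Fock) (act g y : Fock) : ℂ))
    (hDG : ∀ m k, inner ℂ (D (v m)) (b k) =
      ((ε k - ε m : ℝ) : ℂ) * inner ℂ (b m) (act g (v k) : Fock))
    (x : schwartz) {Φ : ℝ → Fock}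
    (hΦ : ∀ l, 0 < l → ∀ hl : 0 < (1 - l) / 4, Φ l = R (l / 4) (D (h.toS hl x)))
    {y : schwartz} (hy : (y : Fock) = R (1 / 4) x) :
    ∫ l in (0 : ℝ)..1, Φ l =
      (4 : ℂ) • (R (1 / 4) (act g x : Fock) - (act g y : Fock)) := by
  refine basis_inner_ext b fun m => ?_
  have hint := h.intervalIntegrable_duhamel hD x hΦ
  have e1 : inner ℂ (b m) (∫ l in (0 : ℝ)..1, Φ l) =
      ∫ l in (0 : ℝ)..1, (inner ℂ (b m) (Φ l) : ℂ) :=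
    ((innerSL ℂ (b m)).intervalIntegral_comp_comm hint).symm
  obtain ⟨B, hB, hle⟩ := h.exists_bound_coeff (D := D) x m
  have h1 := intervalIntegral.hasSum_integral_of_dominated_convergence (a := 0) (b := 1)
    (μ := MeasureTheory.volume) (F := fun (k : ℕ) (l : ℝ) =>
      ((Real.exp (-(l / 4) * ε m) * Real.exp (-((1 - l) / 4) * ε k) : ℝ) : ℂ) *
        (inner ℂ (D (v m)) (b k) * inner ℂ (b k) (x : Fock)))
    (f := fun l => (inner ℂ (b m) (Φ l) : ℂ)) (fun k _ => B k)
    (fun k => Continuous.aestronglyMeasurable (by fun_prop))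
    (fun k => Eventually.of_forall fun l hl => by
      rw [Set.uIoc_of_le zero_le_one] at hl
      exact hle k l (Set.Ioc_subset_Icc_self hl))
    (Eventually.of_forall fun l _ => hB) (by simp) (by
      have hne : ∀ᵐ l : ℝ, l ≠ 1 := by
        simp [MeasureTheory.ae_iff, MeasureTheory.measure_singleton]
      filter_upwards [hne] with l hl1 hl
      rw [Set.uIoc_of_le zero_le_one] at hl
      have hl' : 0 < (1 - l) / 4 := by
        have := lt_of_le_of_ne hl.2 hl1
        linarith
      rw [hΦ l hl.1 hl']
      exact h.inner_R_symmetric hD (by linarith [hl.1]) hl' x m)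
  have h2 := ((h.hasSum_inner_gen hG m x).mul_left (Real.exp (-(1 / 4) * ε m) : ℂ)).sub
    (h.hasSum_inner_gen hG m y)
  have h3 := h2.mul_left 4
  rw [e1, inner_smul_right, inner_sub_right, inner_diag (h.diag (1 / 4) (by norm_num))]
  refine h1.unique (h3.congr_fun fun k => ?_)
  -- The factor `ε_k - ε_m` of the commutator makes the integrand an exact derivative, with value `4
  -- (e^{-ε_m/4} - e^{-ε_k/4})`: the matrix of `4 (ρ^{1/4} G - G ρ^{1/4})`.
  have h4 := integral_exp_interp (ε m / 4) (ε k / 4)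
  have e2 : ∀ l : ℝ, ((Real.exp (-(l / 4) * ε m) * Real.exp (-((1 - l) / 4) * ε k) : ℝ) : ℂ) *
        (inner ℂ (D (v m)) (b k) * inner ℂ (b k) (x : Fock)) =
      (((4 * (ε k / 4 - ε m / 4)) * (Real.exp (-(l / 4) * (4 * (ε m / 4))) *
        Real.exp (-((1 - l) / 4) * (4 * (ε k / 4)))) : ℝ) : ℂ) *
        (inner ℂ (b m) (act g (v k) : Fock) * inner ℂ (b k) (x : Fock)) := fun l => by
    rw [hDG, mul_div_cancel₀ (ε m) four_ne_zero, mul_div_cancel₀ (ε k) four_ne_zero]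
    push_cast
    ring
  simp only [e2]
  rw [intervalIntegral.integral_mul_const, h4, hy, inner_diag (h.diag (1 / 4) (by norm_num)),
    show -(1 / 4) * ε m = -(ε m / 4) by ring, show -(1 / 4) * ε k = -(ε k / 4) by ring]
  push_cast
  ring

end IsGibbs

/-! ### Differentiation of the representation -/

lemma ofReal_smul_HS (r : ℝ) (F : HS) : r • F = (r : ℂ) • F := by
  ext1
  funext n
  exact ofReal_smul_fock r ((F : ℕ → Fock) n)

lemma hasDerivAt_HS_iff {f : ℝ → HS} {f' : HS} : HasDerivAt f f' 0 ↔
    Tendsto (fun s : ℝ => ((s⁻¹ : ℝ) : ℂ) • (f s - f 0)) (𝓝[≠] 0) (𝓝 f') := by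
  rw [hasDerivAt_iff_tendsto_slope_zero]
  simp only [zero_add, ofReal_smul_HS]

section Family

variable {γ : ℝ → Bogoliubov} {t u : ℂ}

lemma bogoliubovRep_zero (h0 : γ 0 = 1) (F : HS) : bogoliubovRep (γ 0) F = F := by
  rw [h0, map_one]
  rfl

lemma slope_conjHS_rankOne (W : Fock ≃ₗᵢ[ℂ] Fock) (r : ℝ) (x y : Fock) :
    (r : ℂ) • (conjHS W (rankOne x y) - rankOne x y) =
      rankOne ((r : ℂ) • (W x - x)) (W y) + rankOne x ((r : ℂ) • (W y - y)) := by
  rw [conjHS_rankOne, rankOne_smul_left, rankOne_smul_right, Complex.conj_ofReal, ← smul_add,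
    rankOne_sub_left, rankOne_sub_right, sub_add_sub_cancel]

/-- Differentiability of `s ↦ V_s(F)` for `F` in the domain of the generator. -/
lemma exists_hasDerivAt_bogoliubovRep (h0 : γ 0 = 1) (hτ : HasDerivAt (fun s => (γ s).τ) t 0)
    (hθ : HasDerivAt (fun s => (γ s).θ) u 0) {x y : ℕ → schwartz}
    (h1 : Summable fun n => ‖(act weight (x n) : Fock)‖ * ‖(y n : Fock)‖)
    (h2 : Summable fun n => ‖(x n : Fock)‖ * ‖(act weight (y n) : Fock)‖)
    {F : HS} (hF : HasSum (fun n => rankOne (x n) (y n)) F) :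
    ∃ G, HasDerivAt (fun s => bogoliubovRep (γ s) F) G 0 := by
  obtain ⟨K, hK0, hK⟩ := exists_norm_slope_impl_le h0 hτ hθ
  have hTτ := (tendsto_τ h0 hτ).mono_left (nhdsWithin_le_nhds (s := {0}ᶜ))
  have hTθ := (tendsto_θ h0 hθ).mono_left (nhdsWithin_le_nhds (s := {0}ᶜ))
  have hd : ∀ z : schwartz, Tendsto (fun s : ℝ => ((s⁻¹ : ℝ) : ℂ) • (impl (γ s) z - (z : Fock)))
      (𝓝[≠] 0) (𝓝 (act (gen t u) z : Fock)) := fun z => by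
    have := hasDerivAt_fock_iff.mp (hasDerivAt_impl h0 hτ hθ z)
    rwa [h0, impl_one] at this
  -- Leibniz for a rank-one term puts the difference quotient on one vector at a time; its size is
  -- the weighted norm of that vector times the norm of the other.
  have hT := tendsto_tsum_of_dominated_convergence (𝓕 := 𝓝[≠] (0 : ℝ))
    (f := fun s n => ((s⁻¹ : ℝ) : ℂ) • (conjHS (impl (γ s)) (rankOne (x n) (y n)) -
      rankOne (x n : Fock) (y n)))
    (g := fun n => rankOne (act (gen t u) (x n)) (y n) + rankOne (x n) (act (gen t u) (y n)))
    ((h1.add h2).mul_left K) (fun n => by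
      simp only [slope_conjHS_rankOne]
      exact (tendsto_rankOne (hd _) (tendsto_impl hTτ hTθ _)).add
        (tendsto_rankOne tendsto_const_nhds (hd _))) (by
      filter_upwards [hK] with s hs n
      rw [slope_conjHS_rankOne]
      refine (norm_add_le _ _).trans ?_
      rw [norm_rankOne, norm_rankOne, LinearIsometryEquiv.norm_map, mul_add, ← mul_assoc,
        mul_left_comm K]
      gcongr
      · exact hs (x n)
      · exact hs (y n))
  refine ⟨_, hasDerivAt_HS_iff.mpr (hT.congr fun s => ?_)⟩
  rw [bogoliubovRep_zero h0, bogoliubovRep_apply]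
  have h3 : HasSum (fun n => conjHS (impl (γ s)) (rankOne (x n) (y n))) (conjHS (impl (γ s)) F) :=
    hF.mapL ((conjHS (impl (γ s)) : HS ≃ₗᵢ[ℂ] HS) : HS →L[ℂ] HS)
  exact ((h3.sub hF).const_smul _).tsum_eq

/-- The derivative of `s ↦ V_s(F)` is the commutator with the generator. -/
lemma toCLM_deriv_bogoliubovRep (h0 : γ 0 = 1) (hτ : HasDerivAt (fun s => (γ s).τ) t 0)
    (hθ : HasDerivAt (fun s => (γ s).θ) u 0) {F G : HS}
    (hG : HasDerivAt (fun s => bogoliubovRep (γ s) F) G 0) (x y : schwartz)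
    (hy : toCLM F x = y) :
    toCLM G x = (act (gen t u) y : Fock) - toCLM F (act (gen t u) x) := by
  have hTτ := (tendsto_τ h0 hτ).mono_left (nhdsWithin_le_nhds (s := {0}ᶜ))
  have hTθ := (tendsto_θ h0 hθ).mono_left (nhdsWithin_le_nhds (s := {0}ᶜ))
  have h1 := ((toCLM.flip (x : Fock)).continuous.tendsto G).comp (hasDerivAt_HS_iff.mp hG)
  have h2 := hasDerivAt_fock_iff.mp (hasDerivAt_impl h0 hτ hθ y)
  have h3 := hasDerivAt_fock_iff.mp (hasDerivAt_impl_symm h0 hτ hθ x)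
  -- Second half of the product rule for `W_s F W_s* x`: the quotient falls on `W_s*`, whose
  -- derivative is `-G`, and the outer `W_s` tends to the identity.
  have h4 := tendsto_impl_of_tendsto hTτ hTθ (((toCLM F).continuous.tendsto _).comp h3)
  rw [map_neg] at h4
  have h5 := h2.add h4
  rw [← sub_eq_add_neg] at h5
  refine tendsto_nhds_unique h1 (h5.congr fun s => ?_)
  change _ = toCLM (((s⁻¹ : ℝ) : ℂ) • (bogoliubovRep (γ s) F - bogoliubovRep (γ 0) F)) x
  rw [bogoliubovRep_zero h0, bogoliubovRep_apply, map_smul, map_sub, smul_apply, sub_apply,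
    toCLM_conjHS, h0, impl_one, impl_one_symm, Function.comp_apply, map_smul, map_sub, map_smul,
    map_sub, hy, ← smul_add]
  congr 1
  abel

end Family

lemma hasSum_rankOne (b : HilbertBasis ℕ ℂ Fock) {F : HS}
    (hs : Summable fun n => ‖toCLM F (b n)‖) :
    HasSum (fun n => rankOne (toCLM F (b n)) (b n)) F := by
  have h1 : Summable fun n => rankOne (toCLM F (b n)) (b n) := by
    refine Summable.of_norm (hs.congr fun n => ?_)
    rw [norm_rankOne, b.orthonormal.1, mul_one]
  have h2 : ∑' n, rankOne (toCLM F (b n)) (b n) = F := by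
    apply toCLM_injective
    refine basis_ext b fun m => ?_
    have h3 : HasSum (fun n => toCLM (rankOne (toCLM F (b n)) (b n)) (b m))
        (toCLM (∑' n, rankOne (toCLM F (b n)) (b n)) (b m)) :=
      h1.hasSum.mapL (toCLM.flip (b m))
    refine h3.unique ?_
    have h4 := hasSum_single (f := fun n => toCLM (rankOne (toCLM F (b n)) (b n)) (b m)) m
      fun n hn => by rw [toCLM_rankOne, b.orthonormal.2 hn, zero_smul]
    rwa [toCLM_rankOne, inner_self_eq_norm_sq_to_K, b.orthonormal.1, RCLike.ofReal_one, one_pow,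
      one_smul] at h4
  rw [← h2]
  simpa only [h2] using h1.hasSum

namespace IsGibbs

variable {b : HilbertBasis ℕ ℂ Fock} {v : ℕ → schwartz} {ε : ℕ → ℝ} {R : ℝ → Fock →L[ℂ] Fock}
  {γ : ℝ → Bogoliubov} {t u : ℂ}

lemma toCLM_of_represents (h : IsGibbs b v ε R) {p : ℝ} (hp : 0 < p) {f : NCPoly} {F : HS}
    (hF : Represents (R p) (polyOp f) F) (x : Fock) :
    toCLM F x = h.toS hp (act f (h.toS hp x)) := by
  obtain ⟨h1, h2⟩ := represents_iff.mp hF x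
  rw [h2, polyOp_apply]
  rfl

/-- Expand `F = ∑ rankOne (F b_n) (b_n)`. The left vectors are `e^{-pε_n} ρ^p f v_n`: the outer
`ρ^p` absorbs the weight on the left, and the moments absorb it on the right. -/
lemma exists_hasDerivAt_of_represents (h : IsGibbs b v ε R) (h0 : γ 0 = 1)
    (hτ : HasDerivAt (fun s => (γ s).τ) t 0) (hθ : HasDerivAt (fun s => (γ s).θ) u 0) {p : ℝ}
    (hp : 0 < p) {f : NCPoly} {F : HS} (hF : Represents (R p) (polyOp f) F) :
    ∃ G, HasDerivAt (fun s => bogoliubovRep (γ s) F) G 0 := by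
  let x : ℕ → schwartz := fun n => h.toS hp (act f (h.toS hp (b n)))
  have hx : ∀ n, toCLM F (b n) = x n := fun n => h.toCLM_of_represents hp hF _
  have hxv : ∀ n, x n = (Real.exp (-p * ε n) : ℂ) • h.toS hp (act f (v n)) := fun n => by
    have e : h.toS hp (b n) = (Real.exp (-p * ε n) : ℂ) • v n := Subtype.ext (by
      change R p (b n) = _ • (v n : Fock)
      rw [h.diag p hp.le, h.coe_v])
    refine Subtype.ext ?_
    change R p (act f (h.toS hp (b n)) : Fock) = _ • R p (act f (v n) : Fock)
    rw [e, ← map_smul, map_smul]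
    rfl
  have hle : ∀ w, ∃ C : ℝ, ∀ n, ‖(act w (x n) : Fock)‖ ≤
      C * (Real.exp (-p * ε n) * ‖(act f (v n) : Fock)‖) := fun w => by
    obtain ⟨K, hK⟩ := h.exists_actR hp w
    refine ⟨‖K‖, fun n => ?_⟩
    rw [hxv, map_smul, Submodule.coe_smul, norm_smul, ← hK, Complex.norm_real,
      Real.norm_of_nonneg (Real.exp_nonneg _), mul_left_comm]
    gcongr
    exact K.le_opNorm _
  have h1 : Summable fun n => ‖(act weight (x n) : Fock)‖ * ‖(v n : Fock)‖ := by
    obtain ⟨C, hC⟩ := hle weight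
    refine Summable.of_nonneg_of_le (fun n => by positivity) (fun n => ?_)
      ((h.summable_norm hp f).mul_left C)
    rw [h.norm_v, mul_one]
    exact hC n
  obtain ⟨C, hC⟩ := hle 1
  simp only [map_one, Module.End.one_apply] at hC
  have h2 : Summable fun n => ‖(x n : Fock)‖ * ‖(act weight (v n) : Fock)‖ := by
    refine Summable.of_nonneg_of_le (fun n => by positivity) (fun n => ?_)
      ((h.summable_mul_norm hp f weight).mul_left C)
    calc _ ≤ C * (Real.exp (-p * ε n) * ‖(act f (v n) : Fock)‖) *
          ‖(act weight (v n) : Fock)‖ := by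
          gcongr
          exact hC n
      _ = _ := by ring
  refine exists_hasDerivAt_bogoliubovRep h0 hτ hθ h1 h2 ?_
  have h3 := hasSum_rankOne b (F := F) (by
    simp only [hx]
    exact Summable.of_nonneg_of_le (fun n => norm_nonneg _) hC ((h.summable_norm hp f).mul_left C))
  refine h3.congr_fun fun n => ?_
  rw [hx, h.coe_v]

end IsGibbs

/-! ### The derivative of the transformed Hamiltonian -/

section DerivOp

variable {γ : ℝ → Bogoliubov} {t u : ℂ} {U : Fock →ₗ.[ℂ] Fock}

lemma subst_eq_conjOp (g : Bogoliubov) (T : Fock →ₗ.[ℂ] Fock) : subst g T = conjOp (impl g) T :=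
  subst_eq (impl_implements g) T

lemma app_subst_one (T : Fock →ₗ.[ℂ] Fock) (x : Fock) : app (subst 1 T) x = app T x := by
  rw [subst_eq_conjOp, app_conjOp, impl_one, impl_one_symm]

/-- On `𝒮`, the derivative of the transforms of a symmetric operator is a symmetric operator. -/
lemma exists_derivOp_eq {T : ℝ → Fock →ₗ.[ℂ] Fock} (hT : ∀ s, (T s).IsFormalAdjoint (T s))
    (hd : DifferentiableOnSchwartz T) : ∃ D : schwartz →ₗ[ℂ] Fock,
      (∀ x : schwartz, HasDerivAt (fun s => app (T s) x) (D x) 0) ∧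
      ∀ x y : schwartz, inner ℂ (D x) (y : Fock) = (inner ℂ (x : Fock) (D y) : ℂ) := by
  have happ : ∀ s (x : schwartz), app (T s) x = T s ⟨x, hd.1 s x.2⟩ := fun s x => app_of_mem _
  have hder : ∀ x : schwartz, HasDerivAt (fun s => app (T s) x) (derivOp T x) 0 :=
    fun x => (hd.2 x x.2).hasDerivAt
  refine ⟨{ toFun := fun x => derivOp T x
            map_add' := fun x y => ?_
            map_smul' := fun c x => ?_ }, hder, fun x y => ?_⟩
  · refine (hder (x + y)).unique (((hder x).add (hder y)).congr_of_eventuallyEq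
      (Eventually.of_forall fun s => ?_))
    change app (T s) _ = app (T s) x + app (T s) y
    rw [happ, happ, happ, ← LinearPMap.map_add]
    rfl
  · refine (hder (c • x)).unique (((hder x).const_smul c).congr_of_eventuallyEq
      (Eventually.of_forall fun s => ?_))
    change app (T s) _ = c • app (T s) x
    rw [happ, happ, ← LinearPMap.map_smul]
    rfl
  · have h1 := (hasDerivAt_fock_iff.mp (hder x)).inner (𝕜 := ℂ) (tendsto_const_nhds (x := (y : Fock)))
    have h2 := (tendsto_const_nhds (x := (x : Fock))).inner (𝕜 := ℂ) (hasDerivAt_fock_iff.mp (hder y))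
    refine tendsto_nhds_unique h1 (h2.congr fun s => ?_)
    have h3 : ∀ s, inner ℂ (app (T s) x) (y : Fock) = (inner ℂ (x : Fock) (app (T s) y) : ℂ) :=
      fun s => by
        rw [happ, happ]
        exact hT s ⟨x, hd.1 s x.2⟩ ⟨y, hd.1 s y.2⟩
    rw [inner_smul_left, inner_smul_right, inner_sub_left, inner_sub_right, h3, h3,
      Complex.conj_ofReal]

/-- Matrix elements of `∂_s U(a_s, a_s*)`, in a basis of eigenvectors of `U`. -/
lemma inner_derivOp_subst (hU : U.IsFormalAdjoint U) {b : HilbertBasis ℕ ℂ Fock} {E : ℕ → ℝ}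
    (hb : IsEigenbasis U b E) (h0 : γ 0 = 1) (hτ : HasDerivAt (fun s => (γ s).τ) t 0)
    (hθ : HasDerivAt (fun s => (γ s).θ) u 0) {D : schwartz →ₗ[ℂ] Fock}
    (hS : ∀ s, schwartz ≤ (subst (γ s) U).domain)
    (hd : ∀ x : schwartz, HasDerivAt (fun s => app (subst (γ s) U) x) (D x) 0)
    {v : ℕ → schwartz} (hv : ∀ n, (v n : Fock) = b n) (m n : ℕ) :
    inner ℂ (D (v m)) (b n) =
      ((E n - E m : ℝ) : ℂ) * inner ℂ (b m) (act (gen t u) (v n) : Fock) := by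
  -- The identity differentiated is `⟪U_s v_m, W_s v_n⟫ = E_n ⟪v_m, W_s v_n⟫`, valid because `W_s
  -- v_n` is an eigenvector of `U_s`.
  have h1 := inner_deriv_add h0 hτ hθ (hd (v m)) (v n) ((E n : ℂ) • v n) (y := b m) fun s => by
    obtain ⟨h2, h3⟩ := isEigenbasis_conjOp hb (impl (γ s)) n
    have hm : (v m : Fock) ∈ (conjOp (impl (γ s)) U).domain := by
      rw [← subst_eq_conjOp]
      exact hS s (v m).2
    have h4 := isFormalAdjoint_conjOp hU (impl (γ s)) ⟨v m, hm⟩ ⟨_, h2⟩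
    rw [h3] at h4
    rw [subst_eq_conjOp, app_of_mem hm, ← hv m]
    simp only [mapBasis_apply, ← hv] at h4
    rw [h4, Submodule.coe_smul, map_smul]
  obtain ⟨h5, h6⟩ := hb m
  rw [h0, app_subst_one, hv m, app_of_mem h5, h6, inner_smul_left, Complex.conj_ofReal,
    map_smul, Submodule.coe_smul, inner_smul_right, hv n] at h1
  push_cast
  linear_combination h1

end DerivOp


/-! ### The generator on polynomials -/

section Generator

variable {U : Fock →ₗ.[ℂ] Fock} {γ : ℝ → Bogoliubov}

lemma IsBogoliubovFamily.continuous (hγ : IsBogoliubovFamily γ) : Continuous γ :=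
  continuous_induced_rng.mpr (hγ.diff_τ.continuous.prodMk hγ.diff_θ.continuous)

lemma differentiableOnSchwartz_polyOp (hγ : IsBogoliubovFamily γ) (f : NCPoly) :
    DifferentiableOnSchwartz fun s => polyOp (substPoly (γ s) f) := by
  refine ⟨fun s => le_rfl, fun x hx => ?_⟩
  have h := differentiableAt_act_subst (hγ.diff_τ 0) (hγ.diff_θ 0) f ⟨x, hx⟩
  have e : (fun s => app (polyOp (substPoly (γ s) f)) x) =
      fun s => (act (substPoly (γ s) f) ⟨x, hx⟩ : Fock) := funext fun s => app_polyOp _ ⟨x, hx⟩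
  rwa [← e] at h

lemma app_closure_polyOp (f : NCPoly) {x : Fock} (hx : x ∈ schwartz) :
    ∃ h : x ∈ (polyOp f).closure.domain, (polyOp f).closure ⟨x, h⟩ = app (polyOp f) x := by
  have h := LinearPMap.le_closure (polyOp f)
  refine ⟨h.1 hx, ?_⟩
  rw [app_of_mem (show x ∈ (polyOp f).domain from hx)]
  exact (h.2 (x := ⟨x, hx⟩) rfl).symm

lemma subst_closure (g : Bogoliubov) (f : NCPoly) :
    subst g (polyOp f).closure = (polyOp (substPoly g f)).closure := by
  rw [subst_eq_conjOp, conjOp_closure, ← subst_eq_conjOp, subst_polyOp]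

lemma differentiableOnSchwartz_closure (hγ : IsBogoliubovFamily γ) (f : NCPoly) :
    DifferentiableOnSchwartz fun s => subst (γ s) (polyOp f).closure := by
  simp only [subst_closure]
  refine ⟨fun s x hx => (app_closure_polyOp _ hx).1, fun x hx => ?_⟩
  have e : (fun s => app (polyOp (substPoly (γ s) f)).closure x) =
      fun s => app (polyOp (substPoly (γ s) f)) x := funext fun s => by
    obtain ⟨h1, h2⟩ := app_closure_polyOp (substPoly (γ s) f) hx
    rw [app_of_mem h1, h2]
  rw [e]
  exact (differentiableOnSchwartz_polyOp hγ f).2 x hx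

variable {b : HilbertBasis ℕ ℂ Fock} {v : ℕ → schwartz} {E : ℕ → ℝ}

lemma partitionFn_subst (hT : U.IsFormalAdjoint U) (hb : IsEigenbasis U b E)
    (hs : HasSum (fun n => Real.exp (-E n)) (partitionFn U)) (g : Bogoliubov) :
    partitionFn (subst g U) = partitionFn U := by
  rw [subst_eq_conjOp]
  exact partitionFn_eq (isFormalAdjoint_conjOp hT _) (isEigenbasis_conjOp hb _) hs

/-- The Duhamel integral is a commutator with the generator of the implementing operators. -/
lemma duhamel_eq (hT : U.IsFormalAdjoint U) (hb : IsEigenbasis U b E) {c : ℝ}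
    (hR : IsGibbs b v (fun n => E n + c) (gibbsPow U)) (hγ : IsBogoliubovFamily γ)
    (hd : DifferentiableOnSchwartz fun s => subst (γ s) U) :
    (∀ x, IntervalIntegrable (duhamelIntegrand U γ x) MeasureTheory.volume 0 1) ∧
    ∀ x y : schwartz, (y : Fock) = gibbsPow U (1 / 4) x → duhamel U γ x =
      (4 : ℂ) • (gibbsPow U (1 / 4)
        (act (gen (deriv (fun s => (γ s).τ) 0) (deriv (fun s => (γ s).θ) 0)) x : Fock) -
        (act (gen (deriv (fun s => (γ s).τ) 0) (deriv (fun s => (γ s).θ) 0)) y : Fock)) := by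
  have hτ := (hγ.diff_τ 0).hasDerivAt
  have hθ := (hγ.diff_θ 0).hasDerivAt
  obtain ⟨D, hD1, hD2⟩ := exists_derivOp_eq
    (fun s => by
      rw [subst_eq_conjOp]
      exact isFormalAdjoint_conjOp hT _) hd
  have hΦ : ∀ x l, 0 < l → ∀ hl : 0 < (1 - l) / 4, duhamelIntegrand U γ x l =
      gibbsPow U (l / 4) (D (hR.toS hl x)) := fun x l _ hl => by
    rw [← (hD1 (hR.toS hl x)).deriv]
    rfl
  refine ⟨fun x => hR.intervalIntegrable_duhamel hD2 x (hΦ x), fun x y hy => ?_⟩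
  refine hR.integral_duhamel hD2 (inner_gen hγ.zero hτ hθ) (fun m k => ?_) x (hΦ x) hy
  rw [inner_derivOp_subst hT hb hγ.zero hτ hθ hd.1 hD1 hR.coe_v, add_sub_add_right_eq_sub]

end Generator

end

end BogoliubovRep

/-! ### Assembly of the theorem -/

open BogoliubovRep in
theorem mainTheorem5 (U : Fock →ₗ.[ℂ] Fock) (hU : IsSelfAdjoint U) (hmom : FiniteMoments U) :
    -- the substitution `T(A, A*) ↦ T(a, a*)` is well defined, and literal on polynomials
    (∀ g, (∃ W, Implements g W) ∧ ∀ W, Implements g W → ∀ T, conjOp W T = subst g T) ∧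
    (∀ g f, subst g (polyOp f) = polyOp (substPoly g f)) ∧
    (∀ f, U = (polyOp f).closure → ∀ g, subst g U = (polyOp (substPoly g f)).closure) ∧
    -- the transformed densities are well defined, with the same normalisation
    (∀ g, ∀ p : ℝ, 0 ≤ p → ∃! B, IsExpNeg (subst g U) p B) ∧
    (∀ g, HasSum (fun n => (inner ℂ (numberState n)
        (expNeg (subst g U) 1 (numberState n)) : ℂ)) (partitionFn U : ℂ)) ∧
    0 < partitionFn U ∧
    -- bounded operators and polynomials are in `L₂(ρ)`, and the former are dense
    (∀ B : Fock →L[ℂ] Fock, ∃ F,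
      Represents (gibbsPow U (1 / 4)) ((B : Fock →ₗ[ℂ] Fock).toPMap ⊤) F) ∧
    (∀ f, ∃ F, Represents (gibbsPow U (1 / 4)) (polyOp f) F) ∧
    Dense {F : HS | ∃ B : Fock →L[ℂ] Fock,
      Represents (gibbsPow U (1 / 4)) ((B : Fock →ₗ[ℂ] Fock).toPMap ⊤) F} ∧
    -- the unitary representation
    ∃ V : Bogoliubov →* (HS ≃ₗᵢ[ℂ] HS),
      (∀ F, Continuous fun g => V g F) ∧
      -- `ρ^{1/4} V_g(T) ρ^{1/4} = ρ_g^{1/4} T(a, a*) ρ_g^{1/4}` for all `T` in `L₂(ρ)`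
      (∀ g T F, Represents (gibbsPow U (1 / 4)) T F →
        Represents (gibbsPow (subst g U) (1 / 4)) (subst g T) (V g F)) ∧
      (∀ g f F, Represents (gibbsPow U (1 / 4)) (polyOp f) F →
        Represents (gibbsPow (subst g U) (1 / 4)) (polyOp (substPoly g f)) (V g F)) ∧
      ∀ γ, IsBogoliubovFamily γ →
        -- one-parameter groups of transformations give one-parameter unitary groups
        ((∀ s t, γ (s + t) = γ s * γ t) →
          V (γ 0) = 1 ∧ (∀ s t, V (γ (s + t)) = V (γ s) * V (γ t)) ∧
            ∀ F, Continuous fun s => V (γ s) F) ∧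
        -- polynomials are differentiable along the family
        (∀ f, DifferentiableOnSchwartz fun s => polyOp (substPoly (γ s) f)) ∧
        (∀ f, U = (polyOp f).closure → DifferentiableOnSchwartz fun s => subst (γ s) U) ∧
        -- the generator on polynomials
        (DifferentiableOnSchwartz (fun s => subst (γ s) U) →
          (∀ x, gibbsPow U (1 / 4) x ∈ schwartz) ∧
          (∀ x, IntervalIntegrable (duhamelIntegrand U γ x) MeasureTheory.volume 0 1) ∧
          (∀ x ∈ schwartz, duhamel U γ x ∈ schwartz) ∧
          DifferentiableAt ℝ (fun s => partitionFn (subst (γ s) U)) 0 ∧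
          ∀ f F, Represents (gibbsPow U (1 / 4)) (polyOp f) F →
            ∃ G : HS, HasDerivAt (fun s => V (γ s) F) G 0 ∧
              ∀ x ∈ schwartz, SendsTo G x
                (gibbsPow U (1 / 4) (derivOp (fun s => polyOp (substPoly (γ s) f))
                    (gibbsPow U (1 / 4) x))
                  - (1 / 4 : ℂ) • (duhamel U γ (app (polyOp f) (gibbsPow U (1 / 4) x))
                      + gibbsPow U (1 / 4) (app (polyOp f) (duhamel U γ x)))
                  - ((1 / 2 * (deriv (fun s => partitionFn (subst (γ s) U)) 0
                      / partitionFn U) : ℝ) : ℂ) •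
                    gibbsPow U (1 / 4) (app (polyOp f) (gibbsPow U (1 / 4) x)))) := by
  obtain ⟨b, v, E, hb, hZ, hs, hR⟩ := exists_isGibbs hU hmom
  have hT := isFormalAdjoint_self hU
  have h4 : (0 : ℝ) < 1 / 4 := by norm_num
  have hTg : ∀ g, (subst g U).IsFormalAdjoint (subst g U) := fun g => by
    rw [subst_eq_conjOp]
    exact isFormalAdjoint_conjOp hT _
  have hbg : ∀ g, IsEigenbasis (subst g U) (mapBasis (impl g) b) E := fun g => by
    rw [subst_eq_conjOp]
    exact isEigenbasis_conjOp hb _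
  have hrep : ∀ g T F, Represents (gibbsPow U (1 / 4)) T F →
      Represents (gibbsPow (subst g U) (1 / 4)) (subst g T) (bogoliubovRep g F) :=
    fun g T F hF => by
      rw [subst_eq_conjOp, subst_eq_conjOp, gibbsPow_conjOp hT hb hs h4.le]
      exact represents_conj hF _
  refine ⟨fun g => ⟨exists_implements g, fun W hW T => (subst_eq hW T).symm⟩, subst_polyOp,
    fun f hf g => by rw [hf, subst_closure],
    fun g p hp => existsUnique_isExpNeg (hTg g) (hbg g) hs hp,
    fun g => hasSum_expNeg_trace (hTg g) (hbg g) hs, hZ,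
    hR.exists_represents_bounded h4, hR.exists_represents_polyOp h4, hR.dense_bounded h4,
    bogoliubovRep, continuous_bogoliubovRep, hrep, fun g f F hF => ?_, fun γ hγ => ⟨fun hadd =>
      ⟨by rw [hγ.zero, map_one], fun s t => by rw [hadd, map_mul],
        fun F => (continuous_bogoliubovRep F).comp hγ.continuous⟩,
      differentiableOnSchwartz_polyOp hγ, fun f hf => ?_, fun hd => ?_⟩⟩
  · rw [← subst_polyOp]
    exact hrep g _ F hF
  · rw [hf]
    exact differentiableOnSchwartz_closure hγ f
  -- Unitary conjugation keeps the eigenvalues, so `Z_s` is constant and the term in `Z'` is zero.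
  have hconst : (fun s => partitionFn (subst (γ s) U)) = fun _ => partitionFn U :=
    funext fun s => partitionFn_subst hT hb hs (γ s)
  obtain ⟨hint, hduh⟩ := duhamel_eq hT hb hR hγ hd
  have hτ := (hγ.diff_τ 0).hasDerivAt
  have hθ := (hγ.diff_θ 0).hasDerivAt
  refine ⟨hR.R_mem h4, hint, fun x hx => ?_, ?_, fun f F hF => ?_⟩
  · rw [hduh ⟨x, hx⟩ (hR.toS h4 x) rfl]
    exact schwartz.smul_mem _ (schwartz.sub_mem (hR.R_mem h4 _) (Subtype.property _))
  · rw [hconst]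
    exact differentiableAt_const _
  obtain ⟨G, hG⟩ := hR.exists_hasDerivAt_of_represents hγ.zero hτ hθ h4 hF
  refine ⟨G, hG, fun x hx => sendsTo_iff.mpr ?_⟩
  have hFx := hR.toCLM_of_represents h4 hF
  have e1 := toCLM_deriv_bogoliubovRep hγ.zero hτ hθ hG ⟨x, hx⟩ _ (hFx x)
  set g := gen (deriv (fun s => (γ s).τ) 0) (deriv (fun s => (γ s).θ) 0) with hg
  have e2 : derivOp (fun s => polyOp (substPoly (γ s) f)) (gibbsPow U (1 / 4) x) =
      (act g (act f (hR.toS h4 x)) - act f (act g (hR.toS h4 x)) : Fock) := by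
    rw [← (hasDerivAt_act_subst hγ.zero hτ hθ f (hR.toS h4 x)).deriv]
    exact congrArg (fun F : ℝ → Fock => deriv F 0)
      (funext fun s => app_polyOp _ (hR.toS h4 x))
  have e3 : app (polyOp f) (gibbsPow U (1 / 4) x) = (act f (hR.toS h4 x) : Fock) :=
    app_polyOp f (hR.toS h4 x)
  have e4 := hduh (act f (hR.toS h4 x)) (hR.toS h4 (act f (hR.toS h4 x))) rfl
  have e5 : app (polyOp f) (duhamel U γ x) = ((4 : ℂ) • (act f (hR.toS h4 (act g ⟨x, hx⟩)) -
      act f (act g (hR.toS h4 x))) : Fock) := by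
    have e6 := hduh ⟨x, hx⟩ (hR.toS h4 x) rfl
    have e7 : duhamel U γ x = (((4 : ℂ) • (hR.toS h4 (act g ⟨x, hx⟩) -
      act g (hR.toS h4 x)) : schwartz) : Fock) := e6
    rw [e7, app_polyOp, map_smul, map_sub]
    rfl
  -- With `R = ρ^{1/4}` and `L = 4 (R G - G R)`, the claim is `G R f R - R f R G = R [G, f] R - (R G
  -- - G R) f R - R f (R G - G R)`.
  rw [e1, hFx, e2, e3, e4, e5, hconst, deriv_const]
  simp only [map_sub, map_smul, zero_div, mul_zero, Complex.ofReal_zero, zero_smul, sub_zero]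
  change _ - gibbsPow U (1 / 4) (act f (hR.toS h4 (act g ⟨x, hx⟩)) : Fock) = _
  module
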